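/- **Setting.** Let $S_n$ act on $\{1,\dots,n\}$, with adjacent transpositions $s_1,\dots,s_{n-1}$ and Coxeter length $\ell$; $s_i$ is a right descent of $w$ if it is the last letter of some reduced word of $w$, and a right ascent otherwise. Let $w\in S_n$ have exactly one right ascent $s_z$, let $W_J$ be the subgroup generated by the $s_i$ with $i\ne z$, and write $w=vw_0^J$, where $v$ has minimal length in $vW_J$ and $w_0^J$ is the longest element of $W_J$; assume $v\neq 1$. Fix a reduced word $\mathsf v$ of $v$. Its heap is the set of positions of $\mathsf v$ with the transitive closure of the relation: $i\prec j$ ($i$ lies below $j$) if $i>j$ and $\mathsf v_i,\mathsf v_j$ do not commute. A position with letter $s_c$ lies in column $c$. Let $\mathbf P=(P_1,\dots,P_p)$ list all peaks (maximal elements) of the heap, each once, in any order, so $p\ge 1$. Let $R_j$ be the set of entries that are below or equal to $P_j$ but not below or equal to any $P_k$ with $k>j$. It is a rectangle with a unique lowest element $b_j$, a unique leftmost and a unique rightmost element. Let $d_j$ be the column of $b_j$ (one has $d_p=z$), let $\mathrm{ldim}(j)$ be the column of the leftmost element of $R_j$ minus $1$, and let $\mathrm{rdim}(j)$ be the column of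 the rightmost element plus $1$. Put $\mathrm{lpred}(j)=k$ if $k<j$ and $b_k$ covers the leftmost element of $R_j$ and lies in column $\mathrm{ldim}(j)$; put $\mathrm{rpred}(j)=k$ if $k<j$ and $b_k$ covers the rightmost element of $R_j$ and lies in column $\mathrm{rdim}(j)$; if there is no such $k$ they are undefined. Let $E_k=\mathrm{span}(e_1,\dots,e_k)\subset\mathbb C^n$. The Zelevinsky variety $Z_{\mathbf P}$ is the set of points $[W_1,\dots,W_{p-1},F_1,\dots,F_{n-1}]$ of $\prod_{j<p}\mathrm{Gr}(d_j,n)\times\prod_{k=1}^{n-1}\mathrm{Gr}(k,n)$ such that $F_1\subset\dots\subset F_{n-1}$ and, with $W_p:=F_z$, for all $1\le j\le p$ $$L_j\subseteq W_j\subseteq U_j,$$ where $L_j=W_{\mathrm{lpred}(j)}$ (or $E_{\mathrm{ldim}(j)}$ if $\mathrm{lpred}(j)$ is undefined) and $U_j=W_{\mathrm{rpred}(j)}$ (or $E_{\mathrm{rdim}(j)}$ if $\mathrm{rpred}(j)$ is undefined). Let $T=(\mathbb C^*)^n$ be the torus of diagonal matrices, and let $\mathbb C^*$ act by $t\cdot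 e_i=t^{n-i}e_i$. **The construction.** To a $T$-fixed point of $Z_{\mathbf P}$ attach $\boldsymbol\tau=(\tau^{(1)},\dots,\tau^{(p)};x_\tau)$ as follows. Let $A(j)=\{k: e_k\in U_j\}\setminus\{k:e_k\in L_j\}$, $T(j)=\{k:e_k\in W_j\}\setminus\{k:e_k\in L_j\}$ and $D(j)=A(j)\setminus T(j)$. Then $\tau^{(j)}$ is the partition whose $k$-th part is $\#\{m\in D(j): m<T(j)_k\}$, where $T(j)_k$ is the $k$-th largest element of $T(j)$. Let $u_\tau\in S_n$ be the permutation with $u_\tau(1)<\dots<u_\tau(z)$, $u_\tau(z+1)<\dots<u_\tau(n)$ and $F_z=\mathrm{span}(e_{u_\tau(1)},\dots,e_{u_\tau(z)})$. Then $x_\tau$ is the permutation in $S_z\times S_{n-z}$ with $F_j=\mathrm{span}(e_{u_\tau x_\tau(1)},\dots,e_{u_\tau x_\tau(j)})$ for all $j$. Let $\mathcal T_{\mathbf P}$ be the set of all $(\tau^{(1)},\dots,\tau^{(p)};x)$ where $\tau^{(j)}$ is a partition with at most $d_j-\mathrm{ldim}(j)$ parts, each of size at most $\mathrm{rdim}(j)-d_j$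 (that is, $\tau^{(j)}$ fits inside $R_j$), and $x\in S_z\times S_{n-z}$. **Theorem.** 1. The points of $Z_{\mathbf P}$ fixed by $T$ are exactly those fixed by $\mathbb C^*$. The construction is well defined (each such point has exactly one tuple, and the tuple lies in $\mathcal T_{\mathbf P}$), and it is a bijection from the set of $T$-fixed points of $Z_{\mathbf P}$ onto $\mathcal T_{\mathbf P}$. 2. For $\boldsymbol\tau\in\mathcal T_{\mathbf P}$ with corresponding fixed point $p_{\boldsymbol\tau}$, the cell $C_{\boldsymbol\tau}=\{y\in Z_{\mathbf P}:\lim_{t\to0}t\cdot y=p_{\boldsymbol\tau}\}$ (limit under the $\mathbb C^*$-action) has dimension, as a subspace of the product of Grassmannians in the Zariski topology, $$\dim C_{\boldsymbol\tau}=\sum_{j=1}^p|\tau^{(j)}|+\ell(x_\tau).$$ -/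

import Mathlib

open Filter Topology

namespace Zel

/-! ### The symmetric group as a Coxeter group

Positions and values are the elements of `Fin n`, so `i : Fin n` stands for `i + 1` in one-line
notation, and `i : Fin (n - 1)` indexes the generator usually written `s_{i+1}`. -/

/-- The adjacent transposition exchanging `i` and `i + 1`. -/
def s {n : ℕ} (i : Fin (n - 1)) : Equiv.Perm (Fin n) :=
  Equiv.swap ⟨i, by omega⟩ ⟨i + 1, by omega⟩

/-- The permutation expressed by a word in the generators. -/
def wordProd {n : ℕ} (wd : List (Fin (n - 1))) : Equiv.Perm (Fin n) := (wd.map s).prod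

/-- Coxeter length: the minimal length of an expression. -/
noncomputable def len {n : ℕ} (w : Equiv.Perm (Fin n)) : ℕ :=
  sInf {k | ∃ wd : List (Fin (n - 1)), wd.length = k ∧ wordProd wd = w}

/-- `wd` is a reduced expression for `w`. -/
def IsReducedWord {n : ℕ} (wd : List (Fin (n - 1))) (w : Equiv.Perm (Fin n)) : Prop :=
  wordProd wd = w ∧ wd.length = len w

/-- The generator `s i` is the last factor of some reduced expression for `w`. -/
def IsRightDescent {n : ℕ} (w : Equiv.Perm (Fin n)) (i : Fin (n - 1)) : Prop :=
  ∃ wd : List (Fin (n - 1)), IsReducedWord (wd ++ [i]) w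

def IsRightAscent {n : ℕ} (w : Equiv.Perm (Fin n)) (i : Fin (n - 1)) : Prop :=
  ¬ IsRightDescent w i

/-- The parabolic subgroup `W_J` for `J = S \ {s_z}`. -/
def parabolic {n : ℕ} (z : Fin (n - 1)) : Subgroup (Equiv.Perm (Fin n)) :=
  Subgroup.closure (s '' {i | i ≠ z})

/-- `w = v * w₀` where `v` has minimal length in its coset `v W_J` and `w₀` is the longest element
of `W_J`. -/
def IsParabolicDecomposition {n : ℕ} (z : Fin (n - 1)) (w v w₀ : Equiv.Perm (Fin n)) : Prop :=
  w = v * w₀ ∧ (∀ u ∈ parabolic z, len v ≤ len (v * u)) ∧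
    w₀ ∈ parabolic z ∧ ∀ u ∈ parabolic z, len u ≤ len w₀

/-- The subgroup `S_z × S_{n-z}`: the permutations preserving the set of the first positions
(those `i : Fin n` with `i ≤ z`, which are as many as the dimension of `F_z`). -/
def young {n : ℕ} (z : Fin (n - 1)) : Set (Equiv.Perm (Fin n)) :=
  {x | ∀ i : Fin n, (x i : ℕ) ≤ z ↔ (i : ℕ) ≤ z}

/-! ### Heaps, peaks and rectangles -/

section Heap

variable {n : ℕ} (wd : List (Fin (n - 1)))

/-- The strict heap order on the positions of a word: `heapLT wd a b` says that `a` lies below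
`b`. The left end of the word is at the top. -/
def heapLT (a b : Fin wd.length) : Prop :=
  Relation.TransGen
    (fun i j : Fin wd.length => j < i ∧ ¬ Commute (s (wd.get i)) (s (wd.get j))) a b

def heapLE (a b : Fin wd.length) : Prop := a = b ∨ heapLT wd a b

def heapCovBy (a b : Fin wd.length) : Prop :=
  heapLT wd a b ∧ ¬ ∃ c, heapLT wd a c ∧ heapLT wd c b

/-- The column of a heap entry, numbered from `1` to `n - 1`. -/
def col (a : Fin wd.length) : ℕ := (wd.get a : ℕ) + 1

def IsPeak (a : Fin wd.length) : Prop := ∀ b, ¬ heapLT wd a b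

/-- `P` is a complete list, without repetition, of the peaks. There are `p = m + 1` of them. -/
def IsPeakOrdering {m : ℕ} (P : Fin (m + 1) → Fin wd.length) : Prop :=
  Function.Injective P ∧ Set.range P = {a | IsPeak wd a}

variable {m : ℕ} (P : Fin (m + 1) → Fin wd.length)

/-- The rectangle `R_j`: the entries below (or equal to) `P j`, but not below any later peak. -/
def rect (j : Fin (m + 1)) : Set (Fin wd.length) :=
  {a | heapLE wd a (P j) ∧ ∀ k, j < k → ¬ heapLE wd a (P k)}

/-- `b_j`: the lowest element of `R_j`. -/
noncomputable def bottom (j : Fin (m + 1)) : Fin wd.length :=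
  @Classical.epsilon _ ⟨P j⟩ fun a => a ∈ rect wd P j ∧ ∀ c ∈ rect wd P j, heapLE wd a c

noncomputable def leftmost (j : Fin (m + 1)) : Fin wd.length :=
  @Classical.epsilon _ ⟨P j⟩ fun a => a ∈ rect wd P j ∧ ∀ c ∈ rect wd P j, col wd a ≤ col wd c

noncomputable def rightmost (j : Fin (m + 1)) : Fin wd.length :=
  @Classical.epsilon _ ⟨P j⟩ fun a => a ∈ rect wd P j ∧ ∀ c ∈ rect wd P j, col wd c ≤ col wd a

open Classical in
/-- `lpred j = some k` if the leftmost element of `R_j` is immediately south-east of `b_k`, with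
`k < j`; `none` if there is no such `k`. -/
noncomputable def lpred (j : Fin (m + 1)) : Option (Fin (m + 1)) :=
  if h : ∃ k, k < j ∧ heapCovBy wd (leftmost wd P j) (bottom wd P k) ∧
      col wd (bottom wd P k) + 1 = col wd (leftmost wd P j)
  then some h.choose else none

open Classical in
/-- `rpred j = some k` if the rightmost element of `R_j` is immediately south-west of `b_k`, with
`k < j`; `none` if there is no such `k`. -/
noncomputable def rpred (j : Fin (m + 1)) : Option (Fin (m + 1)) :=
  if h : ∃ k, k < j ∧ heapCovBy wd (rightmost wd P j) (bottom wd P k) ∧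
      col wd (bottom wd P k) = col wd (rightmost wd P j) + 1
  then some h.choose else none

/-- The column just left of `R_j`. It is the column of `b_k` if `lpred j = some k`, and otherwise
the column of a valley (possibly an empty column, or column `0`, left of the whole heap). -/
noncomputable def ldim (j : Fin (m + 1)) : ℕ := col wd (leftmost wd P j) - 1

/-- The column just right of `R_j`. -/
noncomputable def rdim (j : Fin (m + 1)) : ℕ := col wd (rightmost wd P j) + 1

/-- `d_j`: the column of `b_j`. -/
noncomputable def d (j : Fin (m + 1)) : ℕ := col wd (bottom wd P j)

end Heap

/-! ### Products of Grassmannians -/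

/-- Complex `n`-space. The inner product is used only to describe the classical topology of
Grassmannians. -/
abbrev V (n : ℕ) : Type := EuclideanSpace ℂ (Fin n)

/-- The `i`-th coordinate vector. -/
noncomputable abbrev e {n : ℕ} (i : Fin n) : V n := EuclideanSpace.single i 1

/-- The coordinate subspace spanned by the `e i` with `i ∈ S`. -/
noncomputable def coordSpan {n : ℕ} (S : Set (Fin n)) : Submodule ℂ (V n) :=
  Submodule.span ℂ (e '' S)

/-- `E_k`, the span of the first `k` coordinate vectors. -/
noncomputable def E (n k : ℕ) : Submodule ℂ (V n) := coordSpan {i : Fin n | (i : ℕ) < k}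

/-- The Grassmannian of `k`-dimensional subspaces of `ℂⁿ`. -/
abbrev Gr (n k : ℕ) : Type := {U : Submodule ℂ (V n) // Module.finrank ℂ U = k}

section Zariski

variable {n : ℕ} {ι : Type} {δ : ι → ℕ}

/-- `A i` is a basis of the `i`-th subspace of the configuration `q`. -/
def IsFrame (A : (i : ι) → Fin (δ i) → V n) (q : (i : ι) → Gr n (δ i)) : Prop :=
  ∀ i, Submodule.span ℂ (Set.range (A i)) = (q i).1

/-- Polynomials in the matrix entries of a family of frames. -/
abbrev FramePoly (n : ℕ) (δ : ι → ℕ) : Type := MvPolynomial (Σ i : ι, Fin n × Fin (δ i)) ℂ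

/-- The value of a polynomial at the matrix entries of a family of frames. -/
noncomputable def evalFrame (A : (i : ι) → Fin (δ i) → V n) (f : FramePoly n δ) : ℂ :=
  MvPolynomial.eval (fun x => A x.1 x.2.2 x.2.1) f

/-- The Zariski topology on a product of Grassmannians, seen as the quotient of the variety of
families of frames by the product of general linear groups acting by change of basis: a set is
closed if the frames of its points are cut out, among all frames, by polynomials. -/
@[reducible] def zariski (n : ℕ) (δ : ι → ℕ) : TopologicalSpace ((i : ι) → Gr n (δ i)) :=
  TopologicalSpace.ofClosed
    {S | ∃ I : Set (FramePoly n δ), ∀ q A, IsFrame A q → (q ∈ S ↔ ∀ f ∈ I, evalFrame A f = 0)}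
    ⟨{1}, fun q A _ => by simp [evalFrame]⟩
    (by
      intro 𝒮 h
      have h' : ∀ S ∈ 𝒮, ∃ I : Set (FramePoly n δ), ∀ q A, IsFrame A q →
          (q ∈ S ↔ ∀ f ∈ I, evalFrame A f = 0) := fun S hS => h hS
      choose! I hI using h'
      refine ⟨⋃ S ∈ 𝒮, I S, fun q A hA => ?_⟩
      simp only [Set.mem_sInter, Set.mem_iUnion, exists_prop]
      constructor
      · rintro hq f ⟨S, hS, hf⟩
        exact (hI S hS q A hA).1 (hq S hS) f hf
      · intro hq S hS
        exact (hI S hS q A hA).2 fun f hf => hq f ⟨S, hS, hf⟩)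
    (by
      rintro S ⟨I, hI⟩ T ⟨K, hK⟩
      refine ⟨{h | ∃ f ∈ I, ∃ g ∈ K, h = f * g}, fun q A hA => ?_⟩
      rw [Set.mem_union, hI q A hA, hK q A hA]
      constructor
      · rintro (h | h) _ ⟨f, hf, g, hg, rfl⟩
        · simp [evalFrame, show MvPolynomial.eval _ f = 0 from h f hf]
        · simp [evalFrame, show MvPolynomial.eval _ g = 0 from h g hg]
      · intro h
        by_contra hc
        push Not at hc
        obtain ⟨⟨f, hf, hf0⟩, g, hg, hg0⟩ := hc
        have := h _ ⟨f, hf, g, hg, rfl⟩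
        simp only [evalFrame, map_mul, mul_eq_zero] at this hf0 hg0
        exact this.elim hf0 hg0)

/-- The dimension of a subset of a product of Grassmannians: the Krull dimension of the subset with
its Zariski topology. -/
noncomputable def zariskiDim (S : Set ((i : ι) → Gr n (δ i))) : WithBot ℕ∞ :=
  letI := zariski n δ
  topologicalKrullDim S

/-- The diagonal endomorphism `e i ↦ c i • e i`. -/
noncomputable def diag (c : Fin n → ℂ) : V n →ₗ[ℂ] V n :=
  Matrix.toEuclideanLin (Matrix.diagonal c)

/-- `q` is fixed by the torus of all invertible diagonal matrices. -/
def IsFixed (q : (i : ι) → Gr n (δ i)) : Prop :=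
  ∀ t : Fin n → ℂˣ, ∀ i, (q i).1.map (diag fun k => (t k : ℂ)) = (q i).1

/-- The subspace `t · U`, for the action with `t · e_i = t^(n-i) e_i`, `i = 1, …, n`. -/
noncomputable def actC (t : ℂ) (U : Submodule ℂ (V n)) : Submodule ℂ (V n) :=
  U.map (diag fun k => t ^ (n - 1 - (k : ℕ)))

/-- `q` is fixed by the one-dimensional torus acting by `t · e_i = t^(n-i) e_i`. -/
def IsFixedC (q : (i : ι) → Gr n (δ i)) : Prop :=
  ∀ t : ℂˣ, ∀ i, actC (t : ℂ) (q i).1 = (q i).1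

/-- `lim_{t → 0} t · y = q`. Subspaces converge if their orthogonal projections do. -/
def FlowsTo (y q : (i : ι) → Gr n (δ i)) : Prop :=
  ∀ i, Tendsto (fun t : ℂ => (actC t (y i).1).starProjection) (𝓝[≠] 0)
    (𝓝 (q i).1.starProjection)

end Zariski

/-! ### The Zelevinsky variety -/

section Variety

variable {n : ℕ} (z : Fin (n - 1)) (wd : List (Fin (n - 1))) {m : ℕ}
  (P : Fin (m + 1) → Fin wd.length)

/-- The dimensions of the subspaces `W_1, …, W_{p-1}, F_1, …, F_{n-1}`, where `p = m + 1`. -/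
noncomputable def confDim : Fin m ⊕ Fin (n - 1) → ℕ
  | Sum.inl j => d wd P j.castSucc
  | Sum.inr k => (k : ℕ) + 1

/-- The points `[W_1, …, W_{p-1}, F_1, …, F_{n-1}]` of the product of Grassmannians. -/
abbrev Conf : Type := (i : Fin m ⊕ Fin (n - 1)) → Gr n (confDim wd P i)

variable {wd P}

/-- The subspaces of the flag; `flag q k` has dimension `k + 1`. -/
def flag (q : Conf wd P) (k : Fin (n - 1)) : Submodule ℂ (V n) := (q (Sum.inr k)).1

/-- `W_1, …, W_{p-1}`, and `W_p = F_z`. -/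
def W (q : Conf wd P) (j : Fin (m + 1)) : Submodule ℂ (V n) :=
  Fin.snoc (α := fun _ => Submodule ℂ (V n)) (fun i : Fin m => (q (Sum.inl i)).1) (flag q z) j

/-- The subspace required to lie in `W_j`. -/
noncomputable def lower (q : Conf wd P) (j : Fin (m + 1)) : Submodule ℂ (V n) :=
  match lpred wd P j with
  | some k => W z q k
  | none => E n (ldim wd P j)

/-- The subspace required to contain `W_j`. -/
noncomputable def upper (q : Conf wd P) (j : Fin (m + 1)) : Submodule ℂ (V n) :=
  match rpred wd P j with
  | some k => W z q k
  | none => E n (rdim wd P j)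

variable (wd P) in
/-- The Zelevinsky variety `Z_P`. -/
def variety : Set (Conf wd P) :=
  {q | (∀ j, lower z q j ≤ W z q j ∧ W z q j ≤ upper z q j) ∧
    ∀ k k' : Fin (n - 1), (k' : ℕ) = k + 1 → flag q k ≤ flag q k'}

variable (wd P) in
/-- The torus-fixed points of `Z_P`. -/
def fixedPoints : Set (Conf wd P) := {q | q ∈ variety z wd P ∧ IsFixed q}

/-- The Białynicki-Birula cell of a fixed point `q`. -/
def cell (q : Conf wd P) : Set (Conf wd P) := {y | y ∈ variety z wd P ∧ FlowsTo y q}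

/-! ### The tuple of a fixed point -/

open Classical in
/-- The indices of the coordinate vectors contained in `U`. -/
noncomputable def coordSet (U : Submodule ℂ (V n)) : Finset (Fin n) :=
  Finset.univ.filter fun k => e k ∈ U

noncomputable def A (q : Conf wd P) (j : Fin (m + 1)) : Finset (Fin n) :=
  coordSet (upper z q j) \ coordSet (lower z q j)

noncomputable def T (q : Conf wd P) (j : Fin (m + 1)) : Finset (Fin n) :=
  coordSet (W z q j) \ coordSet (lower z q j)

noncomputable def D (q : Conf wd P) (j : Fin (m + 1)) : Finset (Fin n) := A z q j \ T z q j

/-- The number of elements of `D` smaller than the `k`-th largest element of `T`, counting `k`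
from `0`; it is `0` if `T` has at most `k` elements. -/
def part (T D : Finset (Fin n)) (k : ℕ) : ℕ :=
  if h : k < T.card then
    (D.filter fun x => x < T.orderEmbOfFin rfl (Fin.rev ⟨k, h⟩)).card
  else 0

theorem part_antitone (T D : Finset (Fin n)) : Antitone (part T D) := by
  intro a b hab
  unfold part
  by_cases hb : b < T.card
  · have ha : a < T.card := lt_of_le_of_lt hab hb
    rw [dif_pos hb, dif_pos ha]
    refine Finset.card_le_card fun x hx => ?_
    rw [Finset.mem_filter] at hx ⊢
    refine ⟨hx.1, lt_of_lt_of_le hx.2 ?_⟩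
    rw [OrderEmbedding.le_iff_le, Fin.rev_le_rev]
    exact hab
  · rw [dif_neg hb]
    exact Nat.zero_le _

theorem part_le (T D : Finset (Fin n)) (k : ℕ) : part T D k ≤ D.card := by
  unfold part
  split_ifs
  · exact Finset.card_filter_le _ _
  · exact Nat.zero_le _

/-- The partition (as a Young diagram) whose `k`-th row has `part T D k` boxes. -/
def diagram (T D : Finset (Fin n)) : YoungDiagram where
  cells := (Finset.range T.card ×ˢ Finset.range D.card).filter fun c => c.2 < part T D c.1
  isLowerSet := by
    rintro ⟨a, b⟩ ⟨a', b'⟩ h hm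
    obtain ⟨h1, h2⟩ : a' ≤ a ∧ b' ≤ b := h
    simp only [Finset.coe_filter, Finset.mem_product, Finset.mem_range, Set.mem_ofPred_eq] at hm ⊢
    have := part_antitone T D h1
    omega

theorem mem_diagram (T D : Finset (Fin n)) (c : ℕ × ℕ) :
    c ∈ diagram T D ↔ c.2 < part T D c.1 := by
  rw [← YoungDiagram.mem_cells]
  simp only [diagram, Finset.mem_filter, Finset.mem_product, Finset.mem_range]
  refine ⟨fun h => h.2, fun h => ⟨⟨?_, lt_of_lt_of_le h (part_le T D c.1)⟩, h⟩⟩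
  by_contra hc
  simp [part, hc] at h

/-- `u` is the grassmannian permutation with `U = span (e_{u(1)}, …, e_{u(z)})`: increasing on the
first block of positions and on the remaining ones. -/
def IsGrassmannianFor (u : Equiv.Perm (Fin n)) (U : Submodule ℂ (V n)) : Prop :=
  (∀ i i' : Fin n, i < i' → ((i' : ℕ) ≤ z ∨ (z : ℕ) < i) → u i < u i') ∧
    U = coordSpan (u '' {i : Fin n | (i : ℕ) ≤ z})

/-- The tuple `σ = (τ⁽¹⁾, …, τ⁽ᵖ⁾; x)` is the one attached to the fixed point `q`. -/
def Encodes (q : Conf wd P) (σ : (Fin (m + 1) → YoungDiagram) × Equiv.Perm (Fin n)) : Prop :=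
  (∀ j, σ.1 j = diagram (T z q j) (D z q j)) ∧ σ.2 ∈ young z ∧
    ∃ u : Equiv.Perm (Fin n), IsGrassmannianFor z u (flag q z) ∧
      ∀ k : Fin (n - 1), flag q k = coordSpan ((u * σ.2) '' {i : Fin n | (i : ℕ) ≤ k})

variable (wd P) in
/-- The index set `T_P`: the `j`-th partition has at most `d j - ldim j` parts, each of size at
most `rdim j - d j`, and the permutation lies in `S_z × S_{n-z}`. -/
def indexSet : Set ((Fin (m + 1) → YoungDiagram) × Equiv.Perm (Fin n)) :=
  {σ | (∀ j, ∀ c ∈ σ.1 j, c.1 + ldim wd P j < d wd P j ∧ c.2 + d wd P j < rdim wd P j) ∧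
    σ.2 ∈ young z}

end Variety

end Zel

/-!
A permutation `v` of minimal length in its coset `v W_J` is grassmannian: it is increasing on the
positions `≤ z` and on the positions `> z` (`increasingOnBlocks_of_minimal`). The letter at each
position of a reduced word of `v` creates one inversion of `v`, a pair of positions in the two
blocks, and recording how far these positions are from the boundary of the blocks turns the heap into
a Young diagram, with the componentwise order (`heapLT_iff`) and with columns given by content
(`col_add_box_fst`). Peaks become the corners of the diagram, and `R_j` is a rectangle whose
lowest, leftmost and rightmost boxes are explicit.

The geometric input from this combinatorics is `lowerOf_le_upperOf`: the conditions on
`W_1, …, W_{j-1}` imply that the lower bound for `W_j` is contained in its upper bound. When the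
rectangles are removed one after the other, each remaining peak has a valley on its left and one on
its right, and the subspaces attached to these two valleys stay nested, because removing `R_j` either
leaves a valley unchanged or replaces it by the bottom of `R_j`, to which `W_j` is attached. Hence the
Zelevinsky variety is the space of points of a tower of Grassmannian bundles (`varietyTower`), whose
last steps choose the members `F_k` of the flag with `k ≠ z`.

Every subspace has a unique reduced echelon basis, and the limit of `t · U` as `t → 0` is the
coordinate subspace on the pivots of `U` (`tendsto_actC`). So both tori fix exactly the
configurations of coordinate subspaces, and a cell consists of the configurations with given pivots
(`cell_eq`). The fixed points are therefore families of subsets of `{1, …, n}` satisfying the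
conditions of the tower. A subset `L ⊆ S ⊆ U` of given size corresponds to a partition in a rectangle
(`exists_diagram_eq`, `eq_of_diagram_eq`), and a flag of subsets to a permutation
(`exists_perm_of_flag`), which yields the bijection with tuples.

For the dimension, the echelon basis of a space between two spaces with given echelon bases depends
polynomially on these bases and on free parameters, one for each pair `a < b` where `b` is a pivot of
the space but not of the lower bound, and `a` a pivot of the upper bound but not of the space
(`isEchelon_stepFamily`, `IsEchelon.eq_stepFamily`). The parameters are themselves entries of the
echelon basis, which are regular functions on the cell (`isRegularOn_echelon`). So the cell, with the
Zariski topology, is an affine space, whose dimension is the Krull dimension of a polynomial ring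
since its points are very dense in the spectrum (`zariskiDim_eq_of_coordinates`). The pairs `(a, b)`
for `W_j` are the boxes of `τ_j` (`card_diagram`), and those for the other members of the flag the
inversions of `x` (`sum_laterInBlock`), whose number is the length of `x` (`len_eq_card_inversions`).
-/

namespace Zel

/-! ### Length and inversions -/

section Length

variable {n : ℕ}

/-- The inversions of a permutation, as pairs of positions. -/
def inversions (w : Equiv.Perm (Fin n)) : Finset (Fin n × Fin n) :=
  Finset.univ.filter fun p => p.1 < p.2 ∧ w p.2 < w p.1

theorem mem_inversions {w : Equiv.Perm (Fin n)} {p : Fin n × Fin n} :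
    p ∈ inversions w ↔ p.1 < p.2 ∧ w p.2 < w p.1 := by
  simp [inversions]

/-- The smaller of the two values exchanged by `s i`. -/
def lowVal (i : Fin (n - 1)) : Fin n := ⟨i, by omega⟩

/-- The larger of the two values exchanged by `s i`. -/
def highVal (i : Fin (n - 1)) : Fin n := ⟨i + 1, by omega⟩

theorem s_eq_swap (i : Fin (n - 1)) : s i = Equiv.swap (lowVal i) (highVal i) := rfl

theorem lowVal_lt_highVal (i : Fin (n - 1)) : lowVal i < highVal i := by
  simp [lowVal, highVal, Fin.lt_def]

theorem s_mul_self (i : Fin (n - 1)) : s i * s i = 1 := Equiv.swap_mul_self _ _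

theorem s_inv (i : Fin (n - 1)) : (s i)⁻¹ = s i := Equiv.swap_inv _ _

theorem s_apply_val (i : Fin (n - 1)) (x : Fin n) :
    (s i x : ℕ) = if (x : ℕ) = i then (i : ℕ) + 1 else if (x : ℕ) = i + 1 then (i : ℕ) else x := by
  rw [s_eq_swap, Equiv.swap_apply_def]
  simp only [Fin.ext_iff, lowVal, highVal]
  split_ifs <;> rfl

theorem s_apply_lt (i : Fin (n - 1)) (x y : Fin n) :
    s i x < s i y ↔
      (x = highVal i ∧ y = lowVal i) ∨ (x < y ∧ ¬ (x = lowVal i ∧ y = highVal i)) := by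
  rw [Fin.lt_def, s_apply_val, s_apply_val]
  simp only [Fin.ext_iff, Fin.lt_def, lowVal, highVal]
  split_ifs <;> omega

theorem inversions_s_mul {w : Equiv.Perm (Fin n)} {i : Fin (n - 1)}
    (h : w⁻¹ (lowVal i) < w⁻¹ (highVal i)) :
    inversions (s i * w) = insert (w⁻¹ (lowVal i), w⁻¹ (highVal i)) (inversions w) := by
  ext ⟨a, b⟩
  simp only [mem_inversions, Finset.mem_insert, Prod.mk.injEq, Equiv.Perm.mul_apply, s_apply_lt,
    Equiv.Perm.eq_inv_iff_eq]
  constructor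
  · rintro ⟨hab, ⟨h1, h2⟩ | ⟨h1, h2⟩⟩
    · exact Or.inl ⟨h2, h1⟩
    · exact Or.inr ⟨hab, h1⟩
  · rintro (⟨h1, h2⟩ | ⟨hab, h1⟩)
    · refine ⟨?_, Or.inl ⟨h2, h1⟩⟩
      simpa [← h1, ← h2] using h
    · refine ⟨hab, Or.inr ⟨h1, ?_⟩⟩
      rintro ⟨h2, h3⟩
      exact absurd (by simpa [← h2, ← h3] using h) hab.asymm

theorem notMem_inversions {w : Equiv.Perm (Fin n)} {i : Fin (n - 1)} :
    (w⁻¹ (lowVal i), w⁻¹ (highVal i)) ∉ inversions w := by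
  simp [mem_inversions, (lowVal_lt_highVal i).le]

theorem card_inversions_s_mul {w : Equiv.Perm (Fin n)} {i : Fin (n - 1)}
    (h : w⁻¹ (lowVal i) < w⁻¹ (highVal i)) :
    (inversions (s i * w)).card = (inversions w).card + 1 := by
  rw [inversions_s_mul h, Finset.card_insert_of_notMem notMem_inversions]

theorem card_inversions_s_mul_of_gt {w : Equiv.Perm (Fin n)} {i : Fin (n - 1)}
    (h : w⁻¹ (highVal i) < w⁻¹ (lowVal i)) :
    (inversions (s i * w)).card + 1 = (inversions w).card := by
  have := card_inversions_s_mul (w := s i * w) (i := i) (by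
    simpa [mul_inv_rev, s_inv, s_eq_swap] using h)
  rw [← this, ← mul_assoc, s_mul_self, one_mul]

theorem card_inversions_inv (w : Equiv.Perm (Fin n)) :
    (inversions w⁻¹).card = (inversions w).card := by
  refine Finset.card_bij' (fun p _ => (w⁻¹ p.2, w⁻¹ p.1)) (fun p _ => (w p.2, w p.1)) ?_ ?_ ?_ ?_
  · rintro ⟨a, b⟩ h
    rw [mem_inversions] at h ⊢
    exact ⟨by simpa using h.2, by simpa using h.1⟩
  · rintro ⟨a, b⟩ h
    rw [mem_inversions] at h ⊢
    exact ⟨by simpa using h.2, by simpa using h.1⟩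
  · simp
  · simp

theorem wordProd_cons (i : Fin (n - 1)) (wd : List (Fin (n - 1))) :
    wordProd (i :: wd) = s i * wordProd wd := by simp [wordProd]

theorem card_inversions_wordProd_le (wd : List (Fin (n - 1))) :
    (inversions (wordProd wd)).card ≤ wd.length := by
  induction wd with
  | nil =>
    have : inversions (wordProd ([] : List (Fin (n - 1)))) = ∅ := by
      ext p
      simpa [wordProd, mem_inversions] using fun h => le_of_lt h
    simp [this]
  | cons i wd ih =>
    rw [wordProd_cons, List.length_cons]
    rcases lt_trichotomy ((wordProd wd)⁻¹ (lowVal i)) ((wordProd wd)⁻¹ (highVal i)) with h | h | h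
    · rw [card_inversions_s_mul h]; omega
    · exact absurd ((wordProd wd)⁻¹.injective h) (lowVal_lt_highVal i).ne
    · have := card_inversions_s_mul_of_gt h; omega

/-- Only the identity is increasing. -/
theorem exists_descent_of_ne_one {w : Equiv.Perm (Fin n)} (hw : w ≠ 1) :
    ∃ i : Fin (n - 1), w (highVal i) < w (lowVal i) := by
  by_contra! h
  have hmono : StrictMono w := by
    obtain _ | n := n
    · exact fun a => a.elim0
    · refine Fin.strictMono_iff_lt_succ.2 fun i => ?_
      refine lt_of_le_of_ne (h i) fun he => ?_
      exact absurd (w.injective he) (lowVal_lt_highVal (n := n + 1) i).ne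
  refine hw (Equiv.ext fun x => ?_)
  exact DFunLike.congr_fun (Subsingleton.elim
    (hmono.orderIsoOfSurjective w w.surjective) (OrderIso.refl _)) x

/-- A descent of the inverse of `w` lets one split off a first letter, decreasing the number of
inversions by one. -/
theorem exists_word (w : Equiv.Perm (Fin n)) :
    ∃ wd : List (Fin (n - 1)), wd.length = (inversions w).card ∧ wordProd wd = w := by
  induction hk : (inversions w).card generalizing w with
  | zero =>
    refine ⟨[], rfl, ?_⟩
    by_contra hne
    obtain ⟨i, hi⟩ := exists_descent_of_ne_one (Ne.symm hne)
    have : (lowVal i, highVal i) ∈ inversions w := mem_inversions.2 ⟨lowVal_lt_highVal i, hi⟩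
    rw [Finset.card_eq_zero] at hk
    simp [hk] at this
  | succ k ih =>
    have hne : w⁻¹ ≠ 1 := by
      rintro h
      rw [inv_eq_one] at h
      have h0 := card_inversions_wordProd_le ([] : List (Fin (n - 1)))
      rw [show wordProd ([] : List (Fin (n - 1))) = 1 from rfl, ← h, hk] at h0
      simp at h0
    obtain ⟨i, hi⟩ := exists_descent_of_ne_one hne
    have h1 := card_inversions_s_mul_of_gt hi
    obtain ⟨wd, h2, h3⟩ := ih (s i * w) (by omega)
    refine ⟨i :: wd, by simp [h2], ?_⟩
    rw [wordProd_cons, h3, ← mul_assoc, s_mul_self, one_mul]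

/-- Coxeter length is the number of inversions. -/
theorem len_eq_card_inversions (w : Equiv.Perm (Fin n)) : len w = (inversions w).card := by
  apply le_antisymm
  · exact Nat.sInf_le (exists_word w)
  · refine le_csInf ⟨_, exists_word w⟩ ?_
    rintro k ⟨wd, rfl, rfl⟩
    exact card_inversions_wordProd_le wd

/-- `v` is increasing on the positions `≤ z` and on the positions `> z`. -/
def IncreasingOnBlocks (z : Fin (n - 1)) (v : Equiv.Perm (Fin n)) : Prop :=
  ∀ i i' : Fin n, i < i' → ((i' : ℕ) ≤ z ∨ (z : ℕ) < i) → v i < v i'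

/-- It suffices to compare neighbouring positions of the same block. -/
theorem IncreasingOnBlocks.of_step {z : Fin (n - 1)} {v : Equiv.Perm (Fin n)}
    (h : ∀ i : Fin (n - 1), i ≠ z → v (lowVal i) < v (highVal i)) : IncreasingOnBlocks z v := by
  have key : ∀ k : ℕ, ∀ i i' : Fin n, (i' : ℕ) = i + k + 1 → ((i' : ℕ) ≤ z ∨ (z : ℕ) < i) →
      v i < v i' := by
    intro k
    induction k with
    | zero =>
      intro i i' hii hz
      have := h ⟨i, by omega⟩ (by rw [Ne, Fin.ext_iff]; simp only; omega)
      rwa [show highVal ⟨i, by omega⟩ = i' from Fin.ext hii.symm] at this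
    | succ k ih =>
      intro i i' hii hz
      have h1 := ih i ⟨i + k + 1, by omega⟩ rfl (by simp only; omega)
      have h2 := h ⟨i + k + 1, by omega⟩ (by rw [Ne, Fin.ext_iff]; simp only; omega)
      rw [show highVal ⟨i + k + 1, by omega⟩ = i' from Fin.ext hii.symm] at h2
      exact h1.trans h2
  intro i i' hii hz
  exact key (i' - i - 1) i i' (by rw [Fin.lt_def] at hii; omega) hz

theorem s_mem_parabolic {z i : Fin (n - 1)} (h : i ≠ z) : s i ∈ parabolic z :=
  Subgroup.subset_closure ⟨i, h, rfl⟩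

/-- Minimal representatives of the cosets of `W_J` are increasing on the two blocks. -/
theorem increasingOnBlocks_of_minimal {z : Fin (n - 1)} {v : Equiv.Perm (Fin n)}
    (h : ∀ u ∈ parabolic z, len v ≤ len (v * u)) : IncreasingOnBlocks z v := by
  refine .of_step fun i hi => ?_
  by_contra! hlt
  have hlt : v (highVal i) < v (lowVal i) :=
    lt_of_le_of_ne hlt fun he => absurd (v.injective he) (lowVal_lt_highVal i).ne'
  have h1 := h _ (s_mem_parabolic hi)
  have h2 := card_inversions_s_mul_of_gt (w := v⁻¹) (i := i) (by simpa using hlt)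
  rw [len_eq_card_inversions, len_eq_card_inversions, ← card_inversions_inv (v * s i),
    mul_inv_rev, s_inv] at h1
  rw [card_inversions_inv] at h2
  omega

end Length

/-! ### The heap of a grassmannian permutation as a Young diagram -/

section HeapModel

variable {n : ℕ} {z : Fin (n - 1)} {wd : List (Fin (n - 1))}

/-- The permutation expressed by the letters of `wd` from position `k` on. -/
def suffixProd (wd : List (Fin (n - 1))) (k : ℕ) : Equiv.Perm (Fin n) := wordProd (wd.drop k)

/-- The inversion created by the letter at position `k`, as a pair of positions of the permutation.
-/
def root (wd : List (Fin (n - 1))) (k : Fin wd.length) : Fin n × Fin n :=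
  ((suffixProd wd (k + 1))⁻¹ (lowVal (wd.get k)), (suffixProd wd (k + 1))⁻¹ (highVal (wd.get k)))

/-- All suffixes of `wd` express permutations increasing on the two blocks, and each letter creates
an inversion between a position of the first block and one of the second. -/
structure IsGrassmannianWord (z : Fin (n - 1)) (wd : List (Fin (n - 1))) : Prop where
  increasing : ∀ k, IncreasingOnBlocks z (suffixProd wd k)
  root_fst_le : ∀ k, ((root wd k).1 : ℕ) ≤ z
  lt_root_snd : ∀ k, (z : ℕ) < (root wd k).2

theorem suffixProd_eq (wd : List (Fin (n - 1))) (k : Fin wd.length) :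
    suffixProd wd k = s (wd.get k) * suffixProd wd (k + 1) := by
  rw [suffixProd, suffixProd, ← wordProd_cons, List.get_eq_getElem, ← List.drop_eq_getElem_cons]

theorem suffixProd_of_length_le {k : ℕ} (h : wd.length ≤ k) : suffixProd wd k = 1 := by
  simp [suffixProd, List.drop_eq_nil_of_le h, wordProd]

theorem card_inversions_of_cons {i : Fin (n - 1)} {l : List (Fin (n - 1))}
    (h : (inversions (wordProd (i :: l))).card = l.length + 1) :
    (inversions (wordProd l)).card = l.length ∧
      (wordProd l)⁻¹ (lowVal i) < (wordProd l)⁻¹ (highVal i) := by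
  have h0 := card_inversions_wordProd_le l
  rw [wordProd_cons] at h
  rcases lt_trichotomy ((wordProd l)⁻¹ (lowVal i)) ((wordProd l)⁻¹ (highVal i)) with h1 | h1 | h1
  · rw [card_inversions_s_mul h1] at h
    exact ⟨by omega, h1⟩
  · exact absurd ((wordProd l)⁻¹.injective h1) (lowVal_lt_highVal i).ne
  · have := card_inversions_s_mul_of_gt h1
    omega

/-- Removing the first letter of a reduced word of a grassmannian permutation. -/
theorem IncreasingOnBlocks.tail {i : Fin (n - 1)} {u : Equiv.Perm (Fin n)}
    (h : u⁻¹ (lowVal i) < u⁻¹ (highVal i)) (hv : IncreasingOnBlocks z (s i * u)) :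
    IncreasingOnBlocks z u ∧ (u⁻¹ (lowVal i) : ℕ) ≤ z ∧ (z : ℕ) < u⁻¹ (highVal i) := by
  constructor
  · intro a b hab hz
    have := hv a b hab hz
    rw [Equiv.Perm.mul_apply, Equiv.Perm.mul_apply, s_apply_lt] at this
    rcases this with ⟨h1, h2⟩ | ⟨h1, -⟩
    · refine absurd h (not_lt.2 (le_of_lt ?_))
      simpa [← h1, ← h2] using hab
    · exact h1
  · by_contra hc
    have := hv _ _ h (by omega)
    simp [s_eq_swap, (lowVal_lt_highVal i).le.not_gt] at this

/-- The suffixes of a reduced word are reduced, and by `IncreasingOnBlocks.tail` they all express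
grassmannian permutations. -/
theorem isGrassmannianWord_of_reduced {v : Equiv.Perm (Fin n)} (hwd : IsReducedWord wd v)
    (hv : IncreasingOnBlocks z v) : IsGrassmannianWord z wd := by
  have key : ∀ k ≤ wd.length, (inversions (suffixProd wd k)).card = wd.length - k ∧
      IncreasingOnBlocks z (suffixProd wd k) := by
    intro k
    induction k with
    | zero =>
      intro _
      rw [suffixProd, List.drop_zero, hwd.1]
      exact ⟨by rw [← len_eq_card_inversions, ← hwd.2, Nat.sub_zero], hv⟩
    | succ k ih =>
      intro hk
      obtain ⟨h1, h2⟩ := ih (by omega)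
      rw [suffixProd, List.drop_eq_getElem_cons (by omega)] at h1 h2
      obtain ⟨h3, h4⟩ := card_inversions_of_cons (by rw [h1, List.length_drop]; omega)
      rw [wordProd_cons] at h2
      exact ⟨by rw [suffixProd, h3, List.length_drop], (h2.tail h4).1⟩
  have root_prop : ∀ k, ((root wd k).1 : ℕ) ≤ z ∧ (z : ℕ) < (root wd k).2 := by
    intro k
    obtain ⟨h1, h2⟩ := key k k.2.le
    rw [suffixProd, List.drop_eq_getElem_cons k.2] at h1 h2
    obtain ⟨h3, h4⟩ := card_inversions_of_cons (by rw [h1, List.length_drop]; omega)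
    rw [wordProd_cons] at h2
    exact (h2.tail h4).2
  refine ⟨fun k => ?_, fun k => (root_prop k).1, fun k => (root_prop k).2⟩
  by_cases hk : k ≤ wd.length
  · exact (key k hk).2
  · rw [suffixProd_of_length_le (by omega)]
    exact fun i i' h _ => h

namespace IsGrassmannianWord

variable (h : IsGrassmannianWord z wd)
include h

theorem root_fst_lt_snd (k : Fin wd.length) : (root wd k).1 < (root wd k).2 :=
  Fin.lt_def.2 (lt_of_le_of_lt (h.root_fst_le k) (h.lt_root_snd k))

/-- The inversions of the permutation expressed by a suffix are those created by its letters. -/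
theorem mem_inversions_suffixProd (j : ℕ) (p : Fin n × Fin n) :
    p ∈ inversions (suffixProd wd j) ↔ ∃ k : Fin wd.length, j ≤ k ∧ root wd k = p := by
  by_cases hj : wd.length ≤ j
  · rw [suffixProd_of_length_le hj, mem_inversions]
    simp only [Equiv.Perm.coe_one, id_eq]
    constructor
    · exact fun h => absurd h.1 h.2.asymm
    · rintro ⟨k, hk, -⟩
      omega
  push Not at hj
  induction hd : wd.length - j generalizing j with
  | zero => omega
  | succ d ih =>
    have h1 := suffixProd_eq wd ⟨j, hj⟩
    simp only at h1
    rw [h1, inversions_s_mul (h.root_fst_lt_snd ⟨j, hj⟩), Finset.mem_insert]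
    have h2 : p ∈ inversions (suffixProd wd (j + 1)) ↔
        ∃ k : Fin wd.length, j + 1 ≤ k ∧ root wd k = p := by
      by_cases hj' : j + 1 < wd.length
      · exact ih (j + 1) hj' (by omega)
      · rw [suffixProd_of_length_le (by omega), mem_inversions]
        simp only [Equiv.Perm.coe_one, id_eq]
        constructor
        · exact fun h => absurd h.1 h.2.asymm
        · rintro ⟨k, hk, -⟩
          omega
    rw [h2]
    constructor
    · rintro (rfl | ⟨k, hk, rfl⟩)
      · exact ⟨⟨j, hj⟩, le_rfl, rfl⟩
      · exact ⟨k, by omega, rfl⟩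
    · rintro ⟨k, hk, rfl⟩
      rcases hk.eq_or_lt with rfl | hk
      · exact Or.inl rfl
      · exact Or.inr ⟨k, hk, rfl⟩

theorem root_injective : Function.Injective (root wd) := by
  have key : ∀ i j : Fin wd.length, i < j → root wd i ≠ root wd j := by
    intro i j hij he
    exact notMem_inversions (i := wd.get i) ((h.mem_inversions_suffixProd _ _).2 ⟨j, hij, he.symm⟩)
  intro i j he
  rcases lt_trichotomy i j with hij | hij | hij
  · exact absurd he (key i j hij)
  · exact hij
  · exact absurd he.symm (key j i hij)

/-- The inversions of a permutation increasing on the blocks are closed under moving both positions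
towards the boundary of the blocks. -/
theorem exists_root_of_le (k : Fin wd.length) {p : Fin n × Fin n} {j : ℕ} (hj : j ≤ k)
    (h1 : (root wd k).1 ≤ p.1) (h2 : (p.1 : ℕ) ≤ z) (h3 : (z : ℕ) < p.2)
    (h4 : p.2 ≤ (root wd k).2) : ∃ i : Fin wd.length, j ≤ i ∧ root wd i = p := by
  rw [← h.mem_inversions_suffixProd, mem_inversions]
  have hk := (mem_inversions.1 ((h.mem_inversions_suffixProd j _).2 ⟨k, hj, rfl⟩)).2
  refine ⟨lt_of_le_of_lt (b := (⟨z, by omega⟩ : Fin n)) h2 h3, ?_⟩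
  have h5 : suffixProd wd j (root wd k).1 ≤ suffixProd wd j p.1 := by
    rcases h1.eq_or_lt with he | hl
    · rw [he]
    · exact (h.increasing j _ _ hl (Or.inl h2)).le
  have h6 : suffixProd wd j p.2 ≤ suffixProd wd j (root wd k).2 := by
    rcases h4.eq_or_lt with he | hl
    · rw [he]
    · exact (h.increasing j _ _ hl (Or.inr h3)).le
  exact h6.trans_lt (hk.trans_le h5)

/-- A letter is determined by the inversion which it creates. -/
theorem root_fst_add_snd (k : Fin wd.length) :
    ((root wd k).1 : ℕ) + (root wd k).2 = (wd.get k : ℕ) + z + 1 := by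
  set u := suffixProd wd (k + 1) with hu
  set p := (root wd k).1 with hp
  set q := (root wd k).2 with hq
  have hup : u p = lowVal (wd.get k) := by simp [hp, root, ← hu]
  have huq : u q = highVal (wd.get k) := by simp [hq, root, ← hu]
  have hpz : (p : ℕ) ≤ z := h.root_fst_le k
  have hzq : (z : ℕ) < q := h.lt_root_snd k
  have hinc := h.increasing (k + 1)
  rw [← hu] at hinc
  -- `lowVal` and `highVal` are consecutive values, at the positions `p` and `q` of the two blocks,
  -- so the smaller values sit exactly at the positions before `p` and before `q` in these blocks
  have hset : (Finset.univ.filter fun x => u x < lowVal (wd.get k)) =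
      Finset.Iio p ∪ Finset.Ioo (⟨z, by omega⟩ : Fin n) q := by
    ext x
    simp only [Finset.mem_filter, Finset.mem_univ, true_and, Finset.mem_union, Finset.mem_Iio,
      Finset.mem_Ioo]
    by_cases hx : (x : ℕ) ≤ z
    · have : ¬ ((⟨z, by omega⟩ : Fin n) < x) := by rw [Fin.lt_def]; simp only; omega
      simp only [this, false_and, or_false]
      rw [← hup]
      refine ⟨fun hlt => ?_, fun hlt => hinc _ _ hlt (Or.inl hpz)⟩
      by_contra hge
      rcases (not_lt.1 hge).eq_or_lt with he | hl
      · rw [he] at hlt; exact lt_irrefl _ hlt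
      · exact lt_asymm hlt (hinc _ _ hl (Or.inl hx))
    · have h1 : (⟨z, by omega⟩ : Fin n) < x := by rw [Fin.lt_def]; simp only; omega
      have h2 : ¬ x < p := by rw [Fin.lt_def]; omega
      simp only [h1, h2, true_and, false_or]
      have h3 : ∀ y : Fin n, y < highVal (wd.get k) ↔ y < lowVal (wd.get k) ∨ y = u p := by
        intro y
        rw [hup]
        simp only [highVal, lowVal, Fin.lt_def, Fin.ext_iff]
        omega
      constructor
      · intro hlt
        have hlt : u x < u q := by rw [huq]; exact hlt.trans (lowVal_lt_highVal _)
        by_contra hge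
        rcases (not_lt.1 hge).eq_or_lt with he | hl
        · rw [he] at hlt; exact lt_irrefl _ hlt
        · exact lt_asymm hlt (hinc _ _ hl (Or.inr hzq))
      · intro hlt
        have := hinc _ _ hlt (Or.inr (by omega))
        rw [huq, h3] at this
        rcases this with h4 | h4
        · exact h4
        · have := u.injective h4
          rw [this] at hx
          exact absurd hpz hx
  have hcard : (Finset.univ.filter fun x => u x < lowVal (wd.get k)).card = wd.get k := by
    rw [Finset.card_equiv (t := Finset.Iio (lowVal (wd.get k))) u (by simp), Fin.card_Iio]
    rfl
  rw [hset, Finset.card_union_of_disjoint, Fin.card_Iio, Fin.card_Ioo] at hcard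
  · simp only at hcard
    omega
  · rw [Finset.disjoint_left]
    intro x hx hx'
    rw [Finset.mem_Iio] at hx
    rw [Finset.mem_Ioo] at hx'
    have := hx.trans_le (show p ≤ ⟨z, by omega⟩ from hpz)
    exact lt_asymm this hx'.1

end IsGrassmannianWord

/-- The box of the Young diagram corresponding to a heap entry. The first coordinate increases
towards the upper left of the heap and the second one towards the upper right; the box `(0, 0)`
lies at the bottom of the heap. -/
def box (z : Fin (n - 1)) (wd : List (Fin (n - 1))) (k : Fin wd.length) : ℕ × ℕ :=
  (z - (root wd k).1, (root wd k).2 - (z + 1))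

theorem not_commute_s_iff (i j : Fin (n - 1)) :
    ¬ Commute (s i) (s j) ↔ (i : ℕ) + 1 = j ∨ (j : ℕ) + 1 = i := by
  have key : ∀ i j : Fin (n - 1), (i : ℕ) + 1 = j → ¬ Commute (s i) (s j) := by
    intro i j hij hc
    have := congrArg (fun w => (w (lowVal i) : ℕ)) hc.eq
    simp only [Equiv.Perm.mul_apply] at this
    have h0 : (lowVal i : ℕ) = i := rfl
    have h1 := s_apply_val j (lowVal i)
    have h2 := s_apply_val i (lowVal i)
    have h3 := s_apply_val i (s j (lowVal i))
    have h4 := s_apply_val j (s i (lowVal i))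
    split_ifs at h1 h2 <;> split_ifs at h3 h4 <;> omega
  refine ⟨fun hc => ?_, fun h => ?_⟩
  · by_contra! hne
    refine hc ?_
    by_cases hij : i = j
    · rw [hij]
    · rw [Fin.ext_iff] at hij
      refine Equiv.ext fun x => Fin.ext ?_
      rw [Equiv.Perm.mul_apply, Equiv.Perm.mul_apply]
      have h1 := s_apply_val j x
      have h2 := s_apply_val i x
      have h3 := s_apply_val i (s j x)
      have h4 := s_apply_val j (s i x)
      split_ifs at h1 h2 <;> split_ifs at h3 h4 <;> omega
  · rcases h with h | h
    · exact key i j h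
    · exact fun hc => key j i h hc.symm

namespace IsGrassmannianWord

variable (h : IsGrassmannianWord z wd)
include h

theorem col_add_box_fst (k : Fin wd.length) :
    col wd k + (box z wd k).1 = z + 1 + (box z wd k).2 := by
  have h1 := h.root_fst_add_snd k
  have h2 := h.root_fst_le k
  have h3 := h.lt_root_snd k
  simp only [col, box]
  omega

theorem box_injective : Function.Injective (box z wd) := by
  intro i j hij
  refine h.root_injective ?_
  have h1 := h.root_fst_le i
  have h2 := h.lt_root_snd i
  have h3 := h.root_fst_le j
  have h4 := h.lt_root_snd j
  simp only [box, Prod.mk.injEq] at hij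
  refine Prod.ext (Fin.ext ?_) (Fin.ext ?_) <;> omega

theorem exists_box_of_le_of_index_le (k : Fin wd.length) {c : ℕ × ℕ} (hc : c ≤ box z wd k) {j : ℕ}
    (hj : j ≤ k) : ∃ i : Fin wd.length, j ≤ i ∧ box z wd i = c := by
  obtain ⟨a, b⟩ := c
  obtain ⟨h1, h2⟩ : a ≤ z - (root wd k).1 ∧ b ≤ (root wd k).2 - (z + 1) := hc
  have h3 := h.root_fst_le k
  have h4 := h.lt_root_snd k
  obtain ⟨i, hi, hr⟩ := h.exists_root_of_le k (p := (⟨z - a, by omega⟩, ⟨z + 1 + b, by omega⟩)) hj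
    (by rw [Fin.le_def]; simp only; omega) (by simp only; omega) (by simp only; omega)
    (by rw [Fin.le_def]; simp only; omega)
  refine ⟨i, hi, ?_⟩
  simp only [box, hr, Prod.mk.injEq]
  omega

/-- The boxes form a Young diagram. -/
theorem exists_box_of_le (k : Fin wd.length) {c : ℕ × ℕ} (hc : c ≤ box z wd k) :
    ∃ i, box z wd i = c := by
  obtain ⟨i, -, hi⟩ := h.exists_box_of_le_of_index_le k hc (Nat.zero_le _)
  exact ⟨i, hi⟩

/-- Read from right to left, the word adds the boxes in an order extending the order of boxes. -/
theorem index_le_of_box_le {i k : Fin wd.length} (hik : box z wd i ≤ box z wd k) : k ≤ i := by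
  obtain ⟨i', hi', he⟩ := h.exists_box_of_le_of_index_le k hik le_rfl
  rwa [← h.box_injective he]

/-- The heap order is the order of the Young diagram: letters that do not commute lie in adjacent
columns, and adjacent boxes of the diagram come from letters that do not commute. -/
theorem heapLT_iff (i j : Fin wd.length) : heapLT wd i j ↔ box z wd i < box z wd j := by
  constructor
  · intro hij
    have step : ∀ i j : Fin wd.length, j < i ∧ ¬ Commute (s (wd.get i)) (s (wd.get j)) →
        box z wd i < box z wd j := by
      rintro i j ⟨hlt, hc⟩
      rw [not_commute_s_iff] at hc
      have hi := h.col_add_box_fst i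
      have hj := h.col_add_box_fst j
      simp only [col] at hi hj
      -- boxes in adjacent columns are comparable, and the word adds smaller boxes first
      have hnot : ¬ box z wd j ≤ box z wd i := fun hle => by
        have := h.index_le_of_box_le hle
        exact absurd hlt this.not_gt
      refine lt_of_le_not_ge ?_ hnot
      rw [Prod.le_def] at hnot ⊢
      omega
    induction hij with
    | single h1 => exact step _ _ h1
    | tail _ h1 ih => exact ih.trans (step _ _ h1)
  · intro hij
    have gen : ∀ i j : Fin wd.length, box z wd i < box z wd j →
        ((box z wd i).1 + 1 = (box z wd j).1 ∧ (box z wd i).2 = (box z wd j).2 ∨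
          (box z wd i).1 = (box z wd j).1 ∧ (box z wd i).2 + 1 = (box z wd j).2) →
        j < i ∧ ¬ Commute (s (wd.get i)) (s (wd.get j)) := by
      intro i j hlt hadj
      refine ⟨lt_of_le_of_ne (h.index_le_of_box_le hlt.le) ?_, ?_⟩
      · rintro rfl
        exact lt_irrefl _ hlt
      · rw [not_commute_s_iff]
        have hi := h.col_add_box_fst i
        have hj := h.col_add_box_fst j
        simp only [col] at hi hj
        omega
    induction hd : (box z wd j).1 + (box z wd j).2 using Nat.strong_induction_on generalizing j with
    | _ d ih =>
      obtain ⟨h1, h2⟩ := Prod.le_def.1 hij.le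
      have hne : (box z wd i).1 ≠ (box z wd j).1 ∨ (box z wd i).2 ≠ (box z wd j).2 := by
        by_contra! hc
        exact hij.ne (Prod.ext hc.1 hc.2)
      -- a box between the two, adjacent to the upper one
      obtain ⟨c, hcj, hic, hadj⟩ : ∃ c : ℕ × ℕ, c ≤ box z wd j ∧ box z wd i ≤ c ∧
          (c.1 + 1 = (box z wd j).1 ∧ c.2 = (box z wd j).2 ∨
            c.1 = (box z wd j).1 ∧ c.2 + 1 = (box z wd j).2) := by
        by_cases h3 : (box z wd i).1 = (box z wd j).1
        · refine ⟨((box z wd j).1, (box z wd j).2 - 1), ?_, ?_, ?_⟩ <;>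
            simp only [Prod.le_def, true_and] <;> omega
        · refine ⟨((box z wd j).1 - 1, (box z wd j).2), ?_, ?_, ?_⟩ <;>
            simp only [Prod.le_def, and_true] <;> omega
      obtain ⟨k, rfl⟩ := h.exists_box_of_le j hcj
      have hkj : box z wd k < box z wd j := lt_of_le_of_ne hcj fun he => by
        rw [he] at hadj; omega
      have hg : heapLT wd k j := Relation.TransGen.single (gen k j hkj hadj)
      rcases hic.eq_or_lt with he | hlt
      · rw [h.box_injective he]; exact hg
      · exact Relation.TransGen.trans (ih _ (by omega) k hlt rfl) hg

theorem heapLE_iff (i j : Fin wd.length) : heapLE wd i j ↔ box z wd i ≤ box z wd j := by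
  rw [heapLE, h.heapLT_iff, le_iff_eq_or_lt, h.box_injective.eq_iff]

end IsGrassmannianWord

end HeapModel

/-! ### Rectangles of the heap -/

section Rectangles

variable {n : ℕ} {z : Fin (n - 1)} {wd : List (Fin (n - 1))} {m : ℕ}
  {P : Fin (m + 1) → Fin wd.length}

/-- The row at which the part of the diagram below the `k`-th peak starts to be covered by no other
peak to its right, when only the peaks of index at least `j` are considered. -/
def innerFst (z : Fin (n - 1)) (wd : List (Fin (n - 1))) (P : Fin (m + 1) → Fin wd.length)
    (j : ℕ) (k : Fin (m + 1)) : ℕ :=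
  (Finset.univ.filter fun i : Fin (m + 1) => j ≤ i ∧ (box z wd (P i)).1 < (box z wd (P k)).1).sup
    fun i => (box z wd (P i)).1 + 1

/-- The analogue of `innerFst` for the second coordinate and the peaks to the left. -/
def innerSnd (z : Fin (n - 1)) (wd : List (Fin (n - 1))) (P : Fin (m + 1) → Fin wd.length)
    (j : ℕ) (k : Fin (m + 1)) : ℕ :=
  (Finset.univ.filter fun i : Fin (m + 1) => j ≤ i ∧ (box z wd (P i)).2 < (box z wd (P k)).2).sup
    fun i => (box z wd (P i)).2 + 1

theorem innerFst_le_iff {j : ℕ} {k : Fin (m + 1)} {x : ℕ} : innerFst z wd P j k ≤ x ↔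
    ∀ i : Fin (m + 1), j ≤ i → (box z wd (P i)).1 < (box z wd (P k)).1 →
      (box z wd (P i)).1 < x := by
  simp only [innerFst, Finset.sup_le_iff, Finset.mem_filter, Finset.mem_univ, true_and, and_imp,
    Nat.succ_le_iff]

theorem innerSnd_le_iff {j : ℕ} {k : Fin (m + 1)} {x : ℕ} : innerSnd z wd P j k ≤ x ↔
    ∀ i : Fin (m + 1), j ≤ i → (box z wd (P i)).2 < (box z wd (P k)).2 →
      (box z wd (P i)).2 < x := by
  simp only [innerSnd, Finset.sup_le_iff, Finset.mem_filter, Finset.mem_univ, true_and, and_imp,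
    Nat.succ_le_iff]

theorem innerFst_le (j : ℕ) (k : Fin (m + 1)) : innerFst z wd P j k ≤ (box z wd (P k)).1 :=
  innerFst_le_iff.2 fun _ _ h => h

theorem innerSnd_le (j : ℕ) (k : Fin (m + 1)) : innerSnd z wd P j k ≤ (box z wd (P k)).2 :=
  innerSnd_le_iff.2 fun _ _ h => h

theorem innerFst_succ {j k : Fin (m + 1)} (hjk : ¬ (box z wd (P j)).1 < (box z wd (P k)).1) :
    innerFst z wd P (j + 1) k = innerFst z wd P j k := by
  refine le_antisymm (innerFst_le_iff.2 fun i hi hlt => ?_) (innerFst_le_iff.2 fun i hi hlt => ?_)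
  · exact innerFst_le_iff.1 le_rfl i (by omega) hlt
  · refine innerFst_le_iff.1 le_rfl i ?_ hlt
    rcases hi.eq_or_lt with he | hl
    · rw [← Fin.ext he] at hlt
      exact absurd hlt hjk
    · exact hl

theorem innerSnd_succ {j k : Fin (m + 1)} (hjk : ¬ (box z wd (P j)).2 < (box z wd (P k)).2) :
    innerSnd z wd P (j + 1) k = innerSnd z wd P j k := by
  refine le_antisymm (innerSnd_le_iff.2 fun i hi hlt => ?_) (innerSnd_le_iff.2 fun i hi hlt => ?_)
  · exact innerSnd_le_iff.1 le_rfl i (by omega) hlt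
  · refine innerSnd_le_iff.1 le_rfl i ?_ hlt
    rcases hi.eq_or_lt with he | hl
    · rw [← Fin.ext he] at hlt
      exact absurd hlt hjk
    · exact hl

/-- The value attached to the left boundary of `R_j` by a family of values `W` for the rectangles
and `E` for the columns. -/
noncomputable def lowerOf {α : Type} (wd : List (Fin (n - 1))) (P : Fin (m + 1) → Fin wd.length)
    (W : Fin (m + 1) → α) (E : ℕ → α) (j : Fin (m + 1)) : α :=
  match lpred wd P j with
  | some k => W k
  | none => E (ldim wd P j)

/-- The value attached to the right boundary of `R_j`. -/
noncomputable def upperOf {α : Type} (wd : List (Fin (n - 1))) (P : Fin (m + 1) → Fin wd.length)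
    (W : Fin (m + 1) → α) (E : ℕ → α) (j : Fin (m + 1)) : α :=
  match rpred wd P j with
  | some k => W k
  | none => E (rdim wd P j)

theorem lpred_spec {j k : Fin (m + 1)} (h : lpred wd P j = some k) :
    k < j ∧ heapCovBy wd (leftmost wd P j) (bottom wd P k) ∧
      col wd (bottom wd P k) + 1 = col wd (leftmost wd P j) := by
  unfold lpred at h
  split_ifs at h with hex
  rw [← Option.some.inj h]
  exact hex.choose_spec

theorem rpred_spec {j k : Fin (m + 1)} (h : rpred wd P j = some k) :
    k < j ∧ heapCovBy wd (rightmost wd P j) (bottom wd P k) ∧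
      col wd (bottom wd P k) = col wd (rightmost wd P j) + 1 := by
  unfold rpred at h
  split_ifs at h with hex
  rw [← Option.some.inj h]
  exact hex.choose_spec

theorem lpred_lt {j k : Fin (m + 1)} (h : lpred wd P j = some k) : k < j := (lpred_spec h).1

theorem rpred_lt {j k : Fin (m + 1)} (h : rpred wd P j = some k) : k < j := (rpred_spec h).1

theorem d_of_lpred {j k : Fin (m + 1)} (h : lpred wd P j = some k) : d wd P k = ldim wd P j := by
  have := (lpred_spec h).2.2
  rw [d, ldim]
  omega

theorem d_of_rpred {j k : Fin (m + 1)} (h : rpred wd P j = some k) : d wd P k = rdim wd P j :=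
  (rpred_spec h).2.2

theorem rdim_le (j : Fin (m + 1)) : rdim wd P j ≤ n := by
  rw [rdim, col]
  omega

namespace IsGrassmannianWord

variable (h : IsGrassmannianWord z wd) (hP : IsPeakOrdering wd P)
include h hP

theorem eq_of_box_peak_le {j k : Fin (m + 1)} (hjk : box z wd (P j) ≤ box z wd (P k)) : j = k := by
  refine hP.1 (h.box_injective (hjk.eq_or_lt.resolve_right fun hlt => ?_))
  have : IsPeak wd (P j) := by
    have := Set.mem_range_self (f := P) j
    rwa [hP.2] at this
  exact this _ ((h.heapLT_iff _ _).2 hlt)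

/-- The peaks form an antichain. -/
theorem peak_fst_lt_iff {j k : Fin (m + 1)} :
    (box z wd (P j)).1 < (box z wd (P k)).1 ↔ (box z wd (P k)).2 < (box z wd (P j)).2 := by
  constructor
  · intro hlt
    by_contra hc
    have := h.eq_of_box_peak_le hP (j := j) (k := k) (Prod.le_def.2 ⟨hlt.le, not_lt.1 hc⟩)
    rw [this] at hlt
    exact lt_irrefl _ hlt
  · intro hlt
    by_contra hc
    have := h.eq_of_box_peak_le hP (j := k) (k := j) (Prod.le_def.2 ⟨not_lt.1 hc, hlt.le⟩)
    rw [this] at hlt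
    exact lt_irrefl _ hlt

theorem peak_fst_ne {j k : Fin (m + 1)} (hjk : j ≠ k) :
    (box z wd (P j)).1 ≠ (box z wd (P k)).1 := by
  intro he
  rcases le_total (box z wd (P j)).2 (box z wd (P k)).2 with hl | hl
  · exact hjk (h.eq_of_box_peak_le hP (Prod.le_def.2 ⟨he.le, hl⟩))
  · exact hjk (h.eq_of_box_peak_le hP (Prod.le_def.2 ⟨he.ge, hl⟩)).symm

/-- A larger heap entry has smaller index, so going up ends at a peak. -/
theorem exists_peak_ge (i : Fin wd.length) : ∃ j, box z wd i ≤ box z wd (P j) := by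
  induction hk : (i : ℕ) using Nat.strong_induction_on generalizing i with
  | _ k ih =>
    by_cases hi : IsPeak wd i
    · have : i ∈ {a | IsPeak wd a} := hi
      rw [← hP.2] at this
      obtain ⟨j, rfl⟩ := this
      exact ⟨j, le_rfl⟩
    · simp only [IsPeak, not_forall, not_not] at hi
      obtain ⟨b, hb⟩ := hi
      rw [h.heapLT_iff] at hb
      have h1 := h.index_le_of_box_le hb.le
      have h2 : b ≠ i := by rintro rfl; exact lt_irrefl _ hb
      obtain ⟨j, hj⟩ := ih b (by rw [← hk]; exact lt_of_le_of_ne h1 (by simpa [Fin.ext_iff] using h2))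
        b rfl
      exact ⟨j, hb.le.trans hj⟩

/-- In the coordinates of the diagram, `R_j` is a rectangle below the peak `P j`. -/
theorem mem_rect_iff {j : Fin (m + 1)} {x : Fin wd.length} :
    x ∈ rect wd P j ↔ (innerFst z wd P j j ≤ (box z wd x).1 ∧ (box z wd x).1 ≤ (box z wd (P j)).1) ∧
      innerSnd z wd P j j ≤ (box z wd x).2 ∧ (box z wd x).2 ≤ (box z wd (P j)).2 := by
  simp only [rect, Set.mem_ofPred_eq, h.heapLE_iff, innerFst_le_iff, innerSnd_le_iff, Prod.le_def]
  constructor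
  · rintro ⟨⟨h1, h2⟩, h3⟩
    refine ⟨⟨fun i hi hlt => ?_, h1⟩, fun i hi hlt => ?_, h2⟩
    · have hij : j < i := lt_of_le_of_ne hi (by rintro rfl; exact lt_irrefl _ hlt)
      have := h3 i hij
      rw [h.peak_fst_lt_iff hP] at hlt
      omega
    · have hij : j < i := lt_of_le_of_ne hi (by rintro rfl; exact lt_irrefl _ hlt)
      have := h3 i hij
      rw [← h.peak_fst_lt_iff hP] at hlt
      omega
  · rintro ⟨⟨h1, h2⟩, h3, h4⟩
    refine ⟨⟨h2, h4⟩, fun k hk ⟨h5, h6⟩ => ?_⟩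
    rcases (h.peak_fst_ne hP hk.ne').lt_or_gt with hlt | hlt
    · have := h1 k hk.le hlt
      omega
    · rw [h.peak_fst_lt_iff hP] at hlt
      have := h3 k hk.le hlt
      omega

theorem exists_mem_rect (j : Fin (m + 1)) {c : ℕ × ℕ}
    (h1 : innerFst z wd P j j ≤ c.1) (h2 : c.1 ≤ (box z wd (P j)).1)
    (h3 : innerSnd z wd P j j ≤ c.2) (h4 : c.2 ≤ (box z wd (P j)).2) :
    ∃ x ∈ rect wd P j, box z wd x = c := by
  obtain ⟨x, rfl⟩ := h.exists_box_of_le (P j) (c := c) (Prod.le_def.2 ⟨h2, h4⟩)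
  exact ⟨x, (h.mem_rect_iff hP).2 ⟨⟨h1, h2⟩, h3, h4⟩, rfl⟩

theorem bottom_spec (j : Fin (m + 1)) : bottom wd P j ∈ rect wd P j ∧
    box z wd (bottom wd P j) = (innerFst z wd P j j, innerSnd z wd P j j) := by
  obtain ⟨x, hx, hbox⟩ := h.exists_mem_rect hP j (c := (innerFst z wd P j j, innerSnd z wd P j j))
    le_rfl (innerFst_le _ _) le_rfl (innerSnd_le _ _)
  have hex : ∃ a, a ∈ rect wd P j ∧ ∀ c ∈ rect wd P j, heapLE wd a c := by
    refine ⟨x, hx, fun c hc => ?_⟩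
    rw [h.mem_rect_iff hP] at hc
    rw [h.heapLE_iff, hbox]
    exact Prod.le_def.2 ⟨hc.1.1, hc.2.1⟩
  obtain ⟨h1, h2⟩ := Classical.epsilon_spec hex
  refine ⟨h1, ?_⟩
  have h3 := (h.heapLE_iff _ _).1 (h2 x hx)
  have h4 := (h.mem_rect_iff hP).1 h1
  rw [hbox] at h3
  exact le_antisymm h3 (Prod.le_def.2 ⟨h4.1.1, h4.2.1⟩)

theorem box_bottom (j : Fin (m + 1)) :
    box z wd (bottom wd P j) = (innerFst z wd P j j, innerSnd z wd P j j) :=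
  (h.bottom_spec hP j).2

theorem box_leftmost (j : Fin (m + 1)) :
    box z wd (leftmost wd P j) = ((box z wd (P j)).1, innerSnd z wd P j j) := by
  obtain ⟨x, hx, hbox⟩ := h.exists_mem_rect hP j (c := ((box z wd (P j)).1, innerSnd z wd P j j))
    (innerFst_le _ _) le_rfl le_rfl (innerSnd_le _ _)
  have hxc := h.col_add_box_fst x
  have hex : ∃ a, a ∈ rect wd P j ∧ ∀ c ∈ rect wd P j, col wd a ≤ col wd c := by
    refine ⟨x, hx, fun c hc => ?_⟩
    rw [h.mem_rect_iff hP] at hc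
    have hcc := h.col_add_box_fst c
    rw [hbox] at hxc
    simp only at hxc
    omega
  obtain ⟨h1, h2⟩ := Classical.epsilon_spec hex
  change leftmost wd P j ∈ _ at h1
  have h3 : col wd (leftmost wd P j) ≤ col wd x := h2 x hx
  have h4 := (h.mem_rect_iff hP).1 h1
  have h5 := h.col_add_box_fst (leftmost wd P j)
  rw [hbox] at hxc
  simp only at hxc
  refine Prod.ext ?_ ?_ <;> simp only <;> omega

theorem box_rightmost (j : Fin (m + 1)) :
    box z wd (rightmost wd P j) = (innerFst z wd P j j, (box z wd (P j)).2) := by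
  obtain ⟨x, hx, hbox⟩ := h.exists_mem_rect hP j (c := (innerFst z wd P j j, (box z wd (P j)).2))
    le_rfl (innerFst_le _ _) (innerSnd_le _ _) le_rfl
  have hxc := h.col_add_box_fst x
  have hex : ∃ a, a ∈ rect wd P j ∧ ∀ c ∈ rect wd P j, col wd c ≤ col wd a := by
    refine ⟨x, hx, fun c hc => ?_⟩
    rw [h.mem_rect_iff hP] at hc
    have hcc := h.col_add_box_fst c
    rw [hbox] at hxc
    simp only at hxc
    omega
  obtain ⟨h1, h2⟩ := Classical.epsilon_spec hex
  change rightmost wd P j ∈ _ at h1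
  have h3 : col wd x ≤ col wd (rightmost wd P j) := h2 x hx
  have h4 := (h.mem_rect_iff hP).1 h1
  have h5 := h.col_add_box_fst (rightmost wd P j)
  rw [hbox] at hxc
  simp only at hxc
  refine Prod.ext ?_ ?_ <;> simp only <;> omega

theorem ldim_add (j : Fin (m + 1)) :
    ldim wd P j + (box z wd (P j)).1 = z + innerSnd z wd P j j := by
  have h1 := h.col_add_box_fst (leftmost wd P j)
  rw [h.box_leftmost hP] at h1
  have : 1 ≤ col wd (leftmost wd P j) := Nat.le_add_left _ _
  simp only at h1
  rw [ldim]
  omega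

theorem d_add (j : Fin (m + 1)) :
    d wd P j + innerFst z wd P j j = z + 1 + innerSnd z wd P j j := by
  have h1 := h.col_add_box_fst (bottom wd P j)
  rwa [h.box_bottom hP] at h1

theorem rdim_add (j : Fin (m + 1)) :
    rdim wd P j + innerFst z wd P j j = z + 2 + (box z wd (P j)).2 := by
  have h1 := h.col_add_box_fst (rightmost wd P j)
  rw [h.box_rightmost hP] at h1
  simp only at h1
  rw [rdim]
  omega

theorem ldim_lt_d (j : Fin (m + 1)) : ldim wd P j < d wd P j := by
  have h1 := h.ldim_add hP j
  have h2 := h.d_add hP j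
  have h3 := innerFst_le (z := z) (P := P) j j
  omega

theorem d_lt_rdim (j : Fin (m + 1)) : d wd P j < rdim wd P j := by
  have h1 := h.rdim_add hP j
  have h2 := h.d_add hP j
  have h3 := innerSnd_le (z := z) (P := P) j j
  omega

theorem d_last : d wd P (Fin.last m) = z + 1 := by
  have h1 : innerFst z wd P (Fin.last m) (Fin.last m) = 0 := by
    rw [← Nat.le_zero, innerFst_le_iff]
    intro i hi hlt
    rw [le_antisymm (Fin.le_last i) hi] at hlt
    exact absurd hlt (lt_irrefl _)
  have h2 : innerSnd z wd P (Fin.last m) (Fin.last m) = 0 := by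
    rw [← Nat.le_zero, innerSnd_le_iff]
    intro i hi hlt
    rw [le_antisymm (Fin.le_last i) hi] at hlt
    exact absurd hlt (lt_irrefl _)
  have := h.d_add hP (Fin.last m)
  omega

theorem bottom_injective : Function.Injective (bottom wd P) := by
  have key : ∀ k k' : Fin (m + 1), k < k' → bottom wd P k ≠ bottom wd P k' := by
    intro k k' hlt he
    refine (h.bottom_spec hP k).1.2 k' hlt ?_
    rw [he]
    exact (h.bottom_spec hP k').1.1
  intro k k' he
  rcases lt_trichotomy k k' with hlt | hlt | hlt
  · exact absurd he (key _ _ hlt)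
  · exact hlt
  · exact absurd he.symm (key _ _ hlt)

/-- A rectangle of index `k` not below the peak `P j`, whose lowest box lies just above a box of
`R_j`, has smaller index. -/
theorem lt_of_box_bottom {j k : Fin (m + 1)} {x : Fin wd.length} (hx : x ∈ rect wd P j)
    (hle : box z wd x ≤ box z wd (bottom wd P k))
    (hnot : ¬ box z wd (bottom wd P k) ≤ box z wd (P j)) : k < j := by
  by_contra hc
  rcases (not_lt.1 hc).eq_or_lt with rfl | hlt
  · exact hnot ((h.heapLE_iff _ _).1 (h.bottom_spec hP j).1.1)
  · refine hx.2 k hlt ((h.heapLE_iff _ _).2 (hle.trans ?_))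
    exact (h.heapLE_iff _ _).1 (h.bottom_spec hP k).1.1

theorem leftmost_mem (j : Fin (m + 1)) : leftmost wd P j ∈ rect wd P j := by
  rw [h.mem_rect_iff hP, h.box_leftmost hP]
  exact ⟨⟨innerFst_le _ _, le_rfl⟩, le_rfl, innerSnd_le _ _⟩

theorem rightmost_mem (j : Fin (m + 1)) : rightmost wd P j ∈ rect wd P j := by
  rw [h.mem_rect_iff hP, h.box_rightmost hP]
  exact ⟨⟨le_rfl, innerFst_le _ _⟩, innerSnd_le _ _, le_rfl⟩

/-- The left predecessor of `R_j` is the rectangle whose lowest box lies just outside `R_j`, above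
its leftmost box. -/
theorem lpred_cond_iff {j k : Fin (m + 1)} :
    (k < j ∧ heapCovBy wd (leftmost wd P j) (bottom wd P k) ∧
      col wd (bottom wd P k) + 1 = col wd (leftmost wd P j)) ↔
    box z wd (bottom wd P k) = ((box z wd (P j)).1 + 1, innerSnd z wd P j j) := by
  have hl := h.col_add_box_fst (leftmost wd P j)
  have hb := h.col_add_box_fst (bottom wd P k)
  rw [h.box_leftmost hP] at hl
  simp only at hl
  constructor
  · rintro ⟨-, ⟨h1, h2⟩, h3⟩
    rw [h.heapLT_iff, h.box_leftmost hP] at h1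
    obtain ⟨h4, h5⟩ := Prod.le_def.1 h1.le
    simp only at h4 h5
    by_contra hne
    obtain ⟨c, hc⟩ := h.exists_box_of_le (bottom wd P k)
      (c := ((box z wd (P j)).1 + 1, innerSnd z wd P j j)) (Prod.le_def.2 (by simp only; omega))
    refine h2 ⟨c, ?_, ?_⟩
    · rw [h.heapLT_iff, h.box_leftmost hP, hc, Prod.mk_lt_mk_iff_left]
      exact Nat.lt_succ_self _
    · rw [h.heapLT_iff, hc]
      refine lt_of_le_of_ne (Prod.le_def.2 (by simp only; omega)) fun he => hne he.symm
  · intro he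
    rw [he] at hb
    simp only at hb
    have hlt : box z wd (leftmost wd P j) < box z wd (bottom wd P k) := by
      rw [h.box_leftmost hP, he, Prod.mk_lt_mk_iff_left]
      exact Nat.lt_succ_self _
    refine ⟨?_, ⟨(h.heapLT_iff _ _).2 hlt, ?_⟩, by omega⟩
    · refine h.lt_of_box_bottom hP (h.leftmost_mem hP j) hlt.le fun hle => ?_
      rw [he] at hle
      have := (Prod.le_def.1 hle).1
      simp only at this
      omega
    · rintro ⟨c, h1, h2⟩
      rw [h.heapLT_iff, h.box_leftmost hP] at h1
      rw [h.heapLT_iff, he] at h2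
      rw [Prod.lt_iff] at h1 h2
      simp only at h1 h2
      omega

/-- The right predecessor of `R_j` is the rectangle whose lowest box lies just outside `R_j`, above
its rightmost box. -/
theorem rpred_cond_iff {j k : Fin (m + 1)} :
    (k < j ∧ heapCovBy wd (rightmost wd P j) (bottom wd P k) ∧
      col wd (bottom wd P k) = col wd (rightmost wd P j) + 1) ↔
    box z wd (bottom wd P k) = (innerFst z wd P j j, (box z wd (P j)).2 + 1) := by
  have hl := h.col_add_box_fst (rightmost wd P j)
  have hb := h.col_add_box_fst (bottom wd P k)
  rw [h.box_rightmost hP] at hl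
  simp only at hl
  constructor
  · rintro ⟨-, ⟨h1, h2⟩, h3⟩
    rw [h.heapLT_iff, h.box_rightmost hP] at h1
    obtain ⟨h4, h5⟩ := Prod.le_def.1 h1.le
    simp only at h4 h5
    by_contra hne
    obtain ⟨c, hc⟩ := h.exists_box_of_le (bottom wd P k)
      (c := (innerFst z wd P j j, (box z wd (P j)).2 + 1)) (Prod.le_def.2 (by simp only; omega))
    refine h2 ⟨c, ?_, ?_⟩
    · rw [h.heapLT_iff, h.box_rightmost hP, hc, Prod.mk_lt_mk_iff_right]
      exact Nat.lt_succ_self _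
    · rw [h.heapLT_iff, hc]
      refine lt_of_le_of_ne (Prod.le_def.2 (by simp only; omega)) fun he => hne he.symm
  · intro he
    rw [he] at hb
    simp only at hb
    have hlt : box z wd (rightmost wd P j) < box z wd (bottom wd P k) := by
      rw [h.box_rightmost hP, he, Prod.mk_lt_mk_iff_right]
      exact Nat.lt_succ_self _
    refine ⟨?_, ⟨(h.heapLT_iff _ _).2 hlt, ?_⟩, by omega⟩
    · refine h.lt_of_box_bottom hP (h.rightmost_mem hP j) hlt.le fun hle => ?_
      rw [he] at hle
      have := (Prod.le_def.1 hle).2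
      simp only at this
      omega
    · rintro ⟨c, h1, h2⟩
      rw [h.heapLT_iff, h.box_rightmost hP] at h1
      rw [h.heapLT_iff, he] at h2
      rw [Prod.lt_iff] at h1 h2
      simp only at h1 h2
      omega

end IsGrassmannianWord

open Classical in
/-- The value attached to a point `c` of the boundary of the diagram: it is `W k` if `c` is the
lowest box of the `k`-th rectangle, and otherwise given by the column of `c`. -/
noncomputable def boundaryValue {α : Type} (z : Fin (n - 1)) (wd : List (Fin (n - 1)))
    (P : Fin (m + 1) → Fin wd.length) (W : Fin (m + 1) → α) (E : ℕ → α) (c : ℕ × ℕ) : α :=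
  if hc : ∃ k, box z wd (bottom wd P k) = c then W hc.choose else E (z + 1 + c.2 - c.1)

namespace IsGrassmannianWord

variable (h : IsGrassmannianWord z wd) (hP : IsPeakOrdering wd P) {α : Type}
include h hP

theorem boundaryValue_bottom (W : Fin (m + 1) → α) (E : ℕ → α) {c : ℕ × ℕ} {k : Fin (m + 1)}
    (hk : box z wd (bottom wd P k) = c) : boundaryValue z wd P W E c = W k := by
  have hex : ∃ k, box z wd (bottom wd P k) = c := ⟨k, hk⟩
  rw [boundaryValue, dif_pos hex]
  congr 1
  exact h.bottom_injective hP (h.box_injective (hex.choose_spec.trans hk.symm))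

theorem lowerOf_eq (W : Fin (m + 1) → α) (E : ℕ → α) (j : Fin (m + 1)) :
    lowerOf wd P W E j =
      boundaryValue z wd P W E ((box z wd (P j)).1 + 1, innerSnd z wd P j j) := by
  unfold lowerOf
  cases hl : lpred wd P j with
  | some k =>
    exact (h.boundaryValue_bottom hP W E ((h.lpred_cond_iff hP).1 (lpred_spec hl))).symm
  | none =>
    have : ¬ ∃ k, box z wd (bottom wd P k) = ((box z wd (P j)).1 + 1, innerSnd z wd P j j) := by
      rintro ⟨k, hk⟩
      unfold lpred at hl
      rw [dif_pos ⟨k, (h.lpred_cond_iff hP).2 hk⟩] at hl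
      exact Option.some_ne_none _ hl
    have h1 := h.ldim_add hP j
    simp only [boundaryValue, dif_neg this]
    congr 1
    omega

theorem upperOf_eq (W : Fin (m + 1) → α) (E : ℕ → α) (j : Fin (m + 1)) :
    upperOf wd P W E j =
      boundaryValue z wd P W E (innerFst z wd P j j, (box z wd (P j)).2 + 1) := by
  unfold upperOf
  cases hl : rpred wd P j with
  | some k =>
    exact (h.boundaryValue_bottom hP W E ((h.rpred_cond_iff hP).1 (rpred_spec hl))).symm
  | none =>
    have : ¬ ∃ k, box z wd (bottom wd P k) = (innerFst z wd P j j, (box z wd (P j)).2 + 1) := by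
      rintro ⟨k, hk⟩
      unfold rpred at hl
      rw [dif_pos ⟨k, (h.rpred_cond_iff hP).2 hk⟩] at hl
      exact Option.some_ne_none _ hl
    have h1 := h.rdim_add hP j
    simp only [boundaryValue, dif_neg this]
    congr 1
    omega

/-- Removing the rectangle `R_j` to the right of the `k`-th peak either leaves the valley to the
right of this peak unchanged, or replaces it, the left valley of `R_j`, by the bottom of `R_j`. -/
theorem right_valley_succ {j k : Fin (m + 1)} (hjk : j < k)
    (hlt : (box z wd (P j)).1 < (box z wd (P k)).1) :
    innerFst z wd P (j + 1) k = innerFst z wd P j k ∨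
      (innerFst z wd P j k = (box z wd (P j)).1 + 1 ∧
        innerSnd z wd P j j = (box z wd (P k)).2 + 1 ∧
        innerFst z wd P j j = innerFst z wd P (j + 1) k) := by
  by_cases hc : (box z wd (P j)).1 + 1 ≤ innerFst z wd P (j + 1) k
  · left
    refine le_antisymm (innerFst_le_iff.2 fun i hi hl => ?_) (innerFst_le_iff.2 fun i hi hl => ?_)
    · exact innerFst_le_iff.1 le_rfl i (by omega) hl
    · rcases hi.eq_or_lt with he | hi
      · rw [← Fin.ext he]
        exact hc
      · exact innerFst_le_iff.1 le_rfl i hi hl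
  · right
    push Not at hc
    -- no remaining peak lies between the `k`-th and the `j`-th
    have hno : ∀ i : Fin (m + 1), j < i → (box z wd (P i)).1 < (box z wd (P k)).1 →
        (box z wd (P i)).1 < (box z wd (P j)).1 := by
      intro i hi hl
      have := innerFst_le_iff.1 (Nat.lt_succ_iff.1 hc) i hi hl
      exact this
    refine ⟨le_antisymm (innerFst_le_iff.2 fun i hi hl => ?_) ?_,
      le_antisymm (innerSnd_le_iff.2 fun i hi hl => ?_) ?_,
      le_antisymm (innerFst_le_iff.2 fun i hi hl => ?_) (innerFst_le_iff.2 fun i hi hl => ?_)⟩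
    · rcases hi.eq_or_lt with he | hi
      · rw [← Fin.ext he]
        exact Nat.lt_succ_self _
      · exact (hno i hi hl).trans (Nat.lt_succ_self _)
    · exact innerFst_le_iff.1 le_rfl j le_rfl hlt
    · by_contra hge
      push Not at hge
      have h1 : (box z wd (P k)).2 < (box z wd (P i)).2 := hge
      rw [← h.peak_fst_lt_iff hP] at h1 hl
      have hij : j < i := lt_of_le_of_ne hi (by rintro rfl; exact lt_irrefl _ hl)
      exact lt_asymm hl (hno i hij h1)
    · exact innerSnd_le_iff.1 le_rfl k hjk.le ((h.peak_fst_lt_iff hP).1 hlt)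
    · have hij : j < i := lt_of_le_of_ne hi (by rintro rfl; exact lt_irrefl _ hl)
      exact innerFst_le_iff.1 le_rfl i hij (hl.trans hlt)
    · exact innerFst_le_iff.1 le_rfl i (by omega) (hno i hi hl)

/-- The mirror image of `right_valley_succ`. -/
theorem left_valley_succ {j k : Fin (m + 1)} (hjk : j < k)
    (hlt : (box z wd (P j)).2 < (box z wd (P k)).2) :
    innerSnd z wd P (j + 1) k = innerSnd z wd P j k ∨
      (innerSnd z wd P j k = (box z wd (P j)).2 + 1 ∧
        innerFst z wd P j j = (box z wd (P k)).1 + 1 ∧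
        innerSnd z wd P j j = innerSnd z wd P (j + 1) k) := by
  by_cases hc : (box z wd (P j)).2 + 1 ≤ innerSnd z wd P (j + 1) k
  · left
    refine le_antisymm (innerSnd_le_iff.2 fun i hi hl => ?_) (innerSnd_le_iff.2 fun i hi hl => ?_)
    · exact innerSnd_le_iff.1 le_rfl i (by omega) hl
    · rcases hi.eq_or_lt with he | hi
      · rw [← Fin.ext he]
        exact hc
      · exact innerSnd_le_iff.1 le_rfl i hi hl
  · right
    push Not at hc
    -- no remaining peak lies between the `j`-th and the `k`-th
    have hno : ∀ i : Fin (m + 1), j < i → (box z wd (P i)).2 < (box z wd (P k)).2 →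
        (box z wd (P i)).2 < (box z wd (P j)).2 := by
      intro i hi hl
      have := innerSnd_le_iff.1 (Nat.lt_succ_iff.1 hc) i hi hl
      exact this
    refine ⟨le_antisymm (innerSnd_le_iff.2 fun i hi hl => ?_) ?_,
      le_antisymm (innerFst_le_iff.2 fun i hi hl => ?_) ?_,
      le_antisymm (innerSnd_le_iff.2 fun i hi hl => ?_) (innerSnd_le_iff.2 fun i hi hl => ?_)⟩
    · rcases hi.eq_or_lt with he | hi
      · rw [← Fin.ext he]
        exact Nat.lt_succ_self _
      · exact (hno i hi hl).trans (Nat.lt_succ_self _)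
    · exact innerSnd_le_iff.1 le_rfl j le_rfl hlt
    · by_contra hge
      push Not at hge
      have h1 : (box z wd (P k)).1 < (box z wd (P i)).1 := hge
      rw [h.peak_fst_lt_iff hP] at h1 hl
      have hij : j < i := lt_of_le_of_ne hi (by rintro rfl; exact lt_irrefl _ hl)
      exact lt_asymm hl (hno i hij h1)
    · exact innerFst_le_iff.1 le_rfl k hjk.le ((h.peak_fst_lt_iff hP).2 hlt)
    · have hij : j < i := lt_of_le_of_ne hi (by rintro rfl; exact lt_irrefl _ hl)
      exact innerSnd_le_iff.1 le_rfl i hij (hl.trans hlt)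
    · exact innerSnd_le_iff.1 le_rfl i (by omega) (hno i hi hl)

/-- When the rectangles of index smaller than `j` are removed, the values attached to the valleys
on both sides of every remaining peak are nested. -/
theorem boundaryValue_le [Preorder α] {W : Fin (m + 1) → α} {E : ℕ → α} (hE : Monotone E) (j : ℕ)
    (hW : ∀ i : Fin (m + 1), (i : ℕ) < j → lowerOf wd P W E i ≤ W i ∧ W i ≤ upperOf wd P W E i)
    (k : Fin (m + 1)) (hk : j ≤ k) :
    boundaryValue z wd P W E ((box z wd (P k)).1 + 1, innerSnd z wd P j k) ≤
      boundaryValue z wd P W E (innerFst z wd P j k, (box z wd (P k)).2 + 1) := by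
  induction j with
  | zero =>
    -- the valleys of the whole heap lie outside the diagram
    have hl : ¬ ∃ i, box z wd (bottom wd P i) = ((box z wd (P k)).1 + 1, innerSnd z wd P 0 k) := by
      rintro ⟨i, hi⟩
      obtain ⟨l, hl⟩ := h.exists_peak_ge hP (bottom wd P i)
      rw [hi, Prod.le_def] at hl
      simp only at hl
      have h1 := (h.peak_fst_lt_iff hP (j := k) (k := l)).1 (by omega)
      have := innerSnd_le_iff.1 (le_refl (innerSnd z wd P 0 k)) l (Nat.zero_le _) h1
      omega
    have hr : ¬ ∃ i, box z wd (bottom wd P i) = (innerFst z wd P 0 k, (box z wd (P k)).2 + 1) := by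
      rintro ⟨i, hi⟩
      obtain ⟨l, hl⟩ := h.exists_peak_ge hP (bottom wd P i)
      rw [hi, Prod.le_def] at hl
      simp only at hl
      have h1 := (h.peak_fst_lt_iff hP (j := l) (k := k)).2 (by omega)
      have := innerFst_le_iff.1 (le_refl (innerFst z wd P 0 k)) l (Nat.zero_le _) h1
      omega
    simp only [boundaryValue, dif_neg hl, dif_neg hr]
    have h1 := innerFst_le (z := z) (P := P) 0 k
    have h2 := innerSnd_le (z := z) (P := P) 0 k
    exact hE (by omega)
  | succ j ih =>
    have ih := ih (fun i hi => hW i (by omega)) (by omega)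
    have hjm : j < m + 1 := by omega
    obtain ⟨hL, hU⟩ := hW ⟨j, hjm⟩ (Nat.lt_succ_self j)
    rw [h.lowerOf_eq hP] at hL
    rw [h.upperOf_eq hP] at hU
    have hjk : (⟨j, hjm⟩ : Fin (m + 1)) < k := Fin.lt_def.2 hk
    -- removing `R_j` changes at most one of the two valleys of the `k`-th peak; if it does, the chain
    -- of inclusions is extended by one of the two conditions on `W j`
    rcases (h.peak_fst_ne hP hjk.ne).lt_or_gt with hlt | hgt
    · have h1 := innerSnd_succ (j := ⟨j, hjm⟩) (k := k)
        ((h.peak_fst_lt_iff hP).1 hlt).asymm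
      simp only at h1
      rw [h1]
      rcases h.right_valley_succ hP hjk hlt with h2 | ⟨h2, h3, h4⟩
      · simp only at h2
        rwa [h2]
      · simp only at h2 h4 hL
        rw [h2] at ih
        rw [h3] at hL
        rw [h.boundaryValue_bottom hP W E (c := (innerFst z wd P (j + 1) k, _)) (k := ⟨j, hjm⟩)
          (by rw [h.box_bottom hP]; exact Prod.ext h4 h3)]
        exact ih.trans hL
    · have hgt' := (h.peak_fst_lt_iff hP).1 hgt
      have h1 := innerFst_succ (j := ⟨j, hjm⟩) (k := k) (not_lt.2 hgt.le)
      simp only at h1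
      rw [h1]
      rcases h.left_valley_succ hP hjk hgt' with h2 | ⟨h2, h3, h4⟩
      · simp only at h2
        rwa [h2]
      · simp only at h2 h4 hU
        rw [h2] at ih
        rw [h3] at hU
        rw [h.boundaryValue_bottom hP W E (c := (_, innerSnd z wd P (j + 1) k)) (k := ⟨j, hjm⟩)
          (by rw [h.box_bottom hP]; exact Prod.ext h3 h4)]
        exact hU.trans ih

/-- The conditions on the members of index smaller than `j` of a configuration imply that the
lower bound for the `j`-th member is contained in the upper bound. -/
theorem lowerOf_le_upperOf [Preorder α] {W : Fin (m + 1) → α} {E : ℕ → α} (hE : Monotone E)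
    (j : Fin (m + 1))
    (hW : ∀ i < j, lowerOf wd P W E i ≤ W i ∧ W i ≤ upperOf wd P W E i) :
    lowerOf wd P W E j ≤ upperOf wd P W E j := by
  rw [h.lowerOf_eq hP, h.upperOf_eq hP]
  exact h.boundaryValue_le hP hE j hW j le_rfl

end IsGrassmannianWord

end Rectangles

/-! ### Reduced echelon bases and pivots -/

section Echelon

variable {n : ℕ}

theorem e_apply (i j : Fin n) : (e i : V n) j = if j = i then 1 else 0 := by simp [e]

theorem diag_apply (c : Fin n → ℂ) (x : V n) (i : Fin n) : diag c x i = c i * x i := by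
  simp [diag, Matrix.mulVec_diagonal]

theorem sum_smul_apply (S : Finset (Fin n)) (c : Fin n → ℂ) (w : Fin n → V n) (j : Fin n) :
    (∑ s ∈ S, c s • w s) j = ∑ s ∈ S, c s * w s j := by simp

theorem eq_sum_smul_e (x : V n) : x = ∑ i, x i • e i := by
  ext j
  rw [sum_smul_apply]
  simp

/-- The vectors `w s` with `s ∈ S` form a reduced echelon family with pivots `S`: the last nonzero
coordinate of `w s` is its `s`-th one, which equals `1`, and the other members of the family vanish
there. The values of `w` outside `S` play no role. -/
structure IsEchelon (S : Finset (Fin n)) (w : Fin n → V n) : Prop where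
  self : ∀ s ∈ S, w s s = 1
  other : ∀ s ∈ S, ∀ t ∈ S, t ≠ s → w s t = 0
  above : ∀ s ∈ S, ∀ t, s < t → w s t = 0

/-- The span of the members of a family with indices in `S`. -/
def spanOn (S : Finset (Fin n)) (w : Fin n → V n) : Submodule ℂ (V n) :=
  Submodule.span ℂ (w '' S)

theorem mem_spanOn {S : Finset (Fin n)} {w : Fin n → V n} {s : Fin n} (hs : s ∈ S) :
    w s ∈ spanOn S w := Submodule.subset_span ⟨s, hs, rfl⟩

theorem spanOn_le {S : Finset (Fin n)} {w : Fin n → V n} {U : Submodule ℂ (V n)} :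
    spanOn S w ≤ U ↔ ∀ s ∈ S, w s ∈ U := by
  rw [spanOn, Submodule.span_le, Set.image_subset_iff]
  rfl

theorem sum_mem_spanOn (S : Finset (Fin n)) (w : Fin n → V n) (c : Fin n → ℂ) :
    ∑ s ∈ S, c s • w s ∈ spanOn S w :=
  Submodule.sum_mem _ fun _ hs => Submodule.smul_mem _ _ (mem_spanOn hs)

theorem spanOn_congr {S : Finset (Fin n)} {w w' : Fin n → V n} (h : ∀ s ∈ S, w s = w' s) :
    spanOn S w = spanOn S w' := by
  rw [spanOn, spanOn, Set.image_congr h]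

open Classical in
/-- The pivots of a subspace: the positions of the last nonzero coordinates of its vectors. -/
noncomputable def pivots (U : Submodule ℂ (V n)) : Finset (Fin n) :=
  Finset.univ.filter fun s => ∃ x ∈ U, x s ≠ 0 ∧ ∀ t, s < t → x t = 0

theorem mem_pivots {U : Submodule ℂ (V n)} {s : Fin n} :
    s ∈ pivots U ↔ ∃ x ∈ U, x s ≠ 0 ∧ ∀ t, s < t → x t = 0 := by simp [pivots]

theorem exists_last_ne_zero {x : V n} (hx : x ≠ 0) : ∃ s, x s ≠ 0 ∧ ∀ t, s < t → x t = 0 := by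
  have hne : (Finset.univ.filter fun s => x s ≠ 0).Nonempty := by
    by_contra hc
    refine hx (PiLp.ext fun i => ?_)
    by_contra hi
    exact hc ⟨i, by simpa using hi⟩
  refine ⟨_, (Finset.mem_filter.1 (Finset.max'_mem _ hne)).2, fun t ht => ?_⟩
  by_contra hc
  exact absurd (Finset.le_max' _ t (by simpa using hc)) (not_le.2 ht)

/-- A vector of a subspace vanishing at all pivots vanishes. -/
theorem eq_zero_of_pivots {U : Submodule ℂ (V n)} {x : V n} (hx : x ∈ U)
    (h : ∀ s ∈ pivots U, x s = 0) : x = 0 := by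
  by_contra hne
  obtain ⟨s, hs, hs'⟩ := exists_last_ne_zero hne
  exact hs (h s (mem_pivots.2 ⟨x, hx, hs, hs'⟩))

namespace IsEchelon

variable {S : Finset (Fin n)} {w : Fin n → V n}

theorem sum_apply (h : IsEchelon S w) (c : Fin n → ℂ) {t : Fin n} (ht : t ∈ S) :
    (∑ s ∈ S, c s • w s) t = c t := by
  rw [sum_smul_apply, Finset.sum_eq_single_of_mem t ht, h.self t ht, mul_one]
  intro s hs hst
  rw [h.other s hs t ht hst.symm, mul_zero]

theorem eq_sum (h : IsEchelon S w) {x : V n} (hx : x ∈ spanOn S w) :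
    x = ∑ s ∈ S, x s • w s := by
  induction hx using Submodule.span_induction with
  | mem x hx =>
    obtain ⟨s, hs, rfl⟩ := hx
    rw [Finset.sum_eq_single_of_mem s hs, h.self s hs, one_smul]
    intro t ht hts
    rw [h.other s hs t ht hts, zero_smul]
  | zero => simp
  | add x y _ _ hx hy =>
    conv_lhs => rw [hx, hy]
    simp [add_smul, Finset.sum_add_distrib]
  | smul a x _ hx =>
    conv_lhs => rw [hx]
    simp [Finset.smul_sum, smul_smul]

theorem ext_of_mem (h : IsEchelon S w) {x y : V n} (hx : x ∈ spanOn S w) (hy : y ∈ spanOn S w)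
    (hxy : ∀ s ∈ S, x s = y s) : x = y := by
  rw [h.eq_sum hx, h.eq_sum hy]
  exact Finset.sum_congr rfl fun s hs => by rw [hxy s hs]

theorem pivots_spanOn (h : IsEchelon S w) : pivots (spanOn S w) = S := by
  ext t
  rw [mem_pivots]
  constructor
  · rintro ⟨x, hx, h1, h2⟩
    by_contra ht
    refine h1 ?_
    rw [h.eq_sum hx, sum_smul_apply]
    refine Finset.sum_eq_zero fun s hs => ?_
    rcases lt_trichotomy s t with hst | rfl | hst
    · rw [h.above s hs t hst, mul_zero]
    · exact absurd hs ht
    · rw [h2 s hst, zero_mul]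
  · intro ht
    exact ⟨w t, mem_spanOn ht, by simp [h.self t ht], h.above t ht⟩

theorem finrank_spanOn (h : IsEchelon S w) : Module.finrank ℂ (spanOn S w) = S.card := by
  have hli : LinearIndependent ℂ fun s : S => w s := by
    rw [Fintype.linearIndependent_iff]
    intro g hg t
    have h1 := h.sum_apply (fun s => if hs : s ∈ S then g ⟨s, hs⟩ else 0) t.2
    rw [← Finset.sum_coe_sort] at h1
    simp only [Finset.coe_mem, dif_pos, Subtype.coe_eta, hg] at h1
    exact h1.symm
  have h2 := finrank_span_eq_card hli
  rw [Fintype.card_coe] at h2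
  rw [← h2, spanOn, Set.image_eq_range]
  rfl

theorem unique (h : IsEchelon S w) {w' : Fin n → V n} (h' : IsEchelon S w')
    (hs : spanOn S w = spanOn S w') {s : Fin n} (hsS : s ∈ S) : w s = w' s := by
  refine h.ext_of_mem (mem_spanOn hsS) (hs ▸ mem_spanOn hsS) fun t ht => ?_
  by_cases hts : t = s
  · rw [hts, h.self s hsS, h'.self s hsS]
  · rw [h.other s hsS t ht hts, h'.other s hsS t ht hts]

end IsEchelon

/-- Every subspace has a reduced echelon basis. -/
theorem exists_isEchelon (U : Submodule ℂ (V n)) :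
    ∃ w : Fin n → V n, IsEchelon (pivots U) w ∧ spanOn (pivots U) w = U := by
  -- induction on the pivot: a vector with last nonzero coordinate there is normalized, and its
  -- coordinates at the smaller pivots are cleared
  have key : ∀ k : ℕ, ∀ s : Fin n, (s : ℕ) = k → s ∈ pivots U → ∃ x ∈ U, x s = 1 ∧
      (∀ t ∈ pivots U, t ≠ s → x t = 0) ∧ ∀ t, s < t → x t = 0 := by
    intro k
    induction k using Nat.strong_induction_on with
    | _ k ih =>
      rintro s rfl hs
      obtain ⟨y, hyU, hy, hy'⟩ := mem_pivots.1 hs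
      have ih' : ∀ t : Fin n, ∃ x : V n, t ∈ pivots U → t < s → x ∈ U ∧ x t = 1 ∧
          (∀ r ∈ pivots U, r ≠ t → x r = 0) ∧ ∀ r, t < r → x r = 0 := by
        intro t
        by_cases ht : t ∈ pivots U ∧ t < s
        · obtain ⟨x, hx⟩ := ih t ht.2 t rfl ht.1
          exact ⟨x, fun _ _ => hx⟩
        · exact ⟨0, fun h1 h2 => absurd ⟨h1, h2⟩ ht⟩
      choose w hw using ih'
      set R := (pivots U).filter (· < s) with hR
      have hmem : ∀ t ∈ R, t ∈ pivots U ∧ t < s := fun t ht => Finset.mem_filter.1 ht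
      set c := (y s)⁻¹ with hc
      refine ⟨c • y - ∑ t ∈ R, (c * y t) • w t, ?_, ?_, ?_, ?_⟩
      · exact U.sub_mem (U.smul_mem _ hyU) (U.sum_mem fun t ht =>
          U.smul_mem _ (hw t (hmem t ht).1 (hmem t ht).2).1)
      · rw [PiLp.sub_apply, sum_smul_apply, PiLp.smul_apply, smul_eq_mul, hc, inv_mul_cancel₀ hy,
          Finset.sum_eq_zero, sub_zero]
        intro t ht
        rw [(hw t (hmem t ht).1 (hmem t ht).2).2.2.2 s (hmem t ht).2, mul_zero]
      · intro r hr hrs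
        rw [PiLp.sub_apply, sum_smul_apply, PiLp.smul_apply, smul_eq_mul]
        rcases hrs.lt_or_gt with hlt | hgt
        · have hrR : r ∈ R := Finset.mem_filter.2 ⟨hr, hlt⟩
          rw [Finset.sum_eq_single_of_mem r hrR, (hw r hr hlt).2.1, mul_one, sub_self]
          intro t ht htr
          rw [(hw t (hmem t ht).1 (hmem t ht).2).2.2.1 r hr htr.symm, mul_zero]
        · rw [hy' r hgt, mul_zero, Finset.sum_eq_zero, sub_zero]
          intro t ht
          rw [(hw t (hmem t ht).1 (hmem t ht).2).2.2.2 r ((hmem t ht).2.trans hgt), mul_zero]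
      · intro r hgt
        rw [PiLp.sub_apply, sum_smul_apply, PiLp.smul_apply, smul_eq_mul, hy' r hgt, mul_zero,
          Finset.sum_eq_zero, sub_zero]
        intro t ht
        rw [(hw t (hmem t ht).1 (hmem t ht).2).2.2.2 r ((hmem t ht).2.trans hgt), mul_zero]
  have key' : ∀ s : Fin n, ∃ x : V n, s ∈ pivots U → x ∈ U ∧ x s = 1 ∧
      (∀ t ∈ pivots U, t ≠ s → x t = 0) ∧ ∀ t, s < t → x t = 0 := by
    intro s
    by_cases hs : s ∈ pivots U
    · obtain ⟨x, hx⟩ := key s s rfl hs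
      exact ⟨x, fun _ => hx⟩
    · exact ⟨0, fun h => absurd h hs⟩
  choose w hw using key'
  have hE : IsEchelon (pivots U) w :=
    ⟨fun s hs => (hw s hs).2.1, fun s hs => (hw s hs).2.2.1, fun s hs => (hw s hs).2.2.2⟩
  refine ⟨w, hE, le_antisymm (spanOn_le.2 fun s hs => (hw s hs).1) fun x hx => ?_⟩
  have h0 : x - ∑ s ∈ pivots U, x s • w s = 0 := by
    refine eq_zero_of_pivots (U.sub_mem hx
      (U.sum_mem fun s hs => U.smul_mem _ (hw s hs).1)) fun s hs => ?_
    rw [PiLp.sub_apply, hE.sum_apply _ hs, sub_self]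
  rw [sub_eq_zero.1 h0]
  exact sum_mem_spanOn _ _ _

theorem isEchelon_e (S : Finset (Fin n)) : IsEchelon S (e : Fin n → V n) where
  self s _ := by simp
  other s _ t _ h := by rw [e_apply, if_neg h]
  above s _ t h := by rw [e_apply, if_neg h.ne']

theorem coordSpan_eq_spanOn (S : Finset (Fin n)) : coordSpan (S : Set (Fin n)) = spanOn S e := rfl

theorem mem_coordSpan_iff {S : Set (Fin n)} {x : V n} : x ∈ coordSpan S ↔ ∀ i ∉ S, x i = 0 := by
  classical
  lift S to Finset (Fin n) using S.toFinite
  rw [coordSpan_eq_spanOn]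
  constructor
  · intro hx i hi
    rw [(isEchelon_e S).eq_sum hx, sum_smul_apply]
    refine Finset.sum_eq_zero fun s hs => ?_
    rw [e_apply, if_neg, mul_zero]
    rintro rfl
    exact hi hs
  · intro hx
    rw [eq_sum_smul_e x]
    refine Submodule.sum_mem _ fun i _ => ?_
    by_cases hi : i ∈ S
    · exact Submodule.smul_mem _ _ (mem_spanOn hi)
    · rw [hx i (by simpa using hi), zero_smul]
      exact Submodule.zero_mem _

theorem e_mem_coordSpan_iff {S : Set (Fin n)} {i : Fin n} : (e i : V n) ∈ coordSpan S ↔ i ∈ S := by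
  rw [mem_coordSpan_iff]
  constructor
  · intro h
    by_contra hi
    have := h i hi
    simp at this
  · intro hi j hj
    rw [e_apply, if_neg]
    rintro rfl
    exact hj hi

theorem coordSpan_le_iff {S T : Set (Fin n)} :
    (coordSpan S : Submodule ℂ (V n)) ≤ coordSpan T ↔ S ⊆ T := by
  constructor
  · intro h i hi
    exact e_mem_coordSpan_iff.1 (h (e_mem_coordSpan_iff.2 hi))
  · intro h
    exact Submodule.span_mono (Set.image_mono h)

theorem coordSpan_injective :
    Function.Injective (coordSpan : Set (Fin n) → Submodule ℂ (V n)) := fun _ _ h =>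
  Set.Subset.antisymm (coordSpan_le_iff.1 h.le) (coordSpan_le_iff.1 h.ge)

theorem mem_coordSet {U : Submodule ℂ (V n)} {i : Fin n} : i ∈ coordSet U ↔ e i ∈ U := by
  simp [coordSet]

theorem coordSet_coordSpan (S : Finset (Fin n)) :
    coordSet (coordSpan (S : Set (Fin n)) : Submodule ℂ (V n)) = S := by
  ext i
  rw [mem_coordSet, e_mem_coordSpan_iff, Finset.mem_coe]

theorem finrank_coordSpan (S : Finset (Fin n)) :
    Module.finrank ℂ (coordSpan (S : Set (Fin n)) : Submodule ℂ (V n)) = S.card :=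
  (isEchelon_e S).finrank_spanOn

/-! ### Limits of subspaces under the one-dimensional torus -/

theorem tendsto_clm_of_basis {l : Filter ℂ} {f : ℂ → V n →L[ℂ] V n} {g : V n →L[ℂ] V n}
    (h : ∀ k, Tendsto (fun t => f t (e k)) l (𝓝 (g (e k)))) : Tendsto f l (𝓝 g) := by
  have key : ∀ f : V n →L[ℂ] V n,
      f = ∑ k, (EuclideanSpace.proj k : V n →L[ℂ] ℂ).smulRight (f (e k)) := by
    intro f
    ext x : 1
    conv_lhs => rw [eq_sum_smul_e x]
    simp
  rw [key g, show f = fun t => ∑ k, (EuclideanSpace.proj k : V n →L[ℂ] ℂ).smulRight (f t (e k)) from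
    funext fun t => key (f t)]
  refine tendsto_finsetSum _ fun k _ => ?_
  exact ((ContinuousLinearMap.smulRightL ℂ (V n) (V n)
    (EuclideanSpace.proj k)).continuous.tendsto _).comp (h k)

/-- A criterion for the convergence of orthogonal projections: each coordinate vector is, up to an
error tending to zero, the sum of a convergent vector of `U t` and a vector orthogonal to `U t`. -/
theorem tendsto_starProjection {l : Filter ℂ} {U : ℂ → Submodule ℂ (V n)}
    {U₀ : Submodule ℂ (V n)}
    (h : ∀ k : Fin n, ∃ a b : ℂ → V n, (∀ᶠ t in l, a t ∈ U t ∧ b t ∈ (U t)ᗮ) ∧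
      Tendsto (fun t => a t + b t) l (𝓝 (e k)) ∧ Tendsto a l (𝓝 (U₀.starProjection (e k)))) :
    Tendsto (fun t => (U t).starProjection) l (𝓝 U₀.starProjection) := by
  refine tendsto_clm_of_basis fun k => ?_
  obtain ⟨a, b, h1, h2, h3⟩ := h k
  have h4 : ∀ᶠ t in l, (U t).starProjection (e k) =
      (U t).starProjection (e k - (a t + b t)) + a t := by
    filter_upwards [h1] with t ht
    have ha : (U t).starProjection (a t) = a t := Submodule.starProjection_eq_self_iff.2 ht.1
    have hb : (U t).starProjection (b t) = 0 :=
      (Submodule.starProjection_apply_eq_zero_iff _).2 ht.2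
    rw [map_sub, map_add, ha, hb]
    abel
  have h5 : Tendsto (fun t => (U t).starProjection (e k - (a t + b t))) l (𝓝 0) := by
    have h6 : Tendsto (fun t => ‖e k - (a t + b t)‖) l (𝓝 0) := by
      have := (tendsto_const_nhds (x := (e k : V n))).sub h2
      rw [sub_self] at this
      exact tendsto_zero_iff_norm_tendsto_zero.1 this
    exact squeeze_zero_norm (fun t => Submodule.norm_starProjection_apply_le _ _) h6
  have h7 := h5.add h3
  rw [zero_add] at h7
  exact h7.congr' (h4.mono fun t ht => ht.symm)

/-- The vector `t · x`, rescaled so that its `s`-th coordinate does not depend on `t`, for a vector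
`x` with last nonzero coordinate the `s`-th one. -/
noncomputable def rescale (s : Fin n) (x : V n) (t : ℂ) : V n :=
  WithLp.toLp 2 fun i => t ^ ((s : ℕ) - i) * x i

theorem rescale_apply (s : Fin n) (x : V n) (t : ℂ) (i : Fin n) :
    rescale s x t i = t ^ ((s : ℕ) - i) * x i := rfl

theorem smul_rescale {s : Fin n} {x : V n} (hx : ∀ t, s < t → x t = 0) (t : ℂ) :
    t ^ (n - 1 - (s : ℕ)) • rescale s x t = diag (fun k => t ^ (n - 1 - (k : ℕ))) x := by
  refine PiLp.ext fun i => ?_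
  rw [PiLp.smul_apply, rescale_apply, diag_apply, smul_eq_mul, ← mul_assoc]
  by_cases hi : s < i
  · rw [hx i hi, mul_zero, mul_zero]
  · rw [← pow_add]
    congr 2
    rw [not_lt, Fin.le_def] at hi
    omega

theorem continuous_rescale (s : Fin n) (x : V n) : Continuous (rescale s x) := by
  unfold rescale
  fun_prop

theorem IsEchelon.rescale_zero {S : Finset (Fin n)} {w : Fin n → V n} (h : IsEchelon S w)
    {s : Fin n} (hs : s ∈ S) : rescale s (w s) 0 = e s := by
  refine PiLp.ext fun i => ?_
  rw [rescale_apply, e_apply]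
  rcases lt_trichotomy s i with hi | rfl | hi
  · rw [h.above s hs i hi, mul_zero, if_neg hi.ne']
  · simp [h.self s hs]
  · rw [if_neg hi.ne, zero_pow, zero_mul]
    rw [Fin.lt_def] at hi
    omega

theorem IsEchelon.tendsto_rescale {S : Finset (Fin n)} {w : Fin n → V n} (h : IsEchelon S w)
    {s : Fin n} (hs : s ∈ S) : Tendsto (rescale s (w s)) (𝓝[≠] 0) (𝓝 (e s)) := by
  rw [← h.rescale_zero hs]
  exact ((continuous_rescale s (w s)).tendsto 0).mono_left nhdsWithin_le_nhds

theorem inner_e_right (x : V n) (s : Fin n) : inner ℂ x (e s) = (starRingEnd ℂ) (x s) := by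
  rw [e, EuclideanSpace.inner_single_right, one_mul]

/-- The limit of `t · U` as `t → 0` is the coordinate subspace of the pivots of `U`. -/
theorem tendsto_actC (U : Submodule ℂ (V n)) :
    Tendsto (fun t : ℂ => (actC t U).starProjection) (𝓝[≠] 0)
      (𝓝 (coordSpan (pivots U : Set (Fin n)) : Submodule ℂ (V n)).starProjection) := by
  obtain ⟨w, hw, hU⟩ := exists_isEchelon U
  set S := pivots U with hS
  have hmem : ∀ t : ℂ, t ≠ 0 → ∀ s ∈ S, rescale s (w s) t ∈ actC t U := by
    intro t ht s hs
    have h1 : diag (fun k => t ^ (n - 1 - (k : ℕ))) (w s) ∈ actC t U :=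
      Submodule.mem_map_of_mem (hU ▸ mem_spanOn hs)
    rw [← smul_rescale (hw.above s hs)] at h1
    exact (Submodule.smul_mem_iff _ (pow_ne_zero _ ht)).1 h1
  refine tendsto_starProjection fun k => ?_
  by_cases hk : k ∈ S
  · refine ⟨rescale k (w k), fun _ => 0, ?_, ?_, ?_⟩
    · filter_upwards [self_mem_nhdsWithin] with t ht
      exact ⟨hmem t ht k hk, Submodule.zero_mem _⟩
    · simpa using hw.tendsto_rescale hk
    · rw [Submodule.starProjection_eq_self_iff.2 (e_mem_coordSpan_iff.2 (by simpa using hk))]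
      exact hw.tendsto_rescale hk
  · -- a vector orthogonal to the rescaled basis of `t · U`, close to the `k`-th coordinate vector
    refine ⟨fun _ => 0,
      fun t => e k - ∑ s ∈ S, (starRingEnd ℂ) (rescale s (w s) t k) • e s, ?_, ?_, ?_⟩
    · filter_upwards [self_mem_nhdsWithin] with t ht
      refine ⟨Submodule.zero_mem _, (Submodule.mem_orthogonal _ _).2 ?_⟩
      rintro _ ⟨x, hx, rfl⟩
      rw [SetLike.mem_coe, ← hU] at hx
      rw [hw.eq_sum hx, map_sum, sum_inner]
      refine Finset.sum_eq_zero fun s hs => ?_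
      rw [map_smul, ← smul_rescale (hw.above s hs), inner_smul_left, inner_smul_left, inner_sub_right,
        inner_sum, Finset.sum_eq_single_of_mem s hs, inner_smul_right, inner_e_right, inner_e_right,
        rescale_apply s (w s) t s, hw.self s hs]
      · simp
      · intro s' hs' hne
        rw [inner_smul_right, inner_e_right, rescale_apply s (w s) t s', hw.other s hs s' hs' hne]
        simp
    · have h1 : ∀ s ∈ S, Tendsto (fun t => (starRingEnd ℂ) (rescale s (w s) t k) • (e s : V n))
          (𝓝[≠] 0) (𝓝 0) := by
        intro s hs
        have h2 : Tendsto (fun t => rescale s (w s) t k) (𝓝[≠] 0) (𝓝 ((e s : V n) k)) :=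
          ((EuclideanSpace.proj k : V n →L[ℂ] ℂ).continuous.tendsto _).comp (hw.tendsto_rescale hs)
        rw [e_apply, if_neg (by rintro rfl; exact hk hs)] at h2
        have h3 := ((Complex.continuous_conj.tendsto 0).comp h2).smul_const (e s : V n)
        simpa using h3
      have h4 := (tendsto_const_nhds (x := (e k : V n)) (f := 𝓝[≠] (0 : ℂ))).sub
        (tendsto_finsetSum S h1)
      simpa using h4
    · have h1 : (coordSpan (S : Set (Fin n)) : Submodule ℂ (V n)).starProjection (e k) = 0 := by
        rw [Submodule.starProjection_apply_eq_zero_iff, Submodule.mem_orthogonal]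
        intro x hx
        rw [inner_e_right, mem_coordSpan_iff.1 hx k (by simpa using hk), map_zero]
      rw [h1]
      exact tendsto_const_nhds

theorem tendsto_actC_iff {U U₀ : Submodule ℂ (V n)} :
    Tendsto (fun t : ℂ => (actC t U).starProjection) (𝓝[≠] 0) (𝓝 U₀.starProjection) ↔
      U₀ = coordSpan (pivots U : Set (Fin n)) := by
  constructor
  · intro h
    exact Submodule.starProjection_inj.1 (tendsto_nhds_unique h (tendsto_actC U))
  · rintro rfl
    exact tendsto_actC U

/-- The subspaces stable under the one-dimensional torus are the coordinate subspaces. -/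
theorem eq_coordSpan_of_actC {U : Submodule ℂ (V n)} (h : ∀ t : ℂˣ, actC (t : ℂ) U = U) :
    U = coordSpan (pivots U : Set (Fin n)) := by
  refine tendsto_actC_iff.1 (tendsto_const_nhds.congr' ?_)
  filter_upwards [self_mem_nhdsWithin] with t ht
  rw [← Units.val_mk0 ht, h]

theorem map_diag_coordSpan (S : Set (Fin n)) (t : Fin n → ℂˣ) :
    (coordSpan S : Submodule ℂ (V n)).map (diag fun k => (t k : ℂ)) = coordSpan S := by
  ext x
  rw [Submodule.mem_map]
  constructor
  · rintro ⟨y, hy, rfl⟩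
    rw [mem_coordSpan_iff] at hy ⊢
    intro i hi
    rw [diag_apply, hy i hi, mul_zero]
  · intro hx
    rw [mem_coordSpan_iff] at hx
    refine ⟨diag (fun k => ((t k)⁻¹ : ℂˣ)) x, mem_coordSpan_iff.2 fun i hi => ?_,
      PiLp.ext fun i => ?_⟩
    · rw [diag_apply, hx i hi, mul_zero]
    · rw [diag_apply, diag_apply, ← mul_assoc, Units.mul_inv, one_mul]

variable {ι : Type} {δ : ι → ℕ}

theorem isFixed_iff_isFixedC (q : (i : ι) → Gr n (δ i)) : IsFixed q ↔ IsFixedC q := by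
  constructor
  · intro h t i
    have := h (fun k => t ^ (n - 1 - (k : ℕ))) i
    simpa [actC] using this
  · intro h t i
    rw [eq_coordSpan_of_actC fun t => h t i]
    exact map_diag_coordSpan _ _

/-- The torus-fixed configurations consist of coordinate subspaces. -/
theorem isFixed_iff (q : (i : ι) → Gr n (δ i)) :
    IsFixed q ↔ ∀ i, (q i).1 = coordSpan (coordSet (q i).1 : Set (Fin n)) := by
  constructor
  · intro h i
    have := eq_coordSpan_of_actC fun t => (isFixed_iff_isFixedC q).1 h t i
    conv_rhs => rw [this, coordSet_coordSpan]
    exact this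
  · intro h t i
    rw [h i]
    exact map_diag_coordSpan _ _

/-- Flowing to a fixed configuration means having its index sets as pivots. -/
theorem flowsTo_iff {y q : (i : ι) → Gr n (δ i)} (hq : IsFixed q) :
    FlowsTo y q ↔ ∀ i, pivots (y i).1 = coordSet (q i).1 := by
  refine forall_congr' fun i => ?_
  rw [tendsto_actC_iff]
  have := (isFixed_iff q).1 hq i
  constructor
  · intro h
    rw [h, coordSet_coordSpan]
  · intro h
    rw [h]
    exact this

end Echelon

/-! ### Regular functions on products of Grassmannians -/

section Regular

variable {n : ℕ} {ι : Type} {δ : ι → ℕ}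

theorem isClosed_zariski_iff {S : Set ((i : ι) → Gr n (δ i))} :
    IsClosed[zariski n δ] S ↔ ∃ I : Set (FramePoly n δ), ∀ q A, IsFrame A q →
      (q ∈ S ↔ ∀ f ∈ I, evalFrame A f = 0) := by
  let _ := zariski n δ
  constructor
  · intro h
    have h1 : Sᶜᶜ ∈ {S : Set ((i : ι) → Gr n (δ i)) | ∃ I : Set (FramePoly n δ), ∀ q A,
      IsFrame A q → (q ∈ S ↔ ∀ f ∈ I, evalFrame A f = 0)} := h.isOpen_compl
    rwa [compl_compl] at h1
  · intro h
    refine ⟨?_⟩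
    change Sᶜᶜ ∈ {S : Set ((i : ι) → Gr n (δ i)) | ∃ I : Set (FramePoly n δ), ∀ q A,
      IsFrame A q → (q ∈ S ↔ ∀ f ∈ I, evalFrame A f = 0)}
    rwa [compl_compl]

/-- The function `g` is, on `C`, a quotient of polynomials in the matrix entries of frames, the
denominator having no zeros on frames of points of `C`. -/
def IsRegularOn (C : Set ((i : ι) → Gr n (δ i))) (g : ((i : ι) → Gr n (δ i)) → ℂ) : Prop :=
  ∃ p r : FramePoly n δ, ∀ q ∈ C, ∀ A, IsFrame A q →
    evalFrame A r ≠ 0 ∧ g q * evalFrame A r = evalFrame A p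

theorem isRegularOn_const (C : Set ((i : ι) → Gr n (δ i))) (c : ℂ) :
    IsRegularOn C fun _ => c :=
  ⟨MvPolynomial.C c, 1, fun q _ A _ => by simp [evalFrame]⟩

theorem IsRegularOn.add {C : Set ((i : ι) → Gr n (δ i))} {f g : ((i : ι) → Gr n (δ i)) → ℂ}
    (hf : IsRegularOn C f) (hg : IsRegularOn C g) : IsRegularOn C fun q => f q + g q := by
  obtain ⟨p, r, h⟩ := hf
  obtain ⟨p', r', h'⟩ := hg
  refine ⟨p * r' + p' * r, r * r', fun q hq A hA => ?_⟩
  obtain ⟨h1, h2⟩ := h q hq A hA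
  obtain ⟨h3, h4⟩ := h' q hq A hA
  simp only [evalFrame, map_add, map_mul] at *
  refine ⟨mul_ne_zero h1 h3, ?_⟩
  rw [← h2, ← h4]
  ring

theorem IsRegularOn.mul {C : Set ((i : ι) → Gr n (δ i))} {f g : ((i : ι) → Gr n (δ i)) → ℂ}
    (hf : IsRegularOn C f) (hg : IsRegularOn C g) : IsRegularOn C fun q => f q * g q := by
  obtain ⟨p, r, h⟩ := hf
  obtain ⟨p', r', h'⟩ := hg
  refine ⟨p * p', r * r', fun q hq A hA => ?_⟩
  obtain ⟨h1, h2⟩ := h q hq A hA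
  obtain ⟨h3, h4⟩ := h' q hq A hA
  simp only [evalFrame, map_mul] at *
  refine ⟨mul_ne_zero h1 h3, ?_⟩
  rw [← h2, ← h4]
  ring

theorem IsRegularOn.eval {σ : Type} {C : Set ((i : ι) → Gr n (δ i))}
    {g : ((i : ι) → Gr n (δ i)) → σ → ℂ} (hg : ∀ a, IsRegularOn C fun q => g q a)
    (p : MvPolynomial σ ℂ) : IsRegularOn C fun q => MvPolynomial.eval (g q) p := by
  induction p using MvPolynomial.induction_on with
  | C c => simpa using isRegularOn_const C c
  | add p p' hp hp' => simpa using hp.add hp'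
  | mul_X p a hp => simpa using hp.mul (hg a)

theorem IsFrame.linearIndependent {A : (i : ι) → Fin (δ i) → V n} {q : (i : ι) → Gr n (δ i)}
    (hA : IsFrame A q) (i : ι) : LinearIndependent ℂ (A i) := by
  rw [linearIndependent_iff_card_eq_finrank_span, Fintype.card_fin, Set.finrank, hA i, (q i).2]

/-- The configurations on all frames of which a polynomial vanishes form a closed set. A polynomial
vanishes on all frames if and only if, on a single frame, all polynomials obtained from it by a
change of basis vanish, and these polynomials do not depend on the configuration. -/
theorem isClosed_setOf_frame (p : FramePoly n δ) :
    IsClosed[zariski n δ] {q | ∀ A, IsFrame A q → evalFrame A p = 0} := by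
  -- the polynomials obtained from `p` by a change of basis
  let act (h : (i : ι) → Matrix (Fin (δ i)) (Fin (δ i)) ℂ) : FramePoly n δ :=
    MvPolynomial.aeval (fun x : Σ i : ι, Fin n × Fin (δ i) =>
      ∑ c, MvPolynomial.C (h x.1 x.2.2 c) * MvPolynomial.X ⟨x.1, x.2.1, c⟩) p
  have hact : ∀ h A, evalFrame A (act h) =
      evalFrame (fun i c => ∑ c', h i c c' • A i c') p := by
    intro h A
    simp only [evalFrame, act, ← MvPolynomial.coe_aeval_eq_eval, RingHom.coe_coe]
    rw [← AlgHom.comp_apply, MvPolynomial.comp_aeval]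
    congr 2
    ext x
    simp
  refine isClosed_zariski_iff.2 ⟨{f | ∃ h k : (i : ι) → Matrix (Fin (δ i)) (Fin (δ i)) ℂ,
    (∀ i, k i * h i = 1) ∧ f = act h}, fun q A hA => ?_⟩
  constructor
  · rintro hq _ ⟨h, k, hkh, rfl⟩
    rw [hact]
    refine hq _ fun i => le_antisymm ?_ ?_
    · rw [Submodule.span_le]
      rintro _ ⟨c, rfl⟩
      refine Submodule.sum_mem _ fun c' _ => Submodule.smul_mem _ _ ?_
      rw [← hA i]
      exact Submodule.subset_span ⟨c', rfl⟩
    · rw [← hA i, Submodule.span_le]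
      rintro _ ⟨c, rfl⟩
      have : A i c = ∑ c', k i c c' • ∑ c'', h i c' c'' • A i c'' := by
        simp only [Finset.smul_sum, smul_smul]
        rw [Finset.sum_comm]
        simp only [← Finset.sum_smul, ← Matrix.mul_apply, hkh]
        simp [Matrix.one_apply]
      rw [this]
      exact Submodule.sum_mem _ fun c' _ => Submodule.smul_mem _ _
        (Submodule.subset_span ⟨c', rfl⟩)
  · intro hq A' hA'
    have hc : ∀ i, ∀ B B' : Fin (δ i) → V n, Submodule.span ℂ (Set.range B) = (q i).1 →
        Submodule.span ℂ (Set.range B') = (q i).1 →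
        ∃ h : Matrix (Fin (δ i)) (Fin (δ i)) ℂ, ∀ c, B' c = ∑ c', h c c' • B c' := by
      intro i B B' hB hB'
      have : ∀ c, ∃ v : Fin (δ i) → ℂ, ∑ c', v c' • B c' = B' c := by
        intro c
        rw [← Submodule.mem_span_range_iff_exists_fun, hB, ← hB']
        exact Submodule.subset_span ⟨c, rfl⟩
      choose v hv using this
      exact ⟨v, fun c => (hv c).symm⟩
    choose h hh using fun i => hc i (A i) (A' i) (hA i) (hA' i)
    choose k hk using fun i => hc i (A' i) (A i) (hA' i) (hA i)
    have hkh : ∀ i, k i * h i = 1 := by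
      intro i
      ext c c''
      have h1 : ∑ c'', (k i * h i) c c'' • A i c'' =
          ∑ c'', (1 : Matrix (Fin (δ i)) (Fin (δ i)) ℂ) c c'' • A i c'' := by
        have h2 : A i c = ∑ c', k i c c' • ∑ c'', h i c' c'' • A i c'' := by
          simp only [← hh]
          exact hk i c
        simp only [Finset.smul_sum, smul_smul] at h2
        rw [Finset.sum_comm] at h2
        simp only [← Finset.sum_smul, ← Matrix.mul_apply] at h2
        rw [← h2]
        simp [Matrix.one_apply]
      exact congrFun (Fintype.linearIndependent_iffₛ.1 (hA.linearIndependent i) _ _ h1 |> funext) c''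
    have := hq _ ⟨h, k, hkh, rfl⟩
    rw [hact] at this
    convert this using 2
    ext i c : 2
    exact hh i c

/-- The zeros of a regular function form a relatively closed set. -/
theorem IsRegularOn.exists_isClosed {C : Set ((i : ι) → Gr n (δ i))}
    {g : ((i : ι) → Gr n (δ i)) → ℂ} (hg : IsRegularOn C g) :
    ∃ Z, IsClosed[zariski n δ] Z ∧ ∀ q ∈ C, q ∈ Z ↔ g q = 0 := by
  obtain ⟨p, r, h⟩ := hg
  refine ⟨_, isClosed_setOf_frame p, fun q hq => ⟨fun hZ => ?_, fun h0 A hA => ?_⟩⟩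
  · obtain ⟨A, hA⟩ : ∃ A, IsFrame A q := by
      refine ⟨fun i c => ((Module.finBasisOfFinrankEq ℂ (q i).1 (q i).2) c : V n), fun i => ?_⟩
      rw [show (Set.range fun c => ((Module.finBasisOfFinrankEq ℂ (q i).1 (q i).2) c : V n)) =
        (q i).1.subtype '' Set.range (Module.finBasisOfFinrankEq ℂ (q i).1 (q i).2) by
          rw [← Set.range_comp]; rfl, Submodule.span_image, Module.Basis.span_eq, Submodule.map_top,
        Submodule.range_subtype]
    obtain ⟨h1, h2⟩ := h q hq A hA
    rw [hZ A hA] at h2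
    exact (mul_eq_zero.1 h2).resolve_right h1
  · rw [← (h q hq A hA).2, h0, zero_mul]

/-- The entries of the reduced echelon basis of a member of a configuration are regular on the set
of configurations where this member has given pivots: the echelon basis is obtained from any frame
by inverting the submatrix of its pivot rows, as in Cramer's rule. -/
theorem isRegularOn_echelon {C : Set ((i : ι) → Gr n (δ i))} {i : ι} {S : Finset (Fin n)}
    {w : ((i : ι) → Gr n (δ i)) → Fin n → V n}
    (hw : ∀ q ∈ C, IsEchelon S (w q) ∧ spanOn S (w q) = (q i).1) (hS : S.card = δ i)
    {b : Fin n} (hb : b ∈ S) (a : Fin n) : IsRegularOn C fun q => w q b a := by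
  -- the submatrix of the pivot rows of a frame, and the row of index `a`
  let M : Matrix (Fin (δ i)) (Fin (δ i)) (FramePoly n δ) := Matrix.of fun c' c =>
    MvPolynomial.X ⟨i, S.orderEmbOfFin hS c', c⟩
  obtain ⟨c₀, hc₀⟩ : ∃ c₀, S.orderEmbOfFin hS c₀ = b := by
    have : b ∈ Set.range (S.orderEmbOfFin hS) := by rwa [Finset.range_orderEmbOfFin]
    exact this
  refine ⟨∑ c, MvPolynomial.X ⟨i, a, c⟩ * M.adjugate c c₀, M.det, fun q hq A hA => ?_⟩
  obtain ⟨h1, h2⟩ := hw q hq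
  let f : FramePoly n δ →+* ℂ := MvPolynomial.eval (fun x => A x.1 x.2.2 x.2.1)
  let N : Matrix (Fin (δ i)) (Fin (δ i)) ℂ := Matrix.of fun c' c => A i c (S.orderEmbOfFin hS c')
  have hMN : f.mapMatrix M = N := by
    ext c' c
    simp [M, N, f]
  have hsum : ∀ x : V n, ∑ s ∈ S, x s • w q s =
      ∑ c', x (S.orderEmbOfFin hS c') • w q (S.orderEmbOfFin hS c') := by
    intro x
    rw [← Finset.sum_coe_sort]
    exact (Equiv.sum_comp (S.orderIsoOfFin hS).toEquiv fun s : S => x s • w q s).symm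
  have hrow : ∀ c, A i c a = ∑ c', N c' c * w q (S.orderEmbOfFin hS c') a := by
    intro c
    have h3 : A i c ∈ spanOn S (w q) := by
      rw [h2, ← hA i]
      exact Submodule.subset_span ⟨c, rfl⟩
    have h4 := h1.eq_sum h3
    rw [hsum] at h4
    have h5 := congrArg (fun x : V n => x a) h4
    simpa [N] using h5
  have hdet : N.det ≠ 0 := by
    have h3 : ∀ c', ∃ v : Fin (δ i) → ℂ, ∑ c, v c • A i c = w q (S.orderEmbOfFin hS c') := by
      intro c'
      rw [← Submodule.mem_span_range_iff_exists_fun, hA i, ← h2]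
      exact mem_spanOn (S.orderEmbOfFin_mem hS c')
    choose v hv using h3
    have h4 : N * (Matrix.of fun c c' => v c' c) = 1 := by
      ext c' c''
      have h5 := congrArg (fun x : V n => x (S.orderEmbOfFin hS c')) (hv c'')
      rw [Matrix.mul_apply, Matrix.one_apply]
      have h6 : w q (S.orderEmbOfFin hS c'') (S.orderEmbOfFin hS c') = if c' = c'' then 1 else 0 := by
        split_ifs with h
        · rw [h, h1.self _ (S.orderEmbOfFin_mem hS _)]
        · exact h1.other _ (S.orderEmbOfFin_mem hS _) _ (S.orderEmbOfFin_mem hS _)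
            fun he => h ((S.orderEmbOfFin hS).injective he)
      rw [← h6]
      simpa [N, mul_comm] using h5
    exact (Matrix.isUnit_det_of_right_inverse h4).ne_zero
  have e1 : evalFrame A M.det = N.det := by
    rw [← hMN]
    exact f.map_det M
  have e2 : evalFrame A (∑ c, MvPolynomial.X ⟨i, a, c⟩ * M.adjugate c c₀) =
      ∑ c, A i c a * N.adjugate c c₀ := by
    rw [← hMN, ← RingHom.map_adjugate]
    simp [evalFrame, f]
  refine ⟨by rwa [e1], ?_⟩
  rw [e1, e2]
  have h7 : (fun c => A i c a) = Matrix.vecMul (fun c' => w q (S.orderEmbOfFin hS c') a) N := by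
    ext c
    rw [hrow c]
    simp [Matrix.vecMul, dotProduct, mul_comm]
  have h8 : Matrix.vecMul (fun c => A i c a) N.adjugate =
      Matrix.vecMul (fun c' => w q (S.orderEmbOfFin hS c') a) (N.det • 1) := by
    rw [h7, Matrix.vecMul_vecMul, Matrix.mul_adjugate]
  have h9 := congrFun h8 c₀
  simp only [Matrix.vecMul_smul, Matrix.vecMul_one, Pi.smul_apply, smul_eq_mul, hc₀] at h9
  rw [mul_comm, ← h9]
  rfl

end Regular

/-! ### The dimension of affine space -/

section AffineSpace

open TopologicalSpace

/-- A subspace meeting all nonempty locally closed sets has the same dimension as the whole space.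
-/
theorem topologicalKrullDim_eq_of_veryDense {X Y : Type*} [TopologicalSpace X] [TopologicalSpace Y]
    {g : Y → X} (hg : IsInducing g)
    (hd : ∀ Z : Set X, IsClosed Z → Z ⊆ closure (Z ∩ Set.range g)) :
    topologicalKrullDim Y = topologicalKrullDim X := by
  refine le_antisymm hg.topologicalKrullDim_le ?_
  have hmeet : ∀ Z O : Set X, IsClosed Z → IsOpen O → (Z ∩ O).Nonempty →
      (g ⁻¹' (Z ∩ O)).Nonempty := by
    rintro Z O hZ hO ⟨x, hx, hxO⟩
    obtain ⟨_, hy1, hy2, y, rfl⟩ := mem_closure_iff.1 (hd Z hZ hx) O hO hxO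
    exact ⟨y, hy2, hy1⟩
  let F : IrreducibleCloseds X → IrreducibleCloseds Y := fun Z =>
    ⟨g ⁻¹' Z, by
      constructor
      · have := hmeet Z Set.univ Z.isClosed isOpen_univ (by simpa using Z.isIrreducible.nonempty)
        simpa using this
      · intro u v hu hv ⟨x, hx, hxu⟩ ⟨y, hy, hyv⟩
        obtain ⟨u', hu', rfl⟩ := hg.isOpen_iff.1 hu
        obtain ⟨v', hv', rfl⟩ := hg.isOpen_iff.1 hv
        have h1 := Z.isIrreducible.2 u' v' hu' hv' ⟨g x, hx, hxu⟩ ⟨g y, hy, hyv⟩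
        exact hmeet Z (u' ∩ v') Z.isClosed (hu'.inter hv') h1,
      Z.isClosed.preimage hg.continuous⟩
  refine Order.krullDim_le_of_strictMono F fun Z Z' hlt => ?_
  refine lt_of_le_of_ne (fun y hy => hlt.le hy) fun he => hlt.not_ge ?_
  have he' : g ⁻¹' (Z : Set X) = g ⁻¹' (Z' : Set X) := congrArg IrreducibleCloseds.carrier he
  intro x hx
  have h1 : (Z' : Set X) ∩ Set.range g ⊆ Z := by
    rintro _ ⟨hy, y, rfl⟩
    have : y ∈ g ⁻¹' (Z' : Set X) := hy
    rwa [← he'] at this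
  exact (closure_minimal h1 Z.isClosed) (hd Z' Z'.isClosed hx)

/-- The points of affine space are very dense in the spectrum of the polynomial ring, by the
Nullstellensatz. -/
theorem subset_closure_inter_range_pointToPoint {σ : Type} [Finite σ]
    (Z : Set (PrimeSpectrum (MvPolynomial σ ℂ))) (hZ : IsClosed Z) :
    Z ⊆ closure (Z ∩ Set.range (MvPolynomial.pointToPoint (k := ℂ) (K := ℂ) (σ := σ))) := by
  obtain ⟨I, rfl⟩ := (PrimeSpectrum.isClosed_iff_zeroLocus_ideal Z).1 hZ
  rintro p hp
  rw [← PrimeSpectrum.zeroLocus_vanishingIdeal_eq_closure, PrimeSpectrum.mem_zeroLocus]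
  intro f hf
  have h1 : f ∈ MvPolynomial.vanishingIdeal ℂ (MvPolynomial.zeroLocus ℂ I) := by
    intro x hx
    have h2 := (PrimeSpectrum.mem_vanishingIdeal _ _).1 hf (MvPolynomial.pointToPoint x)
      ⟨MvPolynomial.pointToPoint_zeroLocus_le I ⟨x, hx, rfl⟩, x, rfl⟩
    exact h2 x rfl
  rw [MvPolynomial.vanishingIdeal_zeroLocus_eq_radical] at h1
  exact p.2.radical_le_iff.2 hp h1

theorem topologicalKrullDim_primeSpectrum_mvPolynomial (σ : Type) [Finite σ] :
    topologicalKrullDim (PrimeSpectrum (MvPolynomial σ ℂ)) = Nat.card σ := by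
  rw [PrimeSpectrum.topologicalKrullDim_eq_ringKrullDim,
    MvPolynomial.ringKrullDim_of_isNoetherianRing, ringKrullDim_eq_zero_of_field, zero_add]

end AffineSpace

/-- A subset of a product of Grassmannians has dimension `card σ` if it admits coordinates indexed
by `σ`, which are regular functions taking all values, together with a frame of each of its points
depending polynomially on the coordinates. -/
theorem zariskiDim_eq_of_coordinates {n : ℕ} {ι : Type} {δ : ι → ℕ} {σ : Type} [Finite σ]
    {C : Set ((i : ι) → Gr n (δ i))} (x : ((i : ι) → Gr n (δ i)) → σ → ℂ)
    (hreg : ∀ a, IsRegularOn C fun q => x q a) (hsurj : ∀ y, ∃ q ∈ C, x q = y)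
    (B : (i : ι) → Fin (δ i) → Fin n → MvPolynomial σ ℂ)
    (hB : ∀ q ∈ C,
      IsFrame (fun i c => WithLp.toLp 2 fun r => MvPolynomial.eval (x q) (B i c r)) q) :
    zariskiDim C = Nat.card σ := by
  let _ := zariski n δ
  let g : C → PrimeSpectrum (MvPolynomial σ ℂ) := fun q => MvPolynomial.pointToPoint (x q)
  have hmem : ∀ (q : C) (s : Set (MvPolynomial σ ℂ)),
      g q ∈ PrimeSpectrum.zeroLocus s ↔ ∀ p ∈ s, MvPolynomial.eval (x q) p = 0 := by
    intro q s
    rw [PrimeSpectrum.mem_zeroLocus]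
    refine forall₂_congr fun p _ => ?_
    exact (MvPolynomial.mem_vanishingIdeal_singleton_iff _ _).trans (by
      rw [← MvPolynomial.coe_aeval_eq_eval]
      rfl)
  -- closed sets pull back along the polynomial frame in one direction, and along the regular
  -- coordinates in the other
  have hg : IsInducing g := by
    refine ⟨TopologicalSpace.ext_isClosed fun K => ?_⟩
    rw [isClosed_induced_iff, isClosed_induced_iff]
    constructor
    · rintro ⟨t, ht, rfl⟩
      obtain ⟨I, hI⟩ := isClosed_zariski_iff.1 ht
      let comp (f : FramePoly n δ) : MvPolynomial σ ℂ :=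
        MvPolynomial.aeval (fun y : Σ i : ι, Fin n × Fin (δ i) => B y.1 y.2.2 y.2.1) f
      refine ⟨PrimeSpectrum.zeroLocus (comp '' I), PrimeSpectrum.isClosed_zeroLocus _, ?_⟩
      ext q
      rw [Set.mem_preimage, hmem, Set.mem_preimage, hI q _ (hB q q.2), Set.forall_mem_image]
      refine forall₂_congr fun f _ => ?_
      have : MvPolynomial.eval (x q) (comp f) = evalFrame
          (fun i c => WithLp.toLp 2 fun r => MvPolynomial.eval (x q) (B i c r)) f := by
        simp only [evalFrame, comp, ← MvPolynomial.coe_aeval_eq_eval, RingHom.coe_coe]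
        rw [← AlgHom.comp_apply, MvPolynomial.comp_aeval]
      rw [this]
    · rintro ⟨t, ht, rfl⟩
      obtain ⟨s, rfl⟩ := (PrimeSpectrum.isClosed_iff_zeroLocus t).1 ht
      choose Z hZ hZ' using fun p => (IsRegularOn.eval hreg p).exists_isClosed
      refine ⟨⋂ p ∈ s, Z p, isClosed_biInter fun p _ => hZ p, ?_⟩
      ext q
      rw [Set.mem_preimage, Set.mem_preimage, hmem, Set.mem_iInter₂]
      exact forall₂_congr fun p _ => hZ' p q q.2
  have h1 := topologicalKrullDim_eq_of_veryDense hg fun Z hZ => by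
    refine (subset_closure_inter_range_pointToPoint Z hZ).trans (closure_mono ?_)
    rintro _ ⟨h2, y, rfl⟩
    obtain ⟨q, hq, rfl⟩ := hsurj y
    exact ⟨h2, ⟨q, hq⟩, rfl⟩
  rw [zariskiDim, h1, topologicalKrullDim_primeSpectrum_mvPolynomial]

/-! ### One step of a tower of Grassmannian bundles -/

section Step

variable {n : ℕ}

/-- The family of vectors describing the spaces between the spans of two families `l` and `u`: to
the members of `u` with index in `T` are added combinations, with coefficients `x`, of those with
index in `D`; the other members, with index in `SL`, are obtained from `l` by reduction. -/
def stepFamily {A M : Type} [Semiring A] [AddCommGroup M] [Module A M] (coord : M → Fin n → A)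
    (SL T D : Finset (Fin n)) (l u : Fin n → M) (x : Fin n → Fin n → A) (s : Fin n) : M :=
  if s ∈ SL then l s - ∑ b ∈ T, coord (l s) b • (u b + ∑ a ∈ D, x a b • u a)
  else u s + ∑ a ∈ D, x a s • u a

theorem IsEchelon.sum_subset_apply {S D : Finset (Fin n)} {w : Fin n → V n} (h : IsEchelon S w)
    (hD : D ⊆ S) (c : Fin n → ℂ) {t : Fin n} (ht : t ∈ S) :
    (∑ a ∈ D, c a • w a) t = if t ∈ D then c t else 0 := by
  rw [sum_smul_apply]
  split_ifs with htD
  · rw [Finset.sum_eq_single_of_mem t htD, h.self t ht, mul_one]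
    intro a ha hat
    rw [h.other a (hD ha) t ht hat.symm, mul_zero]
  · refine Finset.sum_eq_zero fun a ha => ?_
    rw [h.other a (hD ha) t ht (by rintro rfl; exact htD ha), mul_zero]

variable {SL SW SU : Finset (Fin n)} {l u : Fin n → V n}

/-- The coordinate function of `V n`. -/
def coordFn (v : V n) (i : Fin n) : ℂ := v i

theorem isEchelon_stepFamily (hL : SL ⊆ SW) (hU : SW ⊆ SU) (hl : IsEchelon SL l)
    (hu : IsEchelon SU u) (hlu : spanOn SL l ≤ spanOn SU u) {x : Fin n → Fin n → ℂ}
    (hx : ∀ a b, ¬ a < b → x a b = 0) {w : Fin n → V n}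
    (hw : ∀ s ∈ SW, w s = stepFamily coordFn SL (SW \ SL) (SU \ SW) l u x s) :
    IsEchelon SW w ∧ spanOn SL l ≤ spanOn SW w ∧ spanOn SW w ≤ spanOn SU u ∧
      ∀ a ∈ SU \ SW, ∀ b ∈ SW \ SL, w b a = x a b := by
  have hT : ∀ s ∈ SW \ SL, w s = u s + ∑ a ∈ SU \ SW, x a s • u a := by
    intro s hs
    rw [Finset.mem_sdiff] at hs
    rw [hw s hs.1, stepFamily, if_neg hs.2]
  have hL' : ∀ s ∈ SL, w s = l s - ∑ b ∈ SW \ SL, l s b • w b := by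
    intro s hs
    rw [hw s (hL hs), stepFamily, if_pos hs]
    congr 1
    exact Finset.sum_congr rfl fun b hb => by rw [hT b hb]; rfl
  have hTcoord : ∀ s ∈ SW \ SL, ∀ t ∈ SU,
      w s t = (if t = s then 1 else 0) + if t ∈ SU \ SW then x t s else 0 := by
    intro s hs t ht
    rw [hT s hs, PiLp.add_apply, hu.sum_subset_apply Finset.sdiff_subset _ ht]
    congr 1
    have hsU : s ∈ SU := hU (Finset.mem_sdiff.1 hs).1
    split_ifs with h
    · rw [h, hu.self s hsU]
    · rw [hu.other s hsU t ht h]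
  have hTW : ∀ s ∈ SW \ SL, ∀ t ∈ SW, w s t = if t = s then 1 else 0 := by
    intro s hs t ht
    rw [hTcoord s hs t (hU ht), if_neg (c := t ∈ SU \ SW), add_zero]
    intro h
    exact (Finset.mem_sdiff.1 h).2 ht
  have hTabove : ∀ s ∈ SW \ SL, ∀ t, s < t → w s t = 0 := by
    intro s hs t hst
    rw [hT s hs, PiLp.add_apply, sum_smul_apply, hu.above s (hU (Finset.mem_sdiff.1 hs).1) t hst,
      zero_add]
    refine Finset.sum_eq_zero fun a ha => ?_
    by_cases has : a < s
    · rw [hu.above a (Finset.mem_sdiff.1 ha).1 t (has.trans hst), mul_zero]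
    · rw [hx a s has, zero_mul]
  have hLW : ∀ s ∈ SL, ∀ t ∈ SW, w s t = if t = s then 1 else 0 := by
    intro s hs t ht
    rw [hL' s hs, PiLp.sub_apply, sum_smul_apply]
    by_cases htL : t ∈ SL
    · rw [Finset.sum_eq_zero, sub_zero]
      · split_ifs with h
        · rw [h, hl.self s hs]
        · rw [hl.other s hs t htL h]
      · intro b hb
        rw [hTW b hb t ht, if_neg, mul_zero]
        rintro rfl
        exact (Finset.mem_sdiff.1 hb).2 htL
    · rw [if_neg (by rintro rfl; exact htL hs),
        Finset.sum_eq_single_of_mem t (Finset.mem_sdiff.2 ⟨ht, htL⟩),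
        hTW t (Finset.mem_sdiff.2 ⟨ht, htL⟩) t ht, if_pos rfl, mul_one, sub_self]
      intro b hb hbt
      rw [hTW b hb t ht, if_neg hbt.symm, mul_zero]
  have hsplit : ∀ s ∈ SW, s ∈ SL ∨ s ∈ SW \ SL := by
    intro s hs
    rw [Finset.mem_sdiff]
    tauto
  have hTU : ∀ s ∈ SW \ SL, w s ∈ spanOn SU u := by
    intro s hs
    rw [hT s hs]
    exact Submodule.add_mem _ (mem_spanOn (hU (Finset.mem_sdiff.1 hs).1)) (Submodule.sum_mem _
      fun a ha => Submodule.smul_mem _ _ (mem_spanOn (Finset.mem_sdiff.1 ha).1))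
  refine ⟨⟨fun s hs => ?_, fun s hs t ht hts => ?_, fun s hs t hst => ?_⟩, ?_, ?_, ?_⟩
  · rcases hsplit s hs with h | h
    · rw [hLW s h s hs, if_pos rfl]
    · rw [hTW s h s hs, if_pos rfl]
  · rcases hsplit s hs with h | h
    · rw [hLW s h t ht, if_neg hts]
    · rw [hTW s h t ht, if_neg hts]
  · rcases hsplit s hs with h | h
    · rw [hL' s h, PiLp.sub_apply, sum_smul_apply, hl.above s h t hst, zero_sub, neg_eq_zero]
      refine Finset.sum_eq_zero fun b hb => ?_
      by_cases hbs : s < b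
      · rw [hl.above s h b hbs, zero_mul]
      · rw [hTabove b hb t (lt_of_le_of_lt (not_lt.1 hbs) hst), mul_zero]
    · exact hTabove s h t hst
  · rw [spanOn_le]
    intro s hs
    have : l s = w s + ∑ b ∈ SW \ SL, l s b • w b := by rw [hL' s hs]; abel
    rw [this]
    exact Submodule.add_mem _ (mem_spanOn (hL hs)) (Submodule.sum_mem _
      fun b hb => Submodule.smul_mem _ _ (mem_spanOn (Finset.mem_sdiff.1 hb).1))
  · rw [spanOn_le]
    intro s hs
    rcases hsplit s hs with h | h
    · rw [hL' s h]
      exact Submodule.sub_mem _ (hlu (mem_spanOn h)) (Submodule.sum_mem _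
        fun b hb => Submodule.smul_mem _ _ (hTU b hb))
    · exact hTU s h
  · intro a ha b hb
    rw [hTcoord b hb a (Finset.mem_sdiff.1 ha).1, if_pos ha, if_neg, zero_add]
    rintro rfl
    exact (Finset.mem_sdiff.1 ha).2 (Finset.mem_sdiff.1 hb).1

/-- Conversely, an echelon basis of a space between two given ones is obtained in this way, the
coefficients being some of its entries. -/
theorem IsEchelon.eq_stepFamily {w : Fin n → V n} (hw : IsEchelon SW w) (hL : SL ⊆ SW)
    (hU : SW ⊆ SU) (hu : IsEchelon SU u)
    (hlw : spanOn SL l ≤ spanOn SW w) (hl : IsEchelon SL l) (hwu : spanOn SW w ≤ spanOn SU u)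
    {s : Fin n} (hs : s ∈ SW) :
    w s = stepFamily coordFn SL (SW \ SL) (SU \ SW) l u (fun a b => w b a) s := by
  have hT : ∀ s ∈ SW, w s = u s + ∑ a ∈ SU \ SW, w s a • u a := by
    intro s hs
    conv_lhs => rw [hu.eq_sum (hwu (mem_spanOn hs))]
    rw [← Finset.sum_sdiff hU, add_comm, Finset.sum_eq_single_of_mem s hs, hw.self s hs, one_smul]
    intro t ht hts
    rw [hw.other s hs t ht hts, zero_smul]
  rw [stepFamily]
  split_ifs with hsL
  · rw [eq_sub_iff_add_eq]
    conv_rhs => rw [hw.eq_sum (hlw (mem_spanOn hsL))]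
    rw [← Finset.sum_sdiff hL, add_comm]
    congr 1
    · refine Finset.sum_congr rfl fun b hb => ?_
      rw [← hT b (Finset.mem_sdiff.1 hb).1]
      rfl
    · rw [Finset.sum_eq_single_of_mem s hsL, hl.self s hsL, one_smul]
      intro t ht hts
      rw [hl.other s hsL t ht hts, zero_smul]
  · exact hT s hs

end Step

/-! ### Towers of Grassmannian bundles -/

section Tower

/-- A function defined by recursion along a rank function. -/
theorem exists_eq_of_rank {ι β : Type} [Inhabited β] (rk : ι → ℕ) (G : (ι → β) → ι → β)
    (hG : ∀ i f g, (∀ k, rk k < rk i → f k = g k) → G f i = G g i) : ∃ f, ∀ i, f i = G f i := by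
  have key : ∀ N M i, rk i < N → N ≤ M → G^[M] (fun _ => default) i = G^[N] (fun _ => default) i := by
    intro N
    induction N with
    | zero => intro M i h; omega
    | succ N ih =>
      intro M i h1 h2
      obtain ⟨M, rfl⟩ : ∃ M', M = M' + 1 := ⟨M - 1, by omega⟩
      rw [Function.iterate_succ_apply', Function.iterate_succ_apply']
      exact hG i _ _ fun k hk => ih M k (by omega) (by omega)
  refine ⟨fun i => G^[rk i + 1] (fun _ => default) i, fun i => ?_⟩
  simp only [Function.iterate_succ_apply' G (rk i)]
  exact hG i _ _ fun k hk => key _ _ _ (Nat.lt_succ_self _) hk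

/-- A tower of Grassmannian bundles: the `i`-th subspace is required to lie between two subspaces,
each of which is either a subspace of smaller rank or a member of the standard flag. The conditions
on the subspaces of smaller rank imply that the lower bound is contained in the upper one. -/
structure Tower (ι : Type) where
  rk : ι → ℕ
  lo : ι → ι ⊕ ℕ
  up : ι → ι ⊕ ℕ
  rk_lo : ∀ i k, lo i = Sum.inl k → rk k < rk i
  rk_up : ∀ i k, up i = Sum.inl k → rk k < rk i
  nested : ∀ {α : Type} [Preorder α] (W : ι → α) (E : ℕ → α), Monotone E → ∀ i,
    (∀ k, rk k < rk i → Sum.elim W E (lo k) ≤ W k ∧ W k ≤ Sum.elim W E (up k)) →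
    Sum.elim W E (lo i) ≤ Sum.elim W E (up i)

variable {n : ℕ} {ι : Type} (T : Tower ι)

/-- The indices of the first `c` coordinate vectors. -/
def initialSet (n c : ℕ) : Finset (Fin n) := Finset.univ.filter fun i => (i : ℕ) < c

theorem E_eq (n c : ℕ) : E n c = spanOn (initialSet n c) e := by
  rw [E, ← coordSpan_eq_spanOn, initialSet]
  simp

theorem E_mono (n : ℕ) : Monotone (E n) := fun _ _ h =>
  coordSpan_le_iff.2 fun _ hi => lt_of_lt_of_le hi h

theorem initialSet_mono (n : ℕ) : Monotone (initialSet n) := fun a b h i hi => by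
  simp only [initialSet, Finset.mem_filter, Finset.mem_univ, true_and] at hi ⊢
  omega

namespace Tower

/-- The configurations satisfying the conditions of a tower. -/
def points (T : Tower ι) {δ : ι → ℕ} : Set ((i : ι) → Gr n (δ i)) :=
  {q | ∀ i, Sum.elim (fun k => (q k).1) (E n) (T.lo i) ≤ (q i).1 ∧
    (q i).1 ≤ Sum.elim (fun k => (q k).1) (E n) (T.up i)}

/-- The index set of the lower bound of the `i`-th subspace. -/
def loSet (S : ι → Finset (Fin n)) (i : ι) : Finset (Fin n) := Sum.elim S (initialSet n) (T.lo i)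

/-- The index set of the upper bound of the `i`-th subspace. -/
def upSet (S : ι → Finset (Fin n)) (i : ι) : Finset (Fin n) := Sum.elim S (initialSet n) (T.up i)

variable {T} in
theorem congr_lo {α : Type} {E : ℕ → α} {f g : ι → α} {i : ι}
    (h : ∀ k, T.rk k < T.rk i → f k = g k) :
    Sum.elim f E (T.lo i) = Sum.elim g E (T.lo i) := by
  cases hl : T.lo i with
  | inl k => exact h k (T.rk_lo i k hl)
  | inr c => rfl

variable {T} in
theorem congr_up {α : Type} {E : ℕ → α} {f g : ι → α} {i : ι}
    (h : ∀ k, T.rk k < T.rk i → f k = g k) :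
    Sum.elim f E (T.up i) = Sum.elim g E (T.up i) := by
  cases hl : T.up i with
  | inl k => exact h k (T.rk_up i k hl)
  | inr c => rfl

/-- The coordinates of the cell with pivots `S`: triples `(i, a, b)` with `a < b`, where `b` is a
pivot of the `i`-th subspace but not of its lower bound, and `a` a pivot of its upper bound but not
of the subspace itself. -/
abbrev Coord (T : Tower ι) (S : ι → Finset (Fin n)) : Type :=
  {p : ι × Fin n × Fin n // p.2.1 ∈ T.upSet S p.1 \ S p.1 ∧ p.2.2 ∈ S p.1 \ T.loSet S p.1 ∧
    p.2.1 < p.2.2}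

variable {T} {S : ι → Finset (Fin n)}

theorem spanOn_elim (w : ι → Fin n → V n) (y : ι ⊕ ℕ) :
    spanOn (Sum.elim S (initialSet n) y) (Sum.elim w (fun _ => e) y) =
      Sum.elim (fun i => spanOn (S i) (w i)) (E n) y := by
  cases y with
  | inl k => rfl
  | inr c => exact (E_eq n c).symm

/-- A family of vectors obtained by the recursion of the tower consists of echelon bases of the
members of a configuration satisfying the conditions of the tower. -/
theorem isEchelon_of_recursion (hlo : ∀ i, T.loSet S i ⊆ S i) (hup : ∀ i, S i ⊆ T.upSet S i)
    {x : ι → Fin n → Fin n → ℂ} (hx : ∀ i a b, ¬ a < b → x i a b = 0) {w : ι → Fin n → V n}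
    (hw : ∀ i, ∀ s ∈ S i, w i s = stepFamily coordFn (T.loSet S i) (S i \ T.loSet S i)
      (T.upSet S i \ S i) (Sum.elim w (fun _ => e) (T.lo i)) (Sum.elim w (fun _ => e) (T.up i))
      (x i) s) (i : ι) :
    IsEchelon (S i) (w i) ∧
      Sum.elim (fun i => spanOn (S i) (w i)) (E n) (T.lo i) ≤ spanOn (S i) (w i) ∧
      spanOn (S i) (w i) ≤ Sum.elim (fun i => spanOn (S i) (w i)) (E n) (T.up i) ∧
      ∀ a ∈ T.upSet S i \ S i, ∀ b ∈ S i \ T.loSet S i, w i b a = x i a b := by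
  induction hr : T.rk i using Nat.strong_induction_on generalizing i with
  | _ r ih =>
    subst hr
    have hn := T.nested (fun i => spanOn (S i) (w i)) (E n) (E_mono n) i fun k hk =>
      ⟨(ih _ hk k rfl).2.1, (ih _ hk k rfl).2.2.1⟩
    rw [← spanOn_elim, ← spanOn_elim] at hn ⊢
    refine isEchelon_stepFamily (hlo i) (hup i) ?_ ?_ hn (hx i) (hw i)
    · unfold loSet
      cases hl : T.lo i with
      | inl k => exact (ih _ (T.rk_lo i k hl) k rfl).1
      | inr c => exact isEchelon_e _
    · unfold upSet
      cases hl : T.up i with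
      | inl k => exact (ih _ (T.rk_up i k hl) k rfl).1
      | inr c => exact isEchelon_e _

/-- The vectors `w` of the generic configuration of a cell, with polynomial entries. The family `X x`
is the point `x` of affine space, extended by zero to a family of coefficients for `stepFamily`. -/
theorem exists_polynomial_recursion (T : Tower ι) (S : ι → Finset (Fin n)) :
    ∃ (w : ι → Fin n → Fin n → MvPolynomial (T.Coord S) ℂ)
      (X : (T.Coord S → ℂ) → ι → Fin n → Fin n → ℂ),
      (∀ x i a b, ¬ a < b → X x i a b = 0) ∧
      (∀ x (p : T.Coord S), X x p.1.1 p.1.2.1 p.1.2.2 = x p) ∧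
      (∀ x (y : ι → Fin n → Fin n → ℂ), (∀ p : T.Coord S, x p = y p.1.1 p.1.2.1 p.1.2.2) →
        ∀ i a b, a ∈ T.upSet S i \ S i → b ∈ S i \ T.loSet S i → a < b → X x i a b = y i a b) ∧
      ∀ x i s, WithLp.toLp 2 (fun r => MvPolynomial.eval x (w i s r)) =
        stepFamily coordFn (T.loSet S i) (S i \ T.loSet S i) (T.upSet S i \ S i)
          (Sum.elim (fun i s => WithLp.toLp 2 fun r => MvPolynomial.eval x (w i s r))
            (fun _ => e) (T.lo i))
          (Sum.elim (fun i s => WithLp.toLp 2 fun r => MvPolynomial.eval x (w i s r))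
            (fun _ => e) (T.up i)) (X x i) s := by
  classical
  let R := MvPolynomial (T.Coord S) ℂ
  let X (i : ι) (a b : Fin n) : R :=
    if h : a ∈ T.upSet S i \ S i ∧ b ∈ S i \ T.loSet S i ∧ a < b then
      MvPolynomial.X ⟨(i, a, b), h⟩ else 0
  let e' (s r : Fin n) : R := if r = s then 1 else 0
  let G (f : ι → Fin n → Fin n → R) (i : ι) : Fin n → Fin n → R :=
    stepFamily (fun v i => v i) (T.loSet S i) (S i \ T.loSet S i) (T.upSet S i \ S i)
      (Sum.elim f (fun _ => e') (T.lo i)) (Sum.elim f (fun _ => e') (T.up i)) (X i)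
  obtain ⟨w, hw⟩ := exists_eq_of_rank T.rk G fun i f g hfg => by
    simp only [G]
    rw [congr_lo hfg, congr_up hfg]
  refine ⟨w, fun x i a b => MvPolynomial.eval x (X i a b), ?_, ?_, ?_, ?_⟩
  · intro x i a b hab
    simp only [X]
    rw [dif_neg (by tauto), map_zero]
  · rintro x ⟨⟨i, a, b⟩, h⟩
    simp only [X]
    rw [dif_pos h, MvPolynomial.eval_X]
  · intro x y hxy i a b ha hb hab
    simp only [X]
    rw [dif_pos ⟨ha, hb, hab⟩, MvPolynomial.eval_X]
    exact hxy ⟨(i, a, b), ha, hb, hab⟩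
  · intro x i s
    have hnode : ∀ (y : ι ⊕ ℕ) (s r : Fin n),
        (Sum.elim (fun i s => WithLp.toLp 2 fun r => MvPolynomial.eval x (w i s r))
          (fun _ => e) y : Fin n → V n) s r =
        MvPolynomial.eval x (Sum.elim w (fun _ => e') y s r) := by
      rintro (k | c) s r
      · rfl
      · simp only [Sum.elim_inr, e_apply, e']
        split_ifs <;> simp
    refine PiLp.ext fun r => ?_
    change MvPolynomial.eval x (w i s r) = _
    rw [hw i]
    simp only [G, stepFamily]
    split_ifs
    · simp [hnode, coordFn]
    · simp [hnode]

/-- The cell of the configurations with given pivots in a tower of Grassmannian bundles is an affine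
space, with coordinates the entries of the echelon bases indexed by `Coord`. -/
theorem zariskiDim_cell [Finite ι] {δ : ι → ℕ} (hδ : ∀ i, (S i).card = δ i)
    (hlo : ∀ i, T.loSet S i ⊆ S i) (hup : ∀ i, S i ⊆ T.upSet S i) :
    zariskiDim {q : (i : ι) → Gr n (δ i) | q ∈ T.points ∧ ∀ i, pivots (q i).1 = S i} =
      Nat.card (T.Coord S) := by
  obtain ⟨w, X, hX1, hX2, hX3, hw⟩ := T.exists_polynomial_recursion S
  have hrec : ∀ x i, _ := fun x i => isEchelon_of_recursion (T := T) hlo hup (hX1 x)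
    (w := fun i s => WithLp.toLp 2 fun r => MvPolynomial.eval x (w i s r))
    (fun i s _ => hw x i s) i
  choose v hv hv' using fun U : Submodule ℂ (V n) => exists_isEchelon U
  refine zariskiDim_eq_of_coordinates
    (fun q p => v (q p.1.1).1 p.1.2.2 p.1.2.1) ?_ ?_
    (fun i c => w i ((S i).orderEmbOfFin (hδ i) c)) ?_
  · rintro ⟨⟨i, a, b⟩, ha, hb, hab⟩
    refine isRegularOn_echelon (S := S i) (w := fun q => v (q i).1) (fun q hq => ?_) (hδ i)
      (Finset.mem_sdiff.1 hb).1 a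
    rw [← hq.2 i]
    exact ⟨hv _, hv' _⟩
  · intro y
    refine ⟨fun i => ⟨spanOn (S i) fun s => WithLp.toLp 2 fun r => MvPolynomial.eval y (w i s r),
      by rw [(hrec y i).1.finrank_spanOn, hδ]⟩,
      ⟨fun i => ⟨(hrec y i).2.1, (hrec y i).2.2.1⟩, fun i => (hrec y i).1.pivots_spanOn⟩, ?_⟩
    funext p
    obtain ⟨⟨i, a, b⟩, ha, hb, hab⟩ := p
    simp only
    have h1 := (hrec y i).1
    have h2 := h1.pivots_spanOn
    have h3 := hv (spanOn (S i) fun s => WithLp.toLp 2 fun r => MvPolynomial.eval y (w i s r))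
    rw [h2] at h3
    have h4 := hv' (spanOn (S i) fun s => WithLp.toLp 2 fun r => MvPolynomial.eval y (w i s r))
    rw [h2] at h4
    rw [h3.unique h1 h4 (Finset.mem_sdiff.1 hb).1, (hrec y i).2.2.2 a ha b hb]
    exact hX2 y ⟨(i, a, b), ha, hb, hab⟩
  · rintro q ⟨hq, hpiv⟩ i
    set x : T.Coord S → ℂ := fun p => v (q p.1.1).1 p.1.2.2 p.1.2.1 with hx
    have hvE : ∀ k, IsEchelon (S k) (v (q k).1) := fun k => hpiv k ▸ hv (q k).1
    have hvS : ∀ k, spanOn (S k) (v (q k).1) = (q k).1 := fun k => by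
      conv_rhs => rw [← hv' (q k).1]
      rw [hpiv k]
    -- the echelon bases of `q` satisfy the recursion of the tower
    have key : ∀ k, ∀ s ∈ S k,
        (WithLp.toLp 2 fun r => MvPolynomial.eval x (w k s r) : V n) = v (q k).1 s := by
      have hspan : ∀ y, spanOn (Sum.elim S (initialSet n) y)
          (Sum.elim (fun i => v (q i).1) (fun _ => e) y) =
          Sum.elim (fun i => (q i).1) (E n) y := by
        intro y
        rw [spanOn_elim]
        simp only [hvS]
      have hech : ∀ y, IsEchelon (Sum.elim S (initialSet n) y)
          (Sum.elim (fun i => v (q i).1) (fun _ => e) y) := by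
        rintro (k | c)
        · exact hvE k
        · exact isEchelon_e _
      intro k
      induction hr : T.rk k using Nat.strong_induction_on generalizing k with
      | _ r ih =>
        subst hr
        intro s hs
        have h1 := (hvE k).eq_stepFamily (hlo k) (hup k) (hech _)
          (by rw [hvS k, loSet, hspan]; exact (hq k).1) (hech _)
          (by rw [hvS k, upSet, hspan]; exact (hq k).2) hs
        rw [h1, hw]
        have hl : ∀ s ∈ T.loSet S k,
            (Sum.elim (fun i s => WithLp.toLp 2 fun r => MvPolynomial.eval x (w i s r))
              (fun _ => e) (T.lo k) : Fin n → V n) s =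
            Sum.elim (fun i => v (q i).1) (fun _ => e) (T.lo k) s := by
          unfold loSet
          cases hlk : T.lo k with
          | inl k' => exact fun s hs => ih _ (T.rk_lo k k' hlk) k' rfl s hs
          | inr c => exact fun s _ => rfl
        have hu : ∀ s ∈ T.upSet S k,
            (Sum.elim (fun i s => WithLp.toLp 2 fun r => MvPolynomial.eval x (w i s r))
              (fun _ => e) (T.up k) : Fin n → V n) s =
            Sum.elim (fun i => v (q i).1) (fun _ => e) (T.up k) s := by
          unfold upSet
          cases huk : T.up k with
          | inl k' => exact fun s hs => ih _ (T.rk_up k k' huk) k' rfl s hs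
          | inr c => exact fun s _ => rfl
        have hcoef : ∀ b ∈ S k \ T.loSet S k, ∀ a ∈ T.upSet S k \ S k,
            X x k a b = v (q k).1 b a := by
          intro b hb a ha
          by_cases hab : a < b
          · exact hX3 x (fun i a b => v (q i).1 b a) (fun p => rfl) k a b ha hb hab
          · rw [hX1 x k a b hab, (hvE k).above b (Finset.mem_sdiff.1 hb).1 a]
            refine lt_of_le_of_ne (not_lt.1 hab) ?_
            rintro rfl
            exact (Finset.mem_sdiff.1 ha).2 (Finset.mem_sdiff.1 hb).1
        have hsum : ∀ b ∈ S k \ T.loSet S k,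
            (Sum.elim (fun i s => WithLp.toLp 2 fun r => MvPolynomial.eval x (w i s r))
              (fun _ => e) (T.up k) : Fin n → V n) b +
              ∑ a ∈ T.upSet S k \ S k, X x k a b •
              (Sum.elim (fun i s => WithLp.toLp 2 fun r => MvPolynomial.eval x (w i s r))
              (fun _ => e) (T.up k) : Fin n → V n) a =
            Sum.elim (fun i => v (q i).1) (fun _ => e) (T.up k) b +
              ∑ a ∈ T.upSet S k \ S k, v (q k).1 b a •
              Sum.elim (fun i => v (q i).1) (fun _ => e) (T.up k) a := by
          intro b hb
          rw [hu b (hup k (Finset.mem_sdiff.1 hb).1)]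
          congr 1
          exact Finset.sum_congr rfl fun a ha => by
            rw [hu a (Finset.mem_sdiff.1 ha).1, hcoef b hb a ha]
        unfold stepFamily
        split_ifs with hsL
        · rw [hl s hsL]
          congr 1
          exact Finset.sum_congr rfl fun b hb => by rw [hsum b hb]
        · exact hsum s (Finset.mem_sdiff.2 ⟨hs, hsL⟩)
    rw [← hvS i, ← spanOn_congr (key i), spanOn]
    congr 1
    rw [← Finset.range_orderEmbOfFin (S i) (hδ i), ← Set.range_comp]
    rfl

end Tower

end Tower

/-! ### Subsets and partitions -/

section Subsets

variable {n : ℕ}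

theorem card_filter_lt_orderEmbOfFin (A : Finset (Fin n)) (i : Fin A.card) :
    (A.filter (· < A.orderEmbOfFin rfl i)).card = i := by
  have : A.filter (· < A.orderEmbOfFin rfl i) =
      (Finset.Iio i).map (A.orderEmbOfFin rfl).toEmbedding := by
    ext a
    simp only [Finset.mem_filter, Finset.mem_map, Finset.mem_Iio]
    constructor
    · rintro ⟨ha, hlt⟩
      obtain ⟨j, rfl⟩ : a ∈ Set.range (A.orderEmbOfFin rfl) := by
        rwa [Finset.range_orderEmbOfFin]
      exact ⟨j, (A.orderEmbOfFin rfl).lt_iff_lt.1 hlt, rfl⟩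
    · rintro ⟨j, hj, rfl⟩
      exact ⟨A.orderEmbOfFin_mem rfl j, (A.orderEmbOfFin rfl).lt_iff_lt.2 hj⟩
  rw [this, Finset.card_map, Fin.card_Iio]

theorem eq_of_card_filter_lt {A : Finset (Fin n)} {a b : Fin n} (ha : a ∈ A) (hb : b ∈ A)
    (h : (A.filter (· < a)).card = (A.filter (· < b)).card) : a = b := by
  obtain ⟨i, rfl⟩ : a ∈ Set.range (A.orderEmbOfFin rfl) := by rwa [Finset.range_orderEmbOfFin]
  obtain ⟨j, rfl⟩ : b ∈ Set.range (A.orderEmbOfFin rfl) := by rwa [Finset.range_orderEmbOfFin]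
  rw [card_filter_lt_orderEmbOfFin, card_filter_lt_orderEmbOfFin] at h
  rw [Fin.ext h]

/-- The position in `A` of the `k`-th largest element of a subset `T` determines, and is determined
by, the `k`-th part of the partition of `T`. -/
theorem part_add {A T : Finset (Fin n)} (hT : T ⊆ A) {k : ℕ} (hk : k < T.card) :
    part T (A \ T) k + (T.card - (k + 1)) =
      (A.filter (· < T.orderEmbOfFin rfl (Fin.rev ⟨k, hk⟩))).card := by
  have h1 := card_filter_lt_orderEmbOfFin T (Fin.rev ⟨k, hk⟩)
  rw [Fin.val_rev] at h1
  simp only at h1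
  rw [part, dif_pos hk, ← h1, ← Finset.card_union_of_disjoint, ← Finset.filter_union,
    Finset.sdiff_union_of_subset hT]
  exact Finset.disjoint_filter_filter Finset.sdiff_disjoint

theorem part_eq_of_diagram_eq {T D T' D' : Finset (Fin n)} (h : diagram T D = diagram T' D')
    (k : ℕ) : part T D k = part T' D' k := by
  have key : ∀ j, j < part T D k ↔ j < part T' D' k := fun j => by
    rw [← mem_diagram T D (k, j), ← mem_diagram T' D' (k, j), h]
  exact le_antisymm (le_of_forall_lt fun j hj => (key j).1 hj)
    (le_of_forall_lt fun j hj => (key j).2 hj)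

/-- A subset of `A` is determined by its cardinality and its partition. -/
theorem eq_of_diagram_eq {A T T' : Finset (Fin n)} (hT : T ⊆ A) (hT' : T' ⊆ A)
    (hc : T.card = T'.card) (h : diagram T (A \ T) = diagram T' (A \ T')) : T = T' := by
  refine Finset.eq_of_subset_of_card_le (fun a ha => ?_) hc.ge
  obtain ⟨i, rfl⟩ : a ∈ Set.range (T.orderEmbOfFin rfl) := by rwa [Finset.range_orderEmbOfFin]
  obtain ⟨k, rfl⟩ : ∃ k : Fin T.card, i = k.rev := ⟨i.rev, (Fin.rev_rev i).symm⟩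
  have hk' : (k : ℕ) < T'.card := hc ▸ k.2
  have h1 := part_add hT k.2
  have h2 := part_add hT' hk'
  have h3 := part_eq_of_diagram_eq h k
  have h4 : T.orderEmbOfFin rfl (Fin.rev ⟨k, k.2⟩) = _ :=
    eq_of_card_filter_lt (hT ha) (hT' (T'.orderEmbOfFin_mem rfl (Fin.rev ⟨k, hk'⟩))) (by omega)
  change T.orderEmbOfFin rfl (Fin.rev ⟨k, k.2⟩) ∈ T'
  rw [h4]
  exact T'.orderEmbOfFin_mem rfl _

/-- Every partition fitting into a rectangle is the partition of a subset. -/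
theorem exists_diagram_eq (A : Finset (Fin n)) {t : ℕ} (ht : t ≤ A.card) (μ : YoungDiagram)
    (hμ : ∀ c ∈ μ, c.1 < t ∧ c.2 + t < A.card) :
    ∃ T ⊆ A, T.card = t ∧ diagram T (A \ T) = μ := by
  have hrow : ∀ k, μ.rowLen k + t ≤ A.card := by
    intro k
    by_contra! hc
    have := hμ (k, A.card - t) (YoungDiagram.mem_iff_lt_rowLen.2 (by omega))
    simp only at this
    omega
  -- the position in `A` of the `i`-th smallest element, prescribed by `part_add`
  let f : Fin t → Fin A.card := fun i => ⟨i + μ.rowLen (t - (i + 1)), by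
    have := hrow (t - (i + 1)); omega⟩
  have hf : StrictMono f := by
    intro i j hij
    have := μ.rowLen_anti (t - (j + 1)) (t - (i + 1)) (by omega)
    rw [Fin.lt_def] at hij ⊢
    simp only [f]
    omega
  let T := Finset.univ.map ⟨fun i => A.orderEmbOfFin rfl (f i),
    (A.orderEmbOfFin rfl).injective.comp hf.injective⟩
  have hTA : T ⊆ A := by
    intro a ha
    obtain ⟨i, -, rfl⟩ := Finset.mem_map.1 ha
    exact A.orderEmbOfFin_mem rfl _
  have hTc : T.card = t := by simp [T]
  have hemb : ∀ i : Fin T.card, T.orderEmbOfFin rfl i = A.orderEmbOfFin rfl (f (i.cast hTc)) := by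
    have := Finset.orderEmbOfFin_unique (s := T) rfl
      (f := fun i => A.orderEmbOfFin rfl (f (i.cast hTc)))
      (fun i => Finset.mem_map.2 ⟨i.cast hTc, Finset.mem_univ _, rfl⟩)
      (fun i j hij => (A.orderEmbOfFin rfl).strictMono (hf hij))
    exact fun i => (congrFun this i).symm
  refine ⟨T, hTA, hTc, ?_⟩
  ext ⟨k, j⟩
  rw [YoungDiagram.mem_cells, YoungDiagram.mem_cells, mem_diagram]
  by_cases hk : k < T.card
  · have h1 := part_add hTA hk
    rw [hemb, card_filter_lt_orderEmbOfFin] at h1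
    simp only [f, Fin.val_cast, Fin.val_rev] at h1
    rw [show t - (T.card - (k + 1) + 1) = k by omega] at h1
    rw [YoungDiagram.mem_iff_lt_rowLen]
    simp only
    omega
  · rw [part, dif_neg hk]
    constructor
    · intro h
      exact absurd h (Nat.not_lt_zero _)
    · intro h
      exact absurd (hμ _ h).1 (by omega)

/-- The number of pairs `(a, b)` with `a ∈ D`, `b ∈ T` and `a < b`. -/
def crossings (T D : Finset (Fin n)) : ℕ := ∑ b ∈ T, (D.filter (· < b)).card

theorem card_diagram (T D : Finset (Fin n)) : (diagram T D).card = crossings T D := by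
  have h1 : (diagram T D).card = ∑ k ∈ Finset.range T.card, part T D k := by
    change ((Finset.range T.card ×ˢ Finset.range D.card).filter
      fun c => c.2 < part T D c.1).card = _
    rw [Finset.card_filter, Finset.sum_product]
    refine Finset.sum_congr rfl fun k _ => ?_
    rw [← Finset.card_filter]
    have : (Finset.range D.card).filter (· < part T D k) = Finset.range (part T D k) := by
      ext j
      have := part_le T D k
      simp only [Finset.mem_filter, Finset.mem_range]
      omega
    rw [this, Finset.card_range]
  rw [h1, crossings, Finset.sum_range, ← Finset.sum_coe_sort T]
  refine Fintype.sum_equiv (Fin.revPerm.trans (T.orderIsoOfFin rfl).toEquiv) _ _ fun k => ?_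
  rw [part, dif_pos k.2]
  rfl

end Subsets

/-! ### Grassmannian permutations and flags of subsets -/

section Permutations

variable {n : ℕ} {z : Fin (n - 1)}

/-- The first positions, up to the one of index `k`. -/
def upTo (n k : ℕ) : Finset (Fin n) := Finset.univ.filter fun i => (i : ℕ) ≤ k

theorem mem_upTo {k : ℕ} {i : Fin n} : i ∈ upTo n k ↔ (i : ℕ) ≤ k := by simp [upTo]

theorem card_upTo {k : ℕ} (hk : k < n) : (upTo n k).card = k + 1 := by
  have : upTo n k = Finset.Iic ⟨k, hk⟩ := by
    ext i
    rw [mem_upTo, Finset.mem_Iic, Fin.le_def]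
  rw [this, Fin.card_Iic]

theorem coe_upTo (k : ℕ) : (upTo n k : Set (Fin n)) = {i : Fin n | (i : ℕ) ≤ k} := by
  ext i
  simp [mem_upTo]

/-- A permutation increasing on the blocks lists a subset and then its complement in increasing
order. -/
theorem IncreasingOnBlocks.eq_orderEmbOfFin {u : Equiv.Perm (Fin n)}
    (hu : IncreasingOnBlocks z u) {S : Finset (Fin n)} (hS : S.card = z + 1)
    (hS' : Sᶜ.card = n - (z + 1)) (huS : (upTo n z).map u.toEmbedding = S) (i : Fin n) :
    u i = if h : (i : ℕ) ≤ z then S.orderEmbOfFin hS ⟨i, by omega⟩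
      else Sᶜ.orderEmbOfFin hS' ⟨i - (z + 1), by omega⟩ := by
  have hmem : ∀ i, u i ∈ S ↔ (i : ℕ) ≤ z := by
    intro i
    rw [← huS, Finset.mem_map_equiv, Equiv.symm_apply_apply, mem_upTo]
  split_ifs with h
  · have := Finset.orderEmbOfFin_unique hS (f := fun i : Fin (z + 1) => u ⟨i, by omega⟩)
      (fun i => (hmem _).2 (by simp only; omega))
      (fun i j hij => hu _ _ hij (Or.inl (by simp only; omega)))
    exact congrFun this ⟨i, by omega⟩
  · have := Finset.orderEmbOfFin_unique hS'
      (f := fun i : Fin (n - (z + 1)) => u ⟨i + (z + 1), by omega⟩)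
      (fun i => Finset.mem_compl.2 (by rw [hmem]; simp only; omega))
      (fun i j hij => hu _ _ (by rw [Fin.lt_def] at hij ⊢; simp only; omega)
        (Or.inr (by simp only; omega)))
    rw [← congrFun this ⟨i - (z + 1), by omega⟩]
    congr 1
    ext
    simp only
    omega

/-- A subset is the image of the first block under exactly one grassmannian permutation. -/
theorem existsUnique_increasingOnBlocks {S : Finset (Fin n)} (hS : S.card = z + 1) :
    ∃! u : Equiv.Perm (Fin n), IncreasingOnBlocks z u ∧ (upTo n z).map u.toEmbedding = S := by
  have hS' : Sᶜ.card = n - (z + 1) := by rw [Finset.card_compl, Fintype.card_fin, hS]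
  refine existsUnique_of_exists_of_unique ?_ ?_
  · let f : Fin n → Fin n := fun i => if h : (i : ℕ) ≤ z then S.orderEmbOfFin hS ⟨i, by omega⟩
      else Sᶜ.orderEmbOfFin hS' ⟨i - (z + 1), by omega⟩
    have h1 : ∀ i : Fin n, ∀ h : (i : ℕ) ≤ z, f i = S.orderEmbOfFin hS ⟨i, by omega⟩ :=
      fun i h => dif_pos h
    have h2 : ∀ i : Fin n, ∀ h : ¬ (i : ℕ) ≤ z,
        f i = Sᶜ.orderEmbOfFin hS' ⟨i - (z + 1), by omega⟩ := fun i h => dif_neg h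
    have hmem : ∀ i, f i ∈ S ↔ (i : ℕ) ≤ z := by
      intro i
      by_cases h : (i : ℕ) ≤ z
      · rw [h1 i h]
        exact iff_of_true (S.orderEmbOfFin_mem hS _) h
      · rw [h2 i h]
        exact iff_of_false (Finset.mem_compl.1 (Sᶜ.orderEmbOfFin_mem hS' _)) h
    have hinc : ∀ i i' : Fin n, i < i' → ((i' : ℕ) ≤ z ∨ (z : ℕ) < i) → f i < f i' := by
      intro i i' hii hz
      rw [Fin.lt_def] at hii
      rcases hz with hz | hz
      · rw [h1 i (by omega), h1 i' hz, OrderEmbedding.lt_iff_lt]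
        exact hii
      · rw [h2 i (by omega), h2 i' (by omega), OrderEmbedding.lt_iff_lt, Fin.lt_def]
        simp only
        omega
    have hinj : Function.Injective f := by
      intro i i' he
      have hiff : (i : ℕ) ≤ z ↔ (i' : ℕ) ≤ z := by rw [← hmem, ← hmem, he]
      rcases lt_trichotomy i i' with h | h | h
      · exact absurd he (hinc i i' h (by omega)).ne
      · exact h
      · exact absurd he.symm (hinc i' i h (by omega)).ne
    refine ⟨Equiv.ofBijective f (Finite.injective_iff_bijective.1 hinj), hinc, ?_⟩
    refine Finset.eq_of_subset_of_card_le (fun a ha => ?_) ?_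
    · obtain ⟨i, hi, rfl⟩ := Finset.mem_map.1 ha
      exact (hmem i).2 (mem_upTo.1 hi)
    · rw [Finset.card_map, card_upTo (by omega), hS]
  · rintro u u' ⟨h1, h2⟩ ⟨h3, h4⟩
    refine Equiv.ext fun i => ?_
    rw [h1.eq_orderEmbOfFin hS hS' h2, h3.eq_orderEmbOfFin hS hS' h4]

/-- A permutation is determined by the images of the sets of first positions. -/
theorem perm_eq_of_map_upTo {g g' : Equiv.Perm (Fin n)}
    (h : ∀ k : Fin (n - 1), (upTo n k).map g.toEmbedding = (upTo n k).map g'.toEmbedding) :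
    g = g' := by
  have h' : ∀ k : Fin n, (upTo n k).map g.toEmbedding = (upTo n k).map g'.toEmbedding := by
    intro k
    by_cases hk : (k : ℕ) < n - 1
    · exact h ⟨k, hk⟩
    · have : upTo n k = Finset.univ := by
        ext i
        simp only [mem_upTo, Finset.mem_univ, iff_true]
        omega
      simp [this]
  have key : ∀ g g' : Equiv.Perm (Fin n), (∀ k : Fin n,
      (upTo n k).map g.toEmbedding = (upTo n k).map g'.toEmbedding) → ∀ k, g.symm (g' k) ≤ k := by
    intro g g' h k
    have h1 : g' k ∈ (upTo n k).map g'.toEmbedding :=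
      Finset.mem_map_of_mem _ (mem_upTo.2 le_rfl)
    rw [← h k, Finset.mem_map_equiv, mem_upTo] at h1
    exact h1
  refine Equiv.ext fun k => ?_
  have h1 := key g g' h' k
  have h2 := key g' g (fun k => (h' k).symm) (g.symm (g' k))
  rw [Equiv.apply_symm_apply, Equiv.symm_apply_apply] at h2
  have h3 := le_antisymm h1 h2
  rw [Equiv.symm_apply_eq] at h3
  exact h3.symm

/-- A complete flag of subsets comes from a permutation. -/
theorem exists_perm_of_flag {S : Fin (n - 1) → Finset (Fin n)} (hS : ∀ k, (S k).card = k + 1)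
    (hmono : ∀ k k' : Fin (n - 1), (k' : ℕ) = k + 1 → S k ⊆ S k') :
    ∃ g : Equiv.Perm (Fin n), ∀ k : Fin (n - 1), (upTo n k).map g.toEmbedding = S k := by
  -- the flag, completed by the empty set and the whole set
  let S' : ℕ → Finset (Fin n) := fun k =>
    if k = 0 then ∅ else if h : k - 1 < n - 1 then S ⟨k - 1, h⟩ else Finset.univ
  have hS'0 : S' 0 = ∅ := if_pos rfl
  have hS'1 : ∀ k : Fin (n - 1), S' (k + 1) = S k := by
    intro k
    simp only [S']
    rw [if_neg (by omega), dif_pos (by omega)]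
    rfl
  have hS'n : ∀ k, n ≤ k → S' k = Finset.univ := by
    intro k hk
    simp only [S']
    split_ifs with h1 h2
    · exact (Finset.univ_eq_empty_iff.2 (by rw [show n = 0 by omega]; infer_instance)).symm
    · omega
    · rfl
  have hcard : ∀ k ≤ n, (S' k).card = k := by
    intro k hk
    by_cases h0 : k = 0
    · rw [h0, hS'0, Finset.card_empty]
    by_cases h1 : k < n
    · have := hS'1 ⟨k - 1, by omega⟩
      simp only [show k - 1 + 1 = k by omega] at this
      rw [this, hS]
      simp only
      omega
    · rw [hS'n k (by omega), Finset.card_univ, Fintype.card_fin]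
      omega
  have hstep : Monotone S' := by
    refine monotone_nat_of_le_succ fun k => ?_
    by_cases h0 : k = 0
    · rw [h0, hS'0]
      exact Finset.empty_subset _
    by_cases h1 : k + 1 < n
    · have h2 := hS'1 ⟨k - 1, by omega⟩
      have h3 := hS'1 ⟨k, by omega⟩
      simp only [show k - 1 + 1 = k by omega] at h2 h3
      rw [h2, h3]
      exact hmono _ _ (by simp only; omega)
    · rw [hS'n (k + 1) (by omega)]
      exact Finset.subset_univ _
  have hex : ∀ k : Fin n, ∃ a, a ∈ S' (k + 1) \ S' k := by
    intro k
    have : (S' (k + 1) \ S' k).card = 1 := by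
      rw [Finset.card_sdiff_of_subset (hstep (Nat.le_succ k)), hcard _ (by omega),
        hcard _ (by omega)]
      omega
    exact Finset.card_pos.1 (by omega)
  choose g hg using hex
  have hinj : Function.Injective g := by
    have key : ∀ k k' : Fin n, k < k' → g k ≠ g k' := by
      intro k k' hlt he
      refine (Finset.mem_sdiff.1 (hg k')).2 (hstep (a := k + 1) hlt ?_)
      rw [← he]
      exact (Finset.mem_sdiff.1 (hg k)).1
    intro k k' he
    rcases lt_trichotomy k k' with h | h | h
    · exact absurd he (key _ _ h)
    · exact h
    · exact absurd he.symm (key _ _ h)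
  refine ⟨Equiv.ofBijective g (Finite.injective_iff_bijective.1 hinj), fun k => ?_⟩
  refine Finset.eq_of_subset_of_card_le (fun a ha => ?_) ?_
  · obtain ⟨i, hi, rfl⟩ := Finset.mem_map.1 ha
    rw [← hS'1 k]
    have := mem_upTo.1 hi
    exact hstep (a := i + 1) (by omega) (Finset.mem_sdiff.1 (hg i)).1
  · rw [Finset.card_map, card_upTo (by omega), hS]

/-- Elements of `S_z × S_{n-z}` relate the permutations with the same image of the first block. -/
theorem mem_young_iff {u g : Equiv.Perm (Fin n)} :
    u⁻¹ * g ∈ young z ↔ (upTo n z).map g.toEmbedding = (upTo n z).map u.toEmbedding := by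
  constructor
  · intro h
    refine Finset.eq_of_subset_of_card_le (fun a ha => ?_) (by simp)
    obtain ⟨i, hi, rfl⟩ := Finset.mem_map.1 ha
    rw [Finset.mem_map_equiv, mem_upTo]
    exact (h i).2 (mem_upTo.1 hi)
  · intro h i
    change (u.symm (g i) : ℕ) ≤ z ↔ _
    rw [← mem_upTo, ← Finset.mem_map_equiv, ← h, Finset.mem_map_equiv, Equiv.symm_apply_apply,
      mem_upTo]

/-- The positions after the one of index `k` in the same block. -/
def laterInBlock (z : Fin (n - 1)) (k : Fin (n - 1)) : Finset (Fin n) :=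
  Finset.univ.filter fun i => (k : ℕ) < i ∧ (k < z → (i : ℕ) ≤ z)

/-- The inversions of an element of `S_z × S_{n-z}`, counted block by block. -/
theorem sum_laterInBlock {u x : Equiv.Perm (Fin n)} (hu : IncreasingOnBlocks z u)
    (hx : x ∈ young z) :
    ∑ k ∈ Finset.univ.erase z, crossings {(u * x) (lowVal k)}
      ((laterInBlock z k).map (u * x).toEmbedding) = (inversions x).card := by
  have h1 : (inversions x).card =
      ∑ k : Fin n, (Finset.univ.filter fun i => k < i ∧ x i < x k).card := by
    rw [inversions, Finset.card_filter, ← Finset.univ_product_univ, Finset.sum_product]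
    exact Finset.sum_congr rfl fun k _ => (Finset.card_filter _ _).symm
  -- the last positions of the two blocks are not followed by smaller values
  have h2 : ∀ k : Fin n, (k : ℕ) = z ∨ (k : ℕ) = n - 1 →
      (Finset.univ.filter fun i => k < i ∧ x i < x k).card = 0 := by
    intro k hk
    rw [Finset.card_eq_zero, Finset.filter_eq_empty_iff]
    rintro i - ⟨h3, h4⟩
    rw [Fin.lt_def] at h3 h4
    rcases hk with hk | hk
    · have h5 := hx i
      have h6 := hx k
      omega
    · omega
  -- `u` preserves the order of values in the same block
  have h3 : ∀ k : Fin (n - 1), k ≠ z → crossings {(u * x) (lowVal k)}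
      ((laterInBlock z k).map (u * x).toEmbedding) =
      (Finset.univ.filter fun i => lowVal k < i ∧ x i < x (lowVal k)).card := by
    intro k hkz
    rw [crossings, Finset.sum_singleton, Finset.filter_map, Finset.card_map]
    refine congrArg Finset.card (Finset.ext fun i => ?_)
    have hkv : (lowVal k : ℕ) = k := rfl
    have hkz' : (k : ℕ) ≠ z := fun h => hkz (Fin.ext h)
    rw [Finset.mem_filter, Finset.mem_filter, laterInBlock, Finset.mem_filter]
    simp only [Finset.mem_univ, true_and, Function.comp_apply, Equiv.coe_toEmbedding,
      Equiv.Perm.mul_apply]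
    have hiff : ((x i : ℕ) ≤ z ∧ (x (lowVal k) : ℕ) ≤ z) ∨
        ((z : ℕ) < x i ∧ (z : ℕ) < x (lowVal k)) →
        (u (x i) < u (x (lowVal k)) ↔ x i < x (lowVal k)) := by
      intro hb
      constructor
      · intro hlt
        by_contra hge
        rcases (not_lt.1 hge).eq_or_lt with he | hl
        · rw [he] at hlt
          exact lt_irrefl _ hlt
        · exact lt_asymm hlt (hu _ _ hl (by omega))
      · intro hlt
        exact hu _ _ hlt (by omega)
    have h4 := hx i
    have h5 := hx (lowVal k)
    rw [hkv] at h5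
    constructor
    · rintro ⟨⟨h6, h7⟩, h8⟩
      have h7' : (k : ℕ) < z → (i : ℕ) ≤ z := h7
      exact ⟨h6, (hiff (by omega)).1 h8⟩
    · rintro ⟨h6, h7⟩
      have h6' : (k : ℕ) < i := h6
      have h7' : (x i : ℕ) < x (lowVal k) := h7
      have h8 : (k : ℕ) < z → (i : ℕ) ≤ z := by omega
      exact ⟨⟨h6, h8⟩, (hiff (by omega)).2 h7⟩
  rw [h1, Finset.sum_congr rfl fun k hk => h3 k (Finset.mem_erase.1 hk).1]
  have hinj : Function.Injective (lowVal : Fin (n - 1) → Fin n) := fun a b h => by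
    have := congrArg Fin.val h
    exact Fin.ext this
  rw [← Finset.sum_image (s := Finset.univ.erase z) (g := lowVal)
    (f := fun k => (Finset.univ.filter fun i => k < i ∧ x i < x k).card) hinj.injOn]
  refine Finset.sum_subset (Finset.subset_univ _) fun k _ hk => h2 k ?_
  by_contra! hc
  refine hk (Finset.mem_image.2 ⟨⟨k, by omega⟩, ?_, rfl⟩)
  rw [Finset.mem_erase]
  exact ⟨fun h => hc.1 (congrArg Fin.val h), Finset.mem_univ _⟩

end Permutations

/-! ### The Zelevinsky variety as a tower -/

section VarietyTower

variable {n : ℕ} {z : Fin (n - 1)} {wd : List (Fin (n - 1))} {m : ℕ}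
  {P : Fin (m + 1) → Fin wd.length}

theorem lowerOf_map {α β : Type} (f : α → β) (W : Fin (m + 1) → α) (E : ℕ → α) (j : Fin (m + 1)) :
    lowerOf wd P (fun k => f (W k)) (fun c => f (E c)) j = f (lowerOf wd P W E j) := by
  unfold lowerOf
  cases lpred wd P j <;> rfl

theorem upperOf_map {α β : Type} (f : α → β) (W : Fin (m + 1) → α) (E : ℕ → α) (j : Fin (m + 1)) :
    upperOf wd P (fun k => f (W k)) (fun c => f (E c)) j = f (upperOf wd P W E j) := by
  unfold upperOf
  cases rpred wd P j <;> rfl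

theorem lowerOf_congr {α : Type} {W W' : Fin (m + 1) → α} (E : ℕ → α) {j : Fin (m + 1)}
    (h : ∀ k < j, W k = W' k) : lowerOf wd P W E j = lowerOf wd P W' E j := by
  unfold lowerOf
  cases hl : lpred wd P j with
  | some k => exact h k (lpred_lt hl)
  | none => rfl

theorem upperOf_congr {α : Type} {W W' : Fin (m + 1) → α} (E : ℕ → α) {j : Fin (m + 1)}
    (h : ∀ k < j, W k = W' k) : upperOf wd P W E j = upperOf wd P W' E j := by
  unfold upperOf
  cases hl : rpred wd P j with
  | some k => exact h k (rpred_lt hl)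
  | none => rfl

/-- The position of `W_j` among the members of a configuration. -/
def node (z : Fin (n - 1)) : Fin (m + 1) → Fin m ⊕ Fin (n - 1) :=
  Fin.snoc (α := fun _ => Fin m ⊕ Fin (n - 1)) Sum.inl (Sum.inr z)

@[simp]
theorem node_castSucc (j : Fin m) : node z j.castSucc = Sum.inl j := by
  rw [node, Fin.snoc_castSucc]

@[simp]
theorem node_last : node z (Fin.last m) = Sum.inr z := by
  rw [node, Fin.snoc_last]

theorem W_eq (q : Conf wd P) (j : Fin (m + 1)) : W z q j = (q (node z j)).1 := by
  induction j using Fin.lastCases with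
  | last => rw [node_last, W, Fin.snoc_last]; rfl
  | cast j => rw [node_castSucc, W, Fin.snoc_castSucc]

theorem lower_eq (q : Conf wd P) (j : Fin (m + 1)) :
    lower z q j = lowerOf wd P (W z q) (E n) j := rfl

theorem upper_eq (q : Conf wd P) (j : Fin (m + 1)) :
    upper z q j = upperOf wd P (W z q) (E n) j := rfl

/-- The lower bounds, as members of a configuration or of the standard flag. -/
noncomputable def loNode (z : Fin (n - 1)) (wd : List (Fin (n - 1)))
    (P : Fin (m + 1) → Fin wd.length) : Fin m ⊕ Fin (n - 1) → (Fin m ⊕ Fin (n - 1)) ⊕ ℕ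
  | Sum.inl j => lowerOf wd P (fun k => Sum.inl (node z k)) Sum.inr j.castSucc
  | Sum.inr k =>
    if k = z then lowerOf wd P (fun k => Sum.inl (node z k)) Sum.inr (Fin.last m)
    else if (k : ℕ) = 0 then Sum.inr 0 else Sum.inl (Sum.inr ⟨k - 1, by omega⟩)

/-- The upper bounds, as members of a configuration or of the standard flag. -/
noncomputable def upNode (z : Fin (n - 1)) (wd : List (Fin (n - 1)))
    (P : Fin (m + 1) → Fin wd.length) : Fin m ⊕ Fin (n - 1) → (Fin m ⊕ Fin (n - 1)) ⊕ ℕ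
  | Sum.inl j => upperOf wd P (fun k => Sum.inl (node z k)) Sum.inr j.castSucc
  | Sum.inr k =>
    if k = z then upperOf wd P (fun k => Sum.inl (node z k)) Sum.inr (Fin.last m)
    else if k < z then Sum.inl (Sum.inr z) else Sum.inr n

theorem loNode_node (j : Fin (m + 1)) : loNode z wd P (node z j) =
    lowerOf wd P (fun k => Sum.inl (node z k)) Sum.inr j := by
  induction j using Fin.lastCases with
  | last => rw [node_last, loNode, if_pos rfl]
  | cast j => rw [node_castSucc, loNode]

theorem upNode_node (j : Fin (m + 1)) : upNode z wd P (node z j) =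
    upperOf wd P (fun k => Sum.inl (node z k)) Sum.inr j := by
  induction j using Fin.lastCases with
  | last => rw [node_last, upNode, if_pos rfl]
  | cast j => rw [node_castSucc, upNode]

theorem elim_loNode_node {α : Type} (f : Fin m ⊕ Fin (n - 1) → α) (E : ℕ → α) (j : Fin (m + 1)) :
    Sum.elim f E (loNode z wd P (node z j)) = lowerOf wd P (fun k => f (node z k)) E j := by
  rw [loNode_node, ← lowerOf_map (Sum.elim f E)]
  rfl

theorem elim_upNode_node {α : Type} (f : Fin m ⊕ Fin (n - 1) → α) (E : ℕ → α) (j : Fin (m + 1)) :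
    Sum.elim f E (upNode z wd P (node z j)) = upperOf wd P (fun k => f (node z k)) E j := by
  rw [upNode_node, ← upperOf_map (Sum.elim f E)]
  rfl

/-- The order in which the members of a configuration are chosen: `W_1, …, W_p = F_z` come first,
followed by the other members of the flag. -/
def nodeRank (z : Fin (n - 1)) : Fin m ⊕ Fin (n - 1) → ℕ
  | Sum.inl j => j
  | Sum.inr k => if k = z then m else m + 1 + k

theorem nodeRank_node (j : Fin (m + 1)) : nodeRank z (node z j) = j := by
  induction j using Fin.lastCases with
  | last => rw [node_last, nodeRank, if_pos rfl]; rfl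
  | cast j => rw [node_castSucc, nodeRank]; rfl

theorem exists_node_or (i : Fin m ⊕ Fin (n - 1)) :
    (∃ j, i = node z j) ∨ ∃ k, k ≠ z ∧ i = Sum.inr k := by
  rcases i with j | k
  · exact Or.inl ⟨j.castSucc, (node_castSucc j).symm⟩
  · by_cases hk : k = z
    · exact Or.inl ⟨Fin.last m, by rw [node_last, hk]⟩
    · exact Or.inr ⟨k, hk, rfl⟩

theorem loNode_inr_zero {k : Fin (n - 1)} (hk : k ≠ z) (h0 : (k : ℕ) = 0) :
    loNode z wd P (Sum.inr k) = Sum.inr 0 := by rw [loNode, if_neg hk, if_pos h0]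

theorem loNode_inr_succ {k k' : Fin (n - 1)} (hk : k' ≠ z) (h : (k' : ℕ) = k + 1) :
    loNode z wd P (Sum.inr k') = Sum.inl (Sum.inr k) := by
  rw [loNode, if_neg hk, if_neg (by omega)]
  congr 2
  ext
  simp only
  omega

theorem upNode_inr_lt {k : Fin (n - 1)} (hk : k < z) :
    upNode z wd P (Sum.inr k) = Sum.inl (Sum.inr z) := by rw [upNode, if_neg hk.ne, if_pos hk]

theorem upNode_inr_gt {k : Fin (n - 1)} (hk : z < k) :
    upNode z wd P (Sum.inr k) = Sum.inr n := by rw [upNode, if_neg hk.ne', if_neg hk.asymm]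

/-- The members of a family satisfying the lower bounds are at least `E 0`. -/
theorem zero_le_of_lowerOf_le {α : Type} [Preorder α] {W : Fin (m + 1) → α} {E : ℕ → α}
    (hE : Monotone E) (h : ∀ j, lowerOf wd P W E j ≤ W j) (j : Fin (m + 1)) : E 0 ≤ W j := by
  induction hj : (j : ℕ) using Nat.strong_induction_on generalizing j with
  | _ r ih =>
    refine le_trans ?_ (h j)
    unfold lowerOf
    cases hl : lpred wd P j with
    | some k => exact ih k (hj ▸ lpred_lt hl) k rfl
    | none => exact hE (Nat.zero_le _)

/-- The members of a family satisfying the upper bounds are at most `E n`. -/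
theorem le_of_le_upperOf {α : Type} [Preorder α] {W : Fin (m + 1) → α} {E : ℕ → α}
    (hE : Monotone E) (h : ∀ j, W j ≤ upperOf wd P W E j) (j : Fin (m + 1)) : W j ≤ E n := by
  induction hj : (j : ℕ) using Nat.strong_induction_on generalizing j with
  | _ r ih =>
    refine (h j).trans ?_
    unfold upperOf
    cases hl : rpred wd P j with
    | some k => exact ih k (hj ▸ rpred_lt hl) k rfl
    | none => exact hE (rdim_le j)

/-- The tower of Grassmannian bundles whose points form the Zelevinsky variety. -/
noncomputable def varietyTower (h : IsGrassmannianWord z wd) (hP : IsPeakOrdering wd P) :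
    Tower (Fin m ⊕ Fin (n - 1)) where
  rk := nodeRank z
  lo := loNode z wd P
  up := upNode z wd P
  rk_lo i k hk := by
    rcases exists_node_or (z := z) i with ⟨j, rfl⟩ | ⟨l, hl, rfl⟩
    · rw [loNode_node] at hk
      unfold lowerOf at hk
      cases hj : lpred wd P j with
      | some j' =>
        rw [hj] at hk
        rw [← Sum.inl_injective hk, nodeRank_node, nodeRank_node]
        exact lpred_lt hj
      | none =>
        rw [hj] at hk
        exact absurd hk Sum.inr_ne_inl
    · by_cases h0 : (l : ℕ) = 0
      · rw [loNode_inr_zero hl h0] at hk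
        exact absurd hk Sum.inr_ne_inl
      · rw [loNode_inr_succ (k := ⟨l - 1, by omega⟩) hl (by simp only; omega)] at hk
        rw [← Sum.inl_injective hk, nodeRank, nodeRank, if_neg hl]
        split_ifs
        · omega
        · simp only
          omega
  rk_up i k hk := by
    rcases exists_node_or (z := z) i with ⟨j, rfl⟩ | ⟨l, hl, rfl⟩
    · rw [upNode_node] at hk
      unfold upperOf at hk
      cases hj : rpred wd P j with
      | some j' =>
        rw [hj] at hk
        rw [← Sum.inl_injective hk, nodeRank_node, nodeRank_node]
        exact rpred_lt hj
      | none =>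
        rw [hj] at hk
        exact absurd hk Sum.inr_ne_inl
    · rcases hl.lt_or_gt with hlt | hgt
      · rw [upNode_inr_lt hlt] at hk
        rw [← Sum.inl_injective hk, nodeRank, nodeRank, if_neg hl, if_pos rfl]
        omega
      · rw [upNode_inr_gt hgt] at hk
        exact absurd hk Sum.inr_ne_inl
  nested {α} _ W E hE i hW := by
    have hnode : ∀ j : Fin (m + 1), (j : ℕ) < nodeRank z i →
        lowerOf wd P (fun k => W (node z k)) E j ≤ W (node z j) ∧
          W (node z j) ≤ upperOf wd P (fun k => W (node z k)) E j := by
      intro j hj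
      have := hW (node z j) (by rwa [nodeRank_node])
      rwa [elim_loNode_node, elim_upNode_node] at this
    rcases exists_node_or (z := z) i with ⟨j, rfl⟩ | ⟨l, hl, rfl⟩
    · rw [elim_loNode_node, elim_upNode_node]
      exact h.lowerOf_le_upperOf hP hE j fun i hi => hnode i (by rw [nodeRank_node]; exact hi)
    · have hr : nodeRank z (Sum.inr l : Fin m ⊕ Fin (n - 1)) = m + 1 + l := by
        rw [nodeRank, if_neg hl]
      rw [hr] at hnode hW
      have hz : (Sum.inr z : Fin m ⊕ Fin (n - 1)) = node z (Fin.last m) := node_last.symm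
      rcases hl.lt_or_gt with hlt | hgt
      · rw [upNode_inr_lt hlt]
        by_cases h0 : (l : ℕ) = 0
        · rw [loNode_inr_zero hl h0, Sum.elim_inr, Sum.elim_inl, hz]
          exact zero_le_of_lowerOf_le (W := fun k => W (node z k)) hE
            (fun j => (hnode j (by omega)).1) (Fin.last m)
        · have hlz : (⟨l - 1, by omega⟩ : Fin (n - 1)) < z := by
            rw [Fin.lt_def] at hlt ⊢
            simp only
            omega
          rw [loNode_inr_succ (k := ⟨l - 1, by omega⟩) hl (by simp only; omega)]
          have := (hW (Sum.inr ⟨l - 1, by omega⟩) (by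
            rw [nodeRank, if_neg hlz.ne]
            simp only
            omega)).2
          rwa [upNode_inr_lt hlz] at this
      · rw [upNode_inr_gt hgt, loNode_inr_succ (k := ⟨l - 1, by omega⟩) hl
          (by rw [Fin.lt_def] at hgt; simp only; omega), Sum.elim_inl, Sum.elim_inr]
        by_cases hlz : (⟨l - 1, by omega⟩ : Fin (n - 1)) = z
        · rw [hlz, hz]
          exact le_of_le_upperOf (W := fun k => W (node z k)) hE
            (fun j => (hnode j (by omega)).2) (Fin.last m)
        · have := (hW (Sum.inr ⟨l - 1, by omega⟩) (by
            rw [nodeRank, if_neg hlz]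
            simp only
            rw [Fin.lt_def] at hgt
            omega)).2
          rwa [upNode_inr_gt (lt_of_le_of_ne (by rw [Fin.le_def]; simp only; omega)
            (Ne.symm hlz))] at this

variable (h : IsGrassmannianWord z wd) (hP : IsPeakOrdering wd P)

theorem points_varietyTower : (varietyTower h hP).points = variety z wd P := by
  ext q
  have hmem : q ∈ (varietyTower h hP).points ↔ ∀ i,
      Sum.elim (fun k => (q k).1) (E n) (loNode z wd P i) ≤ (q i).1 ∧
        (q i).1 ≤ Sum.elim (fun k => (q k).1) (E n) (upNode z wd P i) := Iff.rfl
  rw [hmem]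
  constructor
  · intro hq
    refine ⟨fun j => ?_, fun k k' hk => ?_⟩
    · have := hq (node z j)
      rw [elim_loNode_node, elim_upNode_node] at this
      rw [lower_eq, upper_eq, W_eq, show W z q = fun k => (q (node z k)).1 from funext (W_eq q)]
      exact this
    · by_cases hz : k' = z
      · have := (hq (Sum.inr k)).2
        rw [upNode_inr_lt (by rw [← hz, Fin.lt_def]; omega)] at this
        rw [hz]
        exact this
      · have := (hq (Sum.inr k')).1
        rw [loNode_inr_succ hz hk] at this
        exact this
  · rintro ⟨h1, h2⟩ i
    rcases exists_node_or (z := z) i with ⟨j, rfl⟩ | ⟨l, hl, rfl⟩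
    · rw [elim_loNode_node, elim_upNode_node]
      have := h1 j
      rw [lower_eq, upper_eq, W_eq, show W z q = fun k => (q (node z k)).1 from funext (W_eq q)]
        at this
      exact this
    · have hmono : ∀ d : ℕ, ∀ k k' : Fin (n - 1), (k' : ℕ) = k + d → flag q k ≤ flag q k' := by
        intro d
        induction d with
        | zero => intro k k' hk; rw [show k' = k from Fin.ext (by simpa using hk)]
        | succ d ih =>
          intro k k' hk
          exact (ih k ⟨k + d, by omega⟩ rfl).trans (h2 _ _ (by simp only; omega))
      constructor
      · by_cases h0 : (l : ℕ) = 0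
        · rw [loNode_inr_zero hl h0, Sum.elim_inr, E_eq]
          simp [initialSet, spanOn]
        · rw [loNode_inr_succ (k := ⟨l - 1, by omega⟩) hl (by simp only; omega)]
          exact hmono 1 _ _ (by simp only; omega)
      · rcases hl.lt_or_gt with hlt | hgt
        · rw [upNode_inr_lt hlt]
          rw [Fin.lt_def] at hlt
          exact hmono (z - l) _ _ (by omega)
        · rw [upNode_inr_gt hgt, Sum.elim_inr]
          intro x _
          rw [E, mem_coordSpan_iff]
          intro i hi
          exact absurd i.2 hi

end VarietyTower

/-! ### Fixed points -/

section FixedPoints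

variable {n : ℕ} {z : Fin (n - 1)} {wd : List (Fin (n - 1))} {m : ℕ}
  {P : Fin (m + 1) → Fin wd.length}

theorem card_initialSet {c : ℕ} (hc : c ≤ n) : (initialSet n c).card = c := by
  rcases Nat.eq_zero_or_pos c with rfl | h
  · simp [initialSet]
  · have : initialSet n c = upTo n (c - 1) := by
      ext i
      simp only [initialSet, mem_upTo, Finset.mem_filter, Finset.mem_univ, true_and]
      omega
    rw [this, card_upTo (by omega)]
    omega

theorem E_eq_coordSpan (c : ℕ) : E n c = coordSpan (initialSet n c : Set (Fin n)) := by
  rw [E_eq, coordSpan_eq_spanOn]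

theorem lower_eq_coordSpan {q : Conf wd P} {S : Fin (m + 1) → Finset (Fin n)}
    (hS : ∀ j, W z q j = coordSpan (S j : Set (Fin n))) (j : Fin (m + 1)) :
    lower z q j = coordSpan ((lowerOf wd P S (initialSet n) j : Finset (Fin n)) : Set (Fin n)) := by
  rw [lower_eq, show W z q = fun k => coordSpan (S k : Set (Fin n)) from funext hS,
    show E n = fun c => coordSpan (initialSet n c : Set (Fin n)) from funext E_eq_coordSpan]
  exact lowerOf_map (fun S : Finset (Fin n) => (coordSpan (S : Set (Fin n)) : Submodule ℂ (V n)))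
    S (initialSet n) j

theorem upper_eq_coordSpan {q : Conf wd P} {S : Fin (m + 1) → Finset (Fin n)}
    (hS : ∀ j, W z q j = coordSpan (S j : Set (Fin n))) (j : Fin (m + 1)) :
    upper z q j = coordSpan ((upperOf wd P S (initialSet n) j : Finset (Fin n)) : Set (Fin n)) := by
  rw [upper_eq, show W z q = fun k => coordSpan (S k : Set (Fin n)) from funext hS,
    show E n = fun c => coordSpan (initialSet n c : Set (Fin n)) from funext E_eq_coordSpan]
  exact upperOf_map (fun S : Finset (Fin n) => (coordSpan (S : Set (Fin n)) : Submodule ℂ (V n)))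
    S (initialSet n) j

theorem card_lowerOf {S : Fin (m + 1) → Finset (Fin n)} {j : Fin (m + 1)}
    (hS : ∀ k < j, (S k).card = d wd P k) :
    (lowerOf wd P S (initialSet n) j).card = ldim wd P j := by
  unfold lowerOf
  cases hl : lpred wd P j with
  | some k => exact (hS k (lpred_lt hl)).trans (d_of_lpred hl)
  | none =>
    refine card_initialSet ?_
    rw [ldim, col]
    omega

theorem card_upperOf {S : Fin (m + 1) → Finset (Fin n)} {j : Fin (m + 1)}
    (hS : ∀ k < j, (S k).card = d wd P k) :
    (upperOf wd P S (initialSet n) j).card = rdim wd P j := by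
  unfold upperOf
  cases hl : rpred wd P j with
  | some k => exact (hS k (rpred_lt hl)).trans (d_of_rpred hl)
  | none => exact card_initialSet (rdim_le j)

theorem sdiff_sdiff_sdiff_of_subset {A B C : Finset (Fin n)} (h : C ⊆ B) :
    (A \ C) \ (B \ C) = A \ B := by
  ext i
  have := @h i
  simp only [Finset.mem_sdiff]
  tauto

/-- The index sets of `W_1, …, W_p` satisfy the conditions defining the Zelevinsky variety, and
their dimensions and partitions are the given ones. -/
structure IsSubsetFamily (wd : List (Fin (n - 1))) (P : Fin (m + 1) → Fin wd.length)
    (τ : Fin (m + 1) → YoungDiagram) (S : Fin (m + 1) → Finset (Fin n)) (j : Fin (m + 1)) :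
    Prop where
  lower_subset : lowerOf wd P S (initialSet n) j ⊆ S j
  subset_upper : S j ⊆ upperOf wd P S (initialSet n) j
  card_eq : (S j).card = d wd P j
  diagram_eq : diagram (S j \ lowerOf wd P S (initialSet n) j)
    ((upperOf wd P S (initialSet n) j \ lowerOf wd P S (initialSet n) j) \
      (S j \ lowerOf wd P S (initialSet n) j)) = τ j

/-- Each index set is determined by its partition and the preceding index sets. -/
theorem IsSubsetFamily.eq {τ : Fin (m + 1) → YoungDiagram} {S S' : Fin (m + 1) → Finset (Fin n)}
    (hS : ∀ j, IsSubsetFamily wd P τ S j) (hS' : ∀ j, IsSubsetFamily wd P τ S' j) : S = S' := by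
  funext j
  induction hj : (j : ℕ) using Nat.strong_induction_on generalizing j with
  | _ r ih =>
    subst hj
    have ih : ∀ k < j, S k = S' k := fun k hk => ih k hk k rfl
    have h1 := hS j
    have h2 := hS' j
    have hlo := lowerOf_congr (wd := wd) (P := P) (initialSet n) ih
    have hup := upperOf_congr (wd := wd) (P := P) (initialSet n) ih
    obtain ⟨a1, a2, a3, a4⟩ := h1
    obtain ⟨b1, b2, b3, b4⟩ := h2
    rw [← hlo] at b1 b4
    rw [← hup] at b2 b4
    have := eq_of_diagram_eq (Finset.sdiff_subset_sdiff a2 le_rfl)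
      (Finset.sdiff_subset_sdiff b2 le_rfl)
      (by rw [Finset.card_sdiff_of_subset a1, Finset.card_sdiff_of_subset b1, a3, b3])
      (a4.trans b4.symm)
    rw [← Finset.sdiff_union_of_subset a1, this, Finset.sdiff_union_of_subset b1]

/-- The partitions fitting into the rectangles come from families of subsets. -/
theorem exists_isSubsetFamily (h : IsGrassmannianWord z wd) (hP : IsPeakOrdering wd P)
    {τ : Fin (m + 1) → YoungDiagram}
    (hτ : ∀ j, ∀ c ∈ τ j, c.1 + ldim wd P j < d wd P j ∧ c.2 + d wd P j < rdim wd P j) :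
    ∃ S : Fin (m + 1) → Finset (Fin n), ∀ j, IsSubsetFamily wd P τ S j := by
  classical
  let G (f : Fin (m + 1) → Finset (Fin n)) (j : Fin (m + 1)) : Finset (Fin n) :=
    if hT : ∃ T ⊆ upperOf wd P f (initialSet n) j \ lowerOf wd P f (initialSet n) j,
      T.card = d wd P j - ldim wd P j ∧
      diagram T ((upperOf wd P f (initialSet n) j \ lowerOf wd P f (initialSet n) j) \ T) = τ j
    then lowerOf wd P f (initialSet n) j ∪ hT.choose else ∅
  obtain ⟨S, hS⟩ := exists_eq_of_rank (fun j : Fin (m + 1) => (j : ℕ)) G fun j f g hfg => by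
    simp only [G]
    rw [lowerOf_congr (initialSet n) hfg, upperOf_congr (initialSet n) hfg]
  refine ⟨S, fun j => ?_⟩
  induction hj : (j : ℕ) using Nat.strong_induction_on generalizing j with
  | _ r ih =>
    subst hj
    have ih : ∀ k < j, IsSubsetFamily wd P τ S k := fun k hk => ih k hk k rfl
    have hlu := h.lowerOf_le_upperOf hP (initialSet_mono n) j fun k hk =>
      ⟨(ih k hk).lower_subset, (ih k hk).subset_upper⟩
    have hlc := card_lowerOf fun k hk => (ih k hk).card_eq
    have huc := card_upperOf fun k hk => (ih k hk).card_eq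
    have h1 := h.ldim_lt_d hP j
    have h2 := h.d_lt_rdim hP j
    have hAc := Finset.card_sdiff_of_subset hlu
    rw [hlc, huc] at hAc
    have hex := exists_diagram_eq
      (upperOf wd P S (initialSet n) j \ lowerOf wd P S (initialSet n) j)
      (t := d wd P j - ldim wd P j) (by omega) (τ j) fun c hc => by
        have := hτ j c hc
        omega
    obtain ⟨hT1, hT2, hT3⟩ := hex.choose_spec
    have hSj : S j = lowerOf wd P S (initialSet n) j ∪ hex.choose := by
      conv_lhs => rw [hS j]
      simp only [G]
      rw [dif_pos hex]
    have hdisj : Disjoint (lowerOf wd P S (initialSet n) j) hex.choose :=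
      (Finset.sdiff_disjoint.mono_left hT1).symm
    have hsd : S j \ lowerOf wd P S (initialSet n) j = hex.choose := by
      rw [hSj, Finset.union_sdiff_cancel_left hdisj]
    refine ⟨?_, ?_, ?_, ?_⟩
    · rw [hSj]
      exact Finset.subset_union_left
    · rw [hSj]
      exact Finset.union_subset hlu (hT1.trans Finset.sdiff_subset)
    · rw [hSj, Finset.card_union_of_disjoint hdisj, hlc, hT2]
      omega
    · rw [hsd]
      exact hT3

/-- The index set of `W_j`. -/
noncomputable def indexSets (z : Fin (n - 1)) (q : Conf wd P) (j : Fin (m + 1)) : Finset (Fin n) :=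
  coordSet (W z q j)

theorem flag_eq_W_last (q : Conf wd P) : flag q z = W z q (Fin.last m) := by
  rw [W_eq, node_last]
  rfl

theorem W_eq_coordSpan {q : Conf wd P} (hq : IsFixed q) (j : Fin (m + 1)) :
    W z q j = coordSpan (indexSets z q j : Set (Fin n)) := by
  rw [indexSets, W_eq]
  exact (isFixed_iff q).1 hq _

theorem flag_eq_coordSpan {q : Conf wd P} (hq : IsFixed q) (k : Fin (n - 1)) :
    flag q k = coordSpan (coordSet (flag q k) : Set (Fin n)) :=
  (isFixed_iff q).1 hq (Sum.inr k)

theorem T_eq {q : Conf wd P} {S : Fin (m + 1) → Finset (Fin n)}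
    (hS : ∀ j, W z q j = coordSpan (S j : Set (Fin n))) (j : Fin (m + 1)) :
    T z q j = S j \ lowerOf wd P S (initialSet n) j := by
  rw [T, hS, lower_eq_coordSpan hS, coordSet_coordSpan, coordSet_coordSpan]

theorem D_eq {q : Conf wd P} {S : Fin (m + 1) → Finset (Fin n)}
    (hS : ∀ j, W z q j = coordSpan (S j : Set (Fin n))) (j : Fin (m + 1)) :
    D z q j = (upperOf wd P S (initialSet n) j \ lowerOf wd P S (initialSet n) j) \
      (S j \ lowerOf wd P S (initialSet n) j) := by
  rw [D, A, T_eq hS, lower_eq_coordSpan hS, upper_eq_coordSpan hS, coordSet_coordSpan,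
    coordSet_coordSpan]

theorem confDim_node (h : IsGrassmannianWord z wd) (hP : IsPeakOrdering wd P) (j : Fin (m + 1)) :
    confDim wd P (node z j) = d wd P j := by
  induction j using Fin.lastCases with
  | last => rw [node_last, confDim, h.d_last hP]
  | cast j => rw [node_castSucc, confDim]

theorem isSubsetFamily_indexSets (h : IsGrassmannianWord z wd) (hP : IsPeakOrdering wd P)
    {q : Conf wd P} (hq : q ∈ fixedPoints z wd P) {τ : Fin (m + 1) → YoungDiagram}
    (hτ : ∀ j, τ j = diagram (T z q j) (D z q j)) (j : Fin (m + 1)) :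
    IsSubsetFamily wd P τ (indexSets z q) j := by
  have hW := W_eq_coordSpan (z := z) hq.2
  obtain ⟨h1, h2⟩ := hq.1.1 j
  rw [lower_eq_coordSpan hW, hW, coordSpan_le_iff, Finset.coe_subset] at h1
  rw [upper_eq_coordSpan hW, hW, coordSpan_le_iff, Finset.coe_subset] at h2
  refine ⟨h1, h2, ?_, ?_⟩
  · rw [← finrank_coordSpan, ← hW, W_eq, (q (node z j)).2, confDim_node h hP]
  · rw [hτ, T_eq hW, D_eq hW]

theorem image_eq_map_upTo (g : Equiv.Perm (Fin n)) (k : ℕ) :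
    g '' {i : Fin n | (i : ℕ) ≤ k} = ((upTo n k).map g.toEmbedding : Set (Fin n)) := by
  rw [Finset.coe_map, coe_upTo]
  rfl

theorem coordSpan_finset_inj {S S' : Finset (Fin n)} :
    (coordSpan (S : Set (Fin n)) : Submodule ℂ (V n)) = coordSpan (S' : Set (Fin n)) ↔ S = S' :=
  ⟨fun h => Finset.coe_injective (coordSpan_injective h), fun h => by rw [h]⟩

/-- The tuple of a fixed point, in terms of index sets. -/
theorem encodes_iff {q : Conf wd P} (hq : IsFixed q)
    (σ : (Fin (m + 1) → YoungDiagram) × Equiv.Perm (Fin n)) :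
    Encodes z q σ ↔ (∀ j, σ.1 j = diagram (T z q j) (D z q j)) ∧ σ.2 ∈ young z ∧
      ∃ u : Equiv.Perm (Fin n), (IncreasingOnBlocks z u ∧
        (upTo n z).map u.toEmbedding = coordSet (flag q z)) ∧
        ∀ k : Fin (n - 1), (upTo n k).map (u * σ.2).toEmbedding = coordSet (flag q k) := by
  have h1 : ∀ (g : Equiv.Perm (Fin n)) (k : Fin (n - 1)),
      flag q k = coordSpan (g '' {i : Fin n | (i : ℕ) ≤ k}) ↔
      (upTo n k).map g.toEmbedding = coordSet (flag q k) := by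
    intro g k
    rw [image_eq_map_upTo]
    conv_lhs => rw [flag_eq_coordSpan hq k, coordSpan_finset_inj]
    exact eq_comm
  unfold Encodes IsGrassmannianFor
  simp only [h1]
  rfl

theorem card_coordSet_flag {q : Conf wd P} (hq : IsFixed q) (k : Fin (n - 1)) :
    (coordSet (flag q k)).card = k + 1 := by
  rw [← finrank_coordSpan, ← flag_eq_coordSpan hq, flag, (q (Sum.inr k)).2, confDim]

/-- A fixed point comes from a flag of subsets, hence from a permutation `g`, which factors as
`u * x`. -/
theorem existsUnique_encodes {q : Conf wd P} (hq : q ∈ fixedPoints z wd P) :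
    ∃! σ, Encodes z q σ := by
  obtain ⟨u, hu, huniq⟩ := existsUnique_increasingOnBlocks (card_coordSet_flag hq.2 z)
  obtain ⟨g, hg⟩ := exists_perm_of_flag (S := fun k => coordSet (flag q k))
    (card_coordSet_flag hq.2) fun k k' hk i hi => by
      rw [mem_coordSet] at hi ⊢
      exact hq.1.2 k k' hk hi
  refine ⟨(fun j => diagram (T z q j) (D z q j), u⁻¹ * g), ?_, ?_⟩
  · simp only
    rw [encodes_iff hq.2]
    refine ⟨fun j => rfl, mem_young_iff.2 ((hg z).trans hu.2.symm), u, hu, fun k => ?_⟩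
    simp only [mul_inv_cancel_left]
    exact hg k
  · rintro ⟨τ, x⟩ hσ
    rw [encodes_iff hq.2] at hσ
    obtain ⟨h1, -, u', hu', h2⟩ := hσ
    obtain rfl := huniq u' hu'
    have h3 : u' * x = g := perm_eq_of_map_upTo fun k => (h2 k).trans (hg k).symm
    refine Prod.ext (funext h1) ?_
    rw [← h3, inv_mul_cancel_left]

theorem mem_indexSet_of_encodes (h : IsGrassmannianWord z wd) (hP : IsPeakOrdering wd P)
    {q : Conf wd P} (hq : q ∈ fixedPoints z wd P)
    {σ : (Fin (m + 1) → YoungDiagram) × Equiv.Perm (Fin n)} (hσ : Encodes z q σ) :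
    σ ∈ indexSet z wd P := by
  refine ⟨fun j c hc => ?_, hσ.2.1⟩
  have hS := isSubsetFamily_indexSets h hP hq hσ.1
  have hW := W_eq_coordSpan (z := z) hq.2
  obtain ⟨a1, a2, a3, a4⟩ := hS j
  rw [hσ.1 j, T_eq hW, D_eq hW, ← YoungDiagram.mem_cells, diagram, Finset.mem_filter,
    Finset.mem_product, Finset.mem_range, Finset.mem_range, sdiff_sdiff_sdiff_of_subset a1,
    Finset.card_sdiff_of_subset a1, Finset.card_sdiff_of_subset a2, a3,
    card_lowerOf fun k _ => (hS k).card_eq, card_upperOf fun k _ => (hS k).card_eq] at hc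
  omega

theorem existsUnique_fixedPoint (h : IsGrassmannianWord z wd) (hP : IsPeakOrdering wd P)
    {σ : (Fin (m + 1) → YoungDiagram) × Equiv.Perm (Fin n)} (hσ : σ ∈ indexSet z wd P) :
    ∃! q, q ∈ fixedPoints z wd P ∧ Encodes z q σ := by
  refine existsUnique_of_exists_of_unique ?_ ?_
  · obtain ⟨S, hS⟩ := exists_isSubsetFamily h hP hσ.1
    obtain ⟨u, hu, -⟩ := existsUnique_increasingOnBlocks (z := z) (S := S (Fin.last m))
      (by rw [(hS _).card_eq, h.d_last hP])
    let R : Fin m ⊕ Fin (n - 1) → Finset (Fin n) := Sum.elim (fun j => S j.castSucc)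
      fun k => (upTo n k).map (u * σ.2).toEmbedding
    have hR : ∀ i, (R i).card = confDim wd P i := by
      rintro (j | k)
      · exact (hS _).card_eq
      · simp only [R, Sum.elim_inr, Finset.card_map, confDim]
        exact card_upTo (by omega)
    have hz : (upTo n z).map (u * σ.2).toEmbedding = S (Fin.last m) := by
      rw [← hu.2, ← mem_young_iff, inv_mul_cancel_left]
      exact hσ.2
    have hRnode : ∀ j, R (node z j) = S j := by
      intro j
      induction j using Fin.lastCases with
      | last => rw [node_last]; exact hz
      | cast j => rw [node_castSucc]; rfl
    let q : Conf wd P := fun i => ⟨coordSpan (R i : Set (Fin n)), by rw [finrank_coordSpan, hR]⟩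
    have hW : ∀ j, W z q j = coordSpan (S j : Set (Fin n)) := by
      intro j
      rw [W_eq, ← hRnode]
    have hflag : ∀ k, flag q k =
        coordSpan ((upTo n k).map (u * σ.2).toEmbedding : Set (Fin n)) := fun k => rfl
    have hfix : IsFixed q := by
      rw [isFixed_iff]
      intro i
      change (coordSpan (R i : Set (Fin n)) : Submodule ℂ (V n)) = coordSpan
        ((coordSet (coordSpan (R i : Set (Fin n)) : Submodule ℂ (V n)) : Finset (Fin n)) :
          Set (Fin n))
      rw [coordSet_coordSpan]
    refine ⟨q, ⟨⟨fun j => ?_, fun k k' hk => ?_⟩, hfix⟩, ?_⟩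
    · rw [lower_eq_coordSpan hW, upper_eq_coordSpan hW, hW, coordSpan_le_iff, coordSpan_le_iff]
      exact ⟨Finset.coe_subset.2 (hS j).lower_subset, Finset.coe_subset.2 (hS j).subset_upper⟩
    · rw [hflag, hflag, coordSpan_le_iff, Finset.coe_subset, Finset.map_subset_map]
      intro i hi
      rw [mem_upTo] at hi ⊢
      omega
    · rw [encodes_iff hfix]
      refine ⟨fun j => ?_, hσ.2, u, ⟨hu.1, ?_⟩, fun k => ?_⟩
      · rw [T_eq hW, D_eq hW, (hS j).diagram_eq]
      · rw [hflag, coordSet_coordSpan, hz, hu.2]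
      · rw [hflag, coordSet_coordSpan]
  · rintro q q' ⟨hq, hqσ⟩ ⟨hq', hqσ'⟩
    have hSS := IsSubsetFamily.eq (isSubsetFamily_indexSets h hP hq hqσ.1)
      (isSubsetFamily_indexSets h hP hq' hqσ'.1)
    have hWW : ∀ j, W z q j = W z q' j := fun j => by
      rw [W_eq_coordSpan hq.2, W_eq_coordSpan hq'.2, hSS]
    obtain ⟨-, -, u, hu, hug⟩ := (encodes_iff hq.2 σ).1 hqσ
    obtain ⟨-, -, u', hu', hug'⟩ := (encodes_iff hq'.2 σ).1 hqσ'
    have huu : u = u' := by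
      refine (existsUnique_increasingOnBlocks (card_coordSet_flag hq.2 z)).unique hu ?_
      rw [flag_eq_W_last, hWW, ← flag_eq_W_last]
      exact hu'
    funext i
    refine Subtype.ext ?_
    rcases i with j | k
    · have := hWW j.castSucc
      rwa [W_eq, W_eq, node_castSucc] at this
    · change flag q k = flag q' k
      rw [flag_eq_coordSpan hq.2, flag_eq_coordSpan hq'.2, ← hug, ← hug', huu]

/-! ### Dimensions of the cells -/

/-- The number of coordinates of a cell. -/
theorem card_coord {ι : Type} [Fintype ι] (T : Tower ι) (S : ι → Finset (Fin n)) :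
    Nat.card (T.Coord S) = ∑ i, crossings (S i \ T.loSet S i) (T.upSet S i \ S i) := by
  let f : T.Coord S ≃ Σ i, Σ b : {b // b ∈ S i \ T.loSet S i},
      {a // a ∈ (T.upSet S i \ S i).filter (· < b.1)} :=
    { toFun := fun p => ⟨p.1.1, ⟨p.1.2.2, p.2.2.1⟩,
        ⟨p.1.2.1, Finset.mem_filter.2 ⟨p.2.1, p.2.2.2⟩⟩⟩
      invFun := fun x => ⟨(x.1, x.2.2.1, x.2.1.1), (Finset.mem_filter.1 x.2.2.2).1, x.2.1.2,
        (Finset.mem_filter.1 x.2.2.2).2⟩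
      left_inv := fun _ => rfl
      right_inv := fun _ => rfl }
  rw [Nat.card_congr f, Nat.card_eq_fintype_card, Fintype.card_sigma]
  refine Finset.sum_congr rfl fun i _ => ?_
  rw [Fintype.card_sigma, crossings, ← Finset.sum_coe_sort (S i \ T.loSet S i)]
  exact Finset.sum_congr rfl fun b _ => Fintype.card_coe _

/-- The sum over the members of a configuration, with `W_1, …, W_p = F_z` counted first. -/
theorem sum_eq_sum_node (f : Fin m ⊕ Fin (n - 1) → ℕ) :
    ∑ i, f i = ∑ j : Fin (m + 1), f (node z j) + ∑ k ∈ Finset.univ.erase z, f (Sum.inr k) := by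
  rw [Fintype.sum_sum_type, Fin.sum_univ_castSucc, node_last, add_assoc,
    Finset.add_sum_erase _ (fun k => f (Sum.inr k)) (Finset.mem_univ z)]
  simp only [node_castSucc]

/-- The Białynicki-Birula cells are the sets of points with given pivots. -/
theorem cell_eq (h : IsGrassmannianWord z wd) (hP : IsPeakOrdering wd P) {q : Conf wd P}
    (hq : IsFixed q) : cell z q = {y : (i : Fin m ⊕ Fin (n - 1)) → Gr n (confDim wd P i) |
      y ∈ (varietyTower h hP).points ∧ ∀ i, pivots (y i).1 = coordSet (q i).1} := by
  ext y
  rw [points_varietyTower]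
  exact and_congr_right fun _ => flowsTo_iff hq

/-- The contribution of a member `F_k` of the flag, with `k ≠ z`, to the dimension of a cell. -/
theorem crossings_flag (h : IsGrassmannianWord z wd) (hP : IsPeakOrdering wd P)
    {S : Fin m ⊕ Fin (n - 1) → Finset (Fin n)} {g : Equiv.Perm (Fin n)}
    (hg : ∀ k : Fin (n - 1), S (Sum.inr k) = (upTo n k).map g.toEmbedding) {k : Fin (n - 1)}
    (hk : k ≠ z) :
    crossings (S (Sum.inr k) \ (varietyTower h hP).loSet S (Sum.inr k))
      ((varietyTower h hP).upSet S (Sum.inr k) \ S (Sum.inr k)) =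
      crossings {g (lowVal k)} ((laterInBlock z k).map g.toEmbedding) := by
  have hlo : S (Sum.inr k) \ (varietyTower h hP).loSet S (Sum.inr k) = {g (lowVal k)} := by
    ext i
    change i ∈ _ \ Sum.elim S (initialSet n) (loNode z wd P (Sum.inr k)) ↔ _
    rw [Finset.mem_sdiff, hg, Finset.mem_map_equiv, mem_upTo, Finset.mem_singleton,
      ← Equiv.symm_apply_eq, Fin.ext_iff, show (lowVal k : ℕ) = k from rfl]
    by_cases h0 : (k : ℕ) = 0
    · rw [loNode_inr_zero hk h0, Sum.elim_inr]
      simp only [initialSet, Finset.mem_filter]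
      omega
    · rw [loNode_inr_succ (k := ⟨k - 1, by omega⟩) hk (by simp only; omega), Sum.elim_inl, hg,
        Finset.mem_map_equiv, mem_upTo]
      simp only
      omega
  have hup : (varietyTower h hP).upSet S (Sum.inr k) \ S (Sum.inr k) =
      (laterInBlock z k).map g.toEmbedding := by
    ext i
    change i ∈ Sum.elim S (initialSet n) (upNode z wd P (Sum.inr k)) \ _ ↔ _
    rw [Finset.mem_sdiff, hg, Finset.mem_map_equiv, mem_upTo, Finset.mem_map_equiv, laterInBlock,
      Finset.mem_filter, Fin.lt_def]
    rcases hk.lt_or_gt with hlt | hgt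
    · rw [upNode_inr_lt hlt, Sum.elim_inl, hg, Finset.mem_map_equiv, mem_upTo]
      rw [Fin.lt_def] at hlt
      simp only [Finset.mem_univ, true_and]
      omega
    · rw [upNode_inr_gt hgt, Sum.elim_inr]
      rw [Fin.lt_def] at hgt
      simp only [initialSet, Finset.mem_filter, Finset.mem_univ, true_and]
      have := i.2
      omega
  rw [hlo, hup]

/-- The members `W_j` contribute `|τ_j|` to the dimension, and the other members of the flag the
inversions of `x`. -/
theorem zariskiDim_cell_of_encodes (h : IsGrassmannianWord z wd) (hP : IsPeakOrdering wd P)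
    {q : Conf wd P} (hq : q ∈ fixedPoints z wd P)
    {σ : (Fin (m + 1) → YoungDiagram) × Equiv.Perm (Fin n)} (hσ : Encodes z q σ) :
    zariskiDim (cell z q) = ((∑ j, (σ.1 j).card + len σ.2 : ℕ) : WithBot ℕ∞) := by
  obtain ⟨h1, h2, u, hu, hug⟩ := (encodes_iff hq.2 σ).1 hσ
  set S : Fin m ⊕ Fin (n - 1) → Finset (Fin n) := fun i => coordSet (q i).1 with hS
  have hqS : ∀ i, (q i).1 = coordSpan (S i : Set (Fin n)) := (isFixed_iff q).1 hq.2
  have hpts : q ∈ (varietyTower h hP).points := by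
    rw [points_varietyTower]
    exact hq.1
  have helim : ∀ y, Sum.elim (fun k => (q k).1) (E n) y =
      coordSpan ((Sum.elim S (initialSet n) y : Finset (Fin n)) : Set (Fin n)) := by
    rintro (k | c)
    · exact hqS k
    · exact E_eq_coordSpan c
  have hlo : ∀ i, (varietyTower h hP).loSet S i ⊆ S i := by
    intro i
    have := (hpts i).1
    rwa [helim, hqS, coordSpan_le_iff, Finset.coe_subset] at this
  have hup : ∀ i, S i ⊆ (varietyTower h hP).upSet S i := by
    intro i
    have := (hpts i).2
    rwa [helim, hqS, coordSpan_le_iff, Finset.coe_subset] at this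
  rw [cell_eq h hP hq.2, Tower.zariskiDim_cell (fun i => by
    rw [← finrank_coordSpan, ← hqS, (q i).2]) hlo hup, card_coord, sum_eq_sum_node (z := z),
    len_eq_card_inversions, ← sum_laterInBlock hu.1 h2]
  refine congrArg (fun k : ℕ => (k : WithBot ℕ∞)) (congrArg₂ (· + ·) ?_ ?_)
  · refine Finset.sum_congr rfl fun j _ => ?_
    have hW := W_eq_coordSpan (z := z) hq.2
    have hSj : ∀ j, S (node z j) = indexSets z q j := fun j => by
      rw [indexSets, W_eq]
    have hl : (varietyTower h hP).loSet S (node z j) =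
        lowerOf wd P (indexSets z q) (initialSet n) j := by
      rw [← funext hSj]
      exact elim_loNode_node S (initialSet n) j
    have hu : (varietyTower h hP).upSet S (node z j) =
        upperOf wd P (indexSets z q) (initialSet n) j := by
      rw [← funext hSj]
      exact elim_upNode_node S (initialSet n) j
    have hsub := (isSubsetFamily_indexSets h hP hq h1 j).lower_subset
    rw [h1 j, card_diagram, T_eq hW, D_eq hW, sdiff_sdiff_sdiff_of_subset hsub, hl, hu, hSj]
  · exact Finset.sum_congr rfl fun k hk =>
      crossings_flag h hP (fun k => (hug k).symm) (Finset.mem_erase.1 hk).1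

end FixedPoints

end Zel

theorem mainTheorem9 {n : ℕ} (z : Fin (n - 1)) (w v w₀ : Equiv.Perm (Fin n))
    (hw : ∀ i, Zel.IsRightAscent w i ↔ i = z)
    (hv : Zel.IsParabolicDecomposition z w v w₀)
    (wd : List (Fin (n - 1))) (hwd : Zel.IsReducedWord wd v)
    {m : ℕ} (P : Fin (m + 1) → Fin wd.length) (hP : Zel.IsPeakOrdering wd P) :
    -- the two tori have the same fixed points
    (∀ q ∈ Zel.variety z wd P, Zel.IsFixed q ↔ Zel.IsFixedC q) ∧
    -- the construction is well defined on the fixed points, with values in the index set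
    (∀ q ∈ Zel.fixedPoints z wd P, ∃! σ, Zel.Encodes z q σ) ∧
    (∀ q ∈ Zel.fixedPoints z wd P, ∀ σ, Zel.Encodes z q σ → σ ∈ Zel.indexSet z wd P) ∧
    -- it is a bijection onto the index set
    (∀ σ ∈ Zel.indexSet z wd P, ∃! q, q ∈ Zel.fixedPoints z wd P ∧ Zel.Encodes z q σ) ∧
    -- the dimension of the cell of the fixed point with tuple `σ`
    (∀ σ ∈ Zel.indexSet z wd P, ∀ q ∈ Zel.fixedPoints z wd P, Zel.Encodes z q σ →
      Zel.zariskiDim (Zel.cell z q) =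
        ((∑ j, (σ.1 j).card + Zel.len σ.2 : ℕ) : WithBot ℕ∞)) := by
  have h : Zel.IsGrassmannianWord z wd :=
    Zel.isGrassmannianWord_of_reduced hwd (Zel.increasingOnBlocks_of_minimal hv.2.1)
  exact ⟨fun q _ => Zel.isFixed_iff_isFixedC q, fun q hq => Zel.existsUnique_encodes hq,
    fun q hq σ hσ => Zel.mem_indexSet_of_encodes h hP hq hσ,
    fun σ hσ => Zel.existsUnique_fixedPoint h hP hσ,
    fun σ _ q hq hqσ => Zel.zariskiDim_cell_of_encodes h hP hq hqσ⟩
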